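/- **Codes.** Let $G(r,m)$ ($m\ge 0$, $r\in\mathbb Z$) be the list of binary rows of length $2^m$ given by $G(r,0)=[1]$ for $r\ge0$, $G(r,0)=\emptyset$ for $r<0$, and $G(r,m)=\begin{bmatrix}G(r,m-1)&G(r,m-1)\\0&G(r-1,m-1)\end{bmatrix}$. $\mathrm{RM}(r,m)$ is its row space. A star denotes removal of the first bit, $\mathrm{RM}^*(r,m)$ is the punctured code, and $\mathrm{RM}^*(r,m)/\{\mathbf 1\}$ is the span of the punctured rows of $G(r,m)$ other than $\mathbf 1$. $A\setminus B$ lists the rows of $A$ not in $B$. For a binary code $D$ and a word $w$ put $|w\rangle_D=|D|^{-1/2}\sum_{c\in D}|w\oplus c\rangle$. A *unitary encoder* of $(D,C)$ with generators $g_1,\dots,g_k$ (linearly independent, spanning a complement of $D$ in $C$) is a unitary $U$ on $n$ qubits with $U\sum_\mu\varphi_\mu|\mu\rangle|0\rangle^{\otimes n-k}=\sum_\mu\varphi_\mu|\sum_j\mu_jg_j\rangle_D$ for all $\varphi$ (where so indicated, message bit $j$ is input at a prescribed qubit instead of qubit $j$, all other qubits being $|0\rangle$). The code $\mathrm{QRM}(r,m)=\mathrm{CSS}(\mathrm{RM}(r,m),\mathrm{RM}(r,m))$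 has the codewords $|w\rangle_D$ with $D=\mathrm{RM}(r,m)^\perp$, $w\in\mathrm{RM}(r,m)$. **Circuits** consist of Hadamards, CNOTs and qubit permutations. Depth is counted with every gate performed as early as possible; permutations are relabellings and take no time. An index map $M$ of a list of rows sends each row to its number in the list, and a qubit number means a position. **Recursive step.** Let $C_1,C_2$ be circuits on $a$ and $2^{m-1}$ qubits with index maps $M_1,M_2$, let $\pi$ be the identity (if $a=2^{m-1}$) or puncturing (if $a=2^{m-1}-1$), and let lists $M$ (rows of length $a+2^{m-1}$) and $G_3,G_4,G_5$ (rows of length $2^{m-1}$) be given. The step applies Hadamards on a stated set of qubits; then any qubit permutation $p$ with $p(M[(\pi u,u)])=M_1[\pi u]$ for $u\in G_3$ and $p(M[(0,v)])=a+M_2[v]$ for $v\in G_4$; then for each $u\in G_5$ a CNOT from qubit $M_1[\pi u]$ to qubit $a+M_2[u]$; then $C_1\otimes C_2$. It returns index map $M$. If not said otherwise, there are no Hadamards and $G_5=G_3$. 1. $U^c(r,m)$, $0\le r\le m$. $U^c(0,0)$ is empty. If $m\geq 1$, $M=G(r,m)$ and $r'=\min(r,m-1)$: $C_1=C_2=U^c(r',m-1)$,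 $G_3=G(r,m-1)$, $G_4=G(r-1,m-1)$ (for $r=m$ both $G_3$ and $G_4$ are $G(m-1,m-1)$). 2. $U(r,m)$, $\lceil (m-1)/2\rceil\le r\le m$. $U(m,m)=U^c(m,m)$. If $r<m$: $C_1=C_2=U(r,m-1)$; $M$ lists $G(r,m)\setminus G(m-r-1,m)$, then $(u,u)$ for $u\in G_2=G(m-r-1,m-1)\setminus G(m-r-2,m-1)$; Hadamards on the $\binom{m-1}{m-r-1}$ qubits numbered by these last rows; $G_3=G(r,m-1)\setminus G(m-r-2,m-1)$, $G_4=G(r-1,m-1)\setminus G(m-r-2,m-1)$. 3. $U^*(r,m)$, $(m-1)/2\le r<m$, on $2^m-1$ qubits. $U^*(0,1)$ is empty. If $r<m-1$: $C_1=U^*(r,m-1)$, $C_2=U(r,m-1)$, $\pi$ puncturing, $M$ lists the starred rows of $\{\mathbf1\}\cup(G(r,m)\setminus G(m-r-1,m))$, then $(u^*,u)$ for $u\in G_2$, with Hadamards on the qubits of the latter; $G_5$ and $G_4$ are the lists $G_3$ and $G_4$ of item 2, and $G_3=\{\mathbf1\}\cup G_5$. If $r=m-1\ge1$: $C_1=U^*(r-1,r)$,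 $C_2=U^c(r-1,r)$, $M=G(r,r+1)^*$, $G_3=G_4=G(r-1,r)$, with in addition $p(M[(e^*,e)])=2^{r+1}-1$ (the last qubit) for $e=0\cdots01$, and between $C_1$ and $C_2$ a CNOT from qubit $2^{r+1}-1$ to qubit $2^r-1$. 4. $U^{(*,c)}(r,m)$, $0\le r<m$. $U^{(*,c)}(r,r+1)=U^*(r,r+1)$. If $r<m-1$: $C_1=U^{(*,c)}(r,m-1)$, $C_2=U^c(r,m-1)$, $M=G(r,m)^*$, $G_3=G(r,m-1)$, $G_4=G(r-1,m-1)$. 5. $U^{(*,s)}(r,m)$ (variant of $U^*$ without generator $\mathbf1$), $(m-1)/2\le r\le m$. $U^{(*,s)}(0,0)$ is empty. If $r<m-1$: as item 3 with $C_1=U^{(*,s)}(r,m-1)$ and $\mathbf 1$ omitted from $M$ and $G_3$. If $m\ge1$ and $r\in\{m-1,m\}$: $C_1=U^{(*,s)}(m-1,m-1)$, $C_2=U(m-1,m-1)$, $M=(G(r,m)\setminus\{\mathbf1\})^*$, $G_3=G(m-1,m-1)\setminus\{\mathbf1\}$, $G_4=G(r-1,m-1)$. 6. $U^{(0)}(r,m;r_\diamond,m_\diamond)$,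 $(r,m)=(r_\diamond-i,m_\diamond-i)$, $0\le i\le\min(r_\diamond+1,m_\diamond-r_\diamond)$, $r_\diamond\geq 0$. If $2r_\diamond+1\le m_\diamond$ and $r=-1$: it is $U^c(r_\diamond,m)$. If $2r_\diamond+1>m_\diamond$ and $m=r_\diamond$: Hadamards on the qubits $M[g]$, $g\in G(r,r_\diamond)$, then $U(r_\diamond,r_\diamond)$, with the index map $M$ of the latter. Otherwise $C_1=C_2=U^{(0)}(r-1,m-1;r_\diamond,m_\diamond)$; $M$ lists $G(r_\diamond,m)\setminus G(r,m)$, then $(u,u)$ for $u\in G(r,m-1)\setminus G(r-1,m-1)$, with Hadamards on the qubits of the latter; $G_3=G(r_\diamond,m-1)\setminus G(r-1,m-1)$, $G_4=G(r_\diamond-1,m-1)\setminus G(r-1,m-1)$. 7. $U^{(*,0)}(r,m;r_\diamond,m_\diamond)$, same form with $0\le i\le\min(r_\diamond,m_\diamond-r_\diamond-1)$. If $2r_\diamond+1\le m_\diamond$ and $r=0$: it is $U^{(*,c)}(r_\diamond,m)$. If $2r_\diamond+1>m_\diamond$ and $m=r_\diamond+1$: Hadamards on the qubits $M[g^*]$,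 $g\in G(r,m)\setminus\{\mathbf1\}$, then $U^*(r_\diamond,r_\diamond+1)$. Otherwise $C_1=U^{(*,0)}(r-1,m-1;r_\diamond,m_\diamond)$, $C_2=U^{(0)}(r-1,m-1;r_\diamond,m_\diamond)$, $M$ lists the starred rows of $\{\mathbf1\}\cup(G(r_\diamond,m)\setminus G(r,m))$, then $(u^*,u)$ for $u\in G(r,m-1)\setminus G(r-1,m-1)$, with Hadamards on the qubits of the latter; $G_5,G_4$ are the lists $G_3,G_4$ of item 6, $G_3=\{\mathbf1\}\cup G_5$. **Theorem.** For all stated parameters each construction can be carried out, and for every admissible choice of the permutations: (a) The resulting circuit is a unitary encoder: - $U(r,m)$ of $\mathrm{QRM}(r,m)$, i.e. of $D=\mathrm{RM}(r,m)^\perp$, $C=\mathrm{RM}(r,m)$, with generators $G(r,m)\setminus G(m-r-1,m)$; - $U^c(r,m)$ of $D=\{0\}$, $C=\mathrm{RM}(r,m)$, with generators $G(r,m)$; - $U^*(r,m)$ of $D=\mathrm{RM}^*(r,m)^\perp$, $C=\mathrm{RM}^*(r,m)$, with generators $(\{\mathbf1\}\cup(G(r,m)\setminus G(m-r-1,m)))^*$;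 - $U^{(*,c)}(r,m)$ of $D=\{0\}$, $C=\mathrm{RM}^*(r,m)$, with generators $G(r,m)^*$; - $U^{(*,s)}(r,m)$ of $D=\mathrm{RM}^*(r,m)^\perp$, $C=\mathrm{RM}^*(r,m)/\{\mathbf1\}$, with generators $(G(r,m)\setminus (G(m-r-1,m)\cup\{\mathbf1\}))^*$; - $U^{(0)}(r,m;r_\diamond,m_\diamond)$ of $D=\mathrm{RM}(r,m)$, $C=\mathrm{RM}(r_\diamond,m)$, with generators $G(r_\diamond,m)\setminus G(r,m)$ input at the qubits given by its index map; - $U^{(*,0)}(r,m;r_\diamond,m_\diamond)$ of $D=\mathrm{RM}^*(r,m)/\{\mathbf1\}$, $C=\mathrm{RM}^*(r_\diamond,m)$, with generators $(\{\mathbf1\}\cup(G(r_\diamond,m)\setminus G(r,m)))^*$ input at the qubits given by its index map. (b) For $r<m$, $U(r,m)$ consists of $\binom{m-1}{m-r-1}$ Hadamards on distinct qubits, a qubit permutation, one layer of $\sum_{i=m-r-1}^{r}\binom{m-1}{i}$ CNOTs on pairwise disjoint pairs of qubits, and $U(r,m-1)^{\otimes2}$. (c) The CNOT counts satisfy: -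 $\zeta(r,m)=\sum_{i=m-r-1}^{r}\binom{m-1}i+2\zeta(r,m-1)$ for $r<m$; $\zeta(m,m)=m2^{m-1}$; - $\zeta^c(r,m)=\sum_{i=0}^r\binom{m-1}i+2\zeta^c(r,m-1)$ for $r<m$; $\zeta^c(m,m)=m2^{m-1}$; - $\zeta^*(r,m)=\sum_{i=m-r-1}^r\binom{m-1}i+\zeta^*(r,m-1)+\zeta(r,m-1)$ for $r<m-1$; $\zeta^*(r,r+1)=2^r+\zeta^*(r-1,r)+\zeta^c(r-1,r)$ for $r\ge1$; $\zeta^*(0,1)=0$; - $\zeta^{(*,c)}(r,m)=\sum_{i=0}^r\binom{m-1}i+\zeta^{(*,c)}(r,m-1)+\zeta^c(r,m-1)$ for $r<m-1$; $\zeta^{(*,c)}(r,r+1)=\zeta^*(r,r+1)$; - $\zeta^{(*,s)}(r,m)=\sum_{i=m-r-1}^r\binom{m-1}i+\zeta^{(*,s)}(r,m-1)+\zeta(r,m-1)$ for $r<m-1$; $\zeta^{(*,s)}(r,m)=2^{m-1}-1+\zeta^{(*,s)}(m-1,m-1)+\zeta(m-1,m-1)$ for $r\in\{m-1,m\}$,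 $m\ge1$; $\zeta^{(*,s)}(1,1)=0$; - $\zeta^{(0)}(r,m)=\sum_{i=r}^{r_\diamond}\binom{m-1}i+2\zeta^{(0)}(r-1,m-1)$ in the third case of item 6, and $\zeta^c(r_\diamond,m)$, $\zeta(r_\diamond,r_\diamond)$ in the first two; - $\zeta^{(*,0)}(r,m)=\sum_{i=r}^{r_\diamond}\binom{m-1}i+\zeta^{(*,0)}(r-1,m-1)+\zeta^{(0)}(r-1,m-1)$ in the third case of item 7, and $\zeta^{(*,c)}(r_\diamond,m)$, $\zeta^*(r_\diamond,r_\diamond+1)$ in the first two. (d) There is an absolute constant $A$ such that, when the number of qubits $n$ is at least $2$, the circuits $U$, $U^c$, $U^{(*,s)}$, $U^{(0)}$ have depth at most $A\log n$, and $U^*$, $U^{(*,c)}$, $U^{(*,0)}$ have depth at most $A\log n$ after a rearrangement that keeps the unitary and the numbers of CNOT and Hadamard gates. After such a rearrangement $U^*(r,r+1)$ has depth at most $3r$. -/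

import Mathlib

namespace QRMEnc

/-! ## Words, lengths, Reed-Muller codes -/

/-- Binary words of length `n`; they also label the computational basis of `n` qubits. -/
abbrev Word (n : ℕ) : Type := Fin n → ZMod 2

/-- The length `2 ^ m`, by recursion, so that the two halves of a word of length `len (m + 1)`
are words of length `len m`. -/
def len : ℕ → ℕ
  | 0 => 1
  | m + 1 => len m + len m

theorem len_eq (m : ℕ) : len m = 2 ^ m := by
  induction m with
  | zero => rfl
  | succ m ih => rw [len, ih, pow_succ]; ring

/-- The punctured length `2 ^ m - 1`. -/
def plen : ℕ → ℕ
  | 0 => 0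
  | m + 1 => plen m + len m

theorem plen_succ (m : ℕ) : plen m + 1 = len m := by
  induction m with
  | zero => rfl
  | succ m ih => rw [len, plen, ← ih]; ring

theorem plen_eq (m : ℕ) : plen m = 2 ^ m - 1 := by
  have h := plen_succ m
  rw [len_eq] at h
  omega

/-- The rows, in order, of the generator matrix `G(r, m)` of the Plotkin construction:
`G(r, m+1) = [G(r, m), G(r, m); 0, G(r-1, m)]`; `G(r, m)` is empty for `r < 0`. -/
def G : ℤ → (m : ℕ) → List (Word (len m))
  | r, 0 => if 0 ≤ r then [1] else []
  | r, m + 1 =>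
      (G r m).map (fun u => Fin.append u u) ++ (G (r - 1) m).map (fun v => Fin.append 0 v)

/-- The rows of `A` that are not rows of `B`, in the order of `A`. -/
def rowDiff {n : ℕ} (A B : List (Word n)) : List (Word n) := A.filter (fun g => g ∉ B)

/-- The Reed-Muller code `RM(r, m)`. -/
def RM (r : ℤ) (m : ℕ) : Submodule (ZMod 2) (Word (len m)) :=
  Submodule.span (ZMod 2) {g | g ∈ G r m}

/-- Puncturing: removal of the first bit. -/
def punct (m : ℕ) : Word (len m) →ₗ[ZMod 2] Word (plen m) :=
  LinearMap.funLeft (ZMod 2) (ZMod 2) (fun i : Fin (plen m) => Fin.cast (plen_succ m) i.succ)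

/-- The punctured Reed-Muller code `RM*(r, m)`. -/
def pRM (r : ℤ) (m : ℕ) : Submodule (ZMod 2) (Word (plen m)) := (RM r m).map (punct m)

/-- `RM*(r, m) / {1}`: the code generated by the punctured rows of `G(r, m)` other than the
all-ones row. -/
def pRMmod (r : ℤ) (m : ℕ) : Submodule (ZMod 2) (Word (plen m)) :=
  Submodule.span (ZMod 2) {c | ∃ g ∈ G r m, g ≠ 1 ∧ punct m g = c}

/-- The dual code. -/
def dual {n : ℕ} (C : Submodule (ZMod 2) (Word n)) : Submodule (ZMod 2) (Word n) where
  carrier := {x | ∀ c ∈ C, x ⬝ᵥ c = 0}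
  add_mem' := by
    intro a b ha hb c hc
    rw [add_dotProduct, ha c hc, hb c hc, add_zero]
  zero_mem' := by
    intro c _
    exact zero_dotProduct c
  smul_mem' := by
    intro t a ha c hc
    rw [smul_dotProduct, ha c hc, smul_zero]

/-! ## States and unitary encoders -/

/-- Vectors of the Hilbert space of `n` qubits, in the computational basis. -/
abbrev State (n : ℕ) : Type := Word n → ℂ

/-- The computational basis state `|b⟩`. -/
def ket {n : ℕ} (b : Word n) : State n := Pi.single b 1

open Classical in
/-- `|D|^(-1/2) ∑_{c ∈ D} |w + c⟩`. With `D = C₁^⊥` it is the codeword `|w⟩` of `CSS(C₁, C₂)`;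
with `D = ⊥` it is the computational basis state `|w⟩`. -/
noncomputable def cosetState {n : ℕ} (D : Submodule (ZMod 2) (Word n)) (w : Word n) : State n :=
  ((1 / Real.sqrt (Nat.card D) : ℝ) : ℂ) • ∑ c : Word n with c ∈ D, ket (w + c)

/-- The `n`-bit string that carries the bit `μ j` at position `pos j`, and zeros elsewhere. -/
def place {n k : ℕ} (pos : Fin k → ℕ) (μ : Word k) : Word n :=
  fun i => ∑ j, if pos j = (i : ℕ) then μ j else 0

/-- `U` is a unitary encoder of the states `cosetState D w`, `w ∈ C`: the rows `gens` are linearly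
independent and span a complement of `D` in `C`, and the unitary `U` maps
`∑ φ(μ) |μ⟩` (message qubit `j` at position `pos j`, all other qubits in `|0⟩`) to
`∑ φ(μ) |w(μ)⟩`, where `w(μ) = ∑ μ_j gens_j`. For `pos = Fin.val` the input is
`|φ⟩ |0⟩^{⊗ (n - k)}`. -/
structure IsEncoder {n : ℕ} (D C : Submodule (ZMod 2) (Word n)) (gens : List (Word n))
    (pos : Fin gens.length → ℕ) (U : Matrix (Word n) (Word n) ℂ) : Prop where
  indep : LinearIndependent (ZMod 2) (fun j : Fin gens.length => gens[j])
  disj : Disjoint (Submodule.span (ZMod 2) {g | g ∈ gens}) D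
  sup : Submodule.span (ZMod 2) {g | g ∈ gens} ⊔ D = C
  unitary : U ∈ Matrix.unitaryGroup (Word n) ℂ
  encodes : ∀ φ : Word gens.length → ℂ,
    U.mulVec (∑ μ, φ μ • ket (place pos μ)) =
      ∑ μ, φ μ • cosetState D (∑ j, μ j • gens[j])

/-! ## Circuits -/

/-- Hadamard gates, CNOT gates (control `i`, target `j`) and qubit permutations. -/
inductive Gate (n : ℕ) : Type
  | h (i : Fin n) : Gate n
  | cnot (i j : Fin n) (hij : i ≠ j) : Gate n
  | perm (p : Equiv.Perm (Fin n)) : Gate n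

/-- Circuits on `n` qubits; the head of the list acts first. -/
abbrev Circuit (n : ℕ) : Type := List (Gate n)

/-- The matrix of a gate: entry `(x, y)` is the amplitude of `|x⟩` in the image of `|y⟩`.
The permutation `p` moves the qubit at position `i` to position `p i`. -/
noncomputable def Gate.mat {n : ℕ} : Gate n → Matrix (Word n) (Word n) ℂ
  | .h i => fun x y =>
      if ∀ j, j ≠ i → x j = y j then
        ((1 / Real.sqrt 2 : ℝ) : ℂ) * (if x i = 1 ∧ y i = 1 then -1 else 1)
      else 0
  | .cnot i j _ => fun x y => if x = Function.update y j (y j + y i) then 1 else 0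
  | .perm p => fun x y => if x = y ∘ p.symm then 1 else 0

/-- The operator of a circuit. -/
noncomputable def Circuit.mat {n : ℕ} : Circuit n → Matrix (Word n) (Word n) ℂ
  | [] => 1
  | g :: C => Circuit.mat C * g.mat

def Gate.isCnot {n : ℕ} : Gate n → Bool
  | .cnot _ _ _ => true
  | _ => false

def Gate.isH {n : ℕ} : Gate n → Bool
  | .h _ => true
  | _ => false

/-- The number of CNOT gates. -/
def Circuit.cnotCount {n : ℕ} (C : Circuit n) : ℕ := C.countP Gate.isCnot

/-- The number of Hadamard gates. -/
def Circuit.hCount {n : ℕ} (C : Circuit n) : ℕ := C.countP Gate.isH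

/-- Update of the time step at which each qubit was last used; every gate is performed as early as
possible, and a qubit permutation is a relabelling that takes no time. -/
def Gate.tick {n : ℕ} : Gate n → (Fin n → ℕ) → (Fin n → ℕ)
  | .h i, l => Function.update l i (l i + 1)
  | .cnot i j _, l =>
      Function.update (Function.update l i (max (l i) (l j) + 1)) j (max (l i) (l j) + 1)
  | .perm p, l => l ∘ p.symm

/-- The depth of a circuit. -/
def Circuit.depth {n : ℕ} (C : Circuit n) : ℕ :=
  Finset.univ.sup (C.foldl (fun l g => g.tick l) 0)

/-- A gate on the first `a` of `a + b` qubits. -/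
def Gate.left {a : ℕ} (b : ℕ) : Gate a → Gate (a + b)
  | .h i => .h (Fin.castAdd b i)
  | .cnot i j hij => .cnot (Fin.castAdd b i) (Fin.castAdd b j)
      (fun e => hij (Fin.castAdd_injective a b e))
  | .perm p => .perm (finSumFinEquiv.permCongr (Equiv.sumCongr p (Equiv.refl (Fin b))))

/-- A gate on the last `b` of `a + b` qubits. -/
def Gate.right (a : ℕ) {b : ℕ} : Gate b → Gate (a + b)
  | .h i => .h (Fin.natAdd a i)
  | .cnot i j hij => .cnot (Fin.natAdd a i) (Fin.natAdd a j)
      (fun e => hij (Fin.natAdd_injective b a e))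
  | .perm p => .perm (finSumFinEquiv.permCongr (Equiv.sumCongr (Equiv.refl (Fin a)) p))

def Circuit.left {a : ℕ} (b : ℕ) (C : Circuit a) : Circuit (a + b) := C.map (Gate.left b)

def Circuit.right (a : ℕ) {b : ℕ} (C : Circuit b) : Circuit (a + b) := C.map (Gate.right a)

/-- `C₁ ⊗ C₂`: `C₁` on the first `a` qubits and `C₂` on the last `b` qubits. -/
def par {a b : ℕ} (C₁ : Circuit a) (C₂ : Circuit b) : Circuit (a + b) :=
  C₁.left b ++ C₂.right a

theorem castAdd_ne_natAdd {a b : ℕ} (i : Fin a) (j : Fin b) :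
    Fin.castAdd b i ≠ Fin.natAdd a j := by
  intro e
  have h := congrArg Fin.val e
  simp only [Fin.val_castAdd, Fin.val_natAdd] at h
  have := i.isLt
  omega

/-- A CNOT gate with control in the first part and target in the second part. -/
def crossCnot {a b : ℕ} (e : Fin a × Fin b) : Gate (a + b) :=
  .cnot (Fin.castAdd b e.1) (Fin.natAdd a e.2) (castAdd_ne_natAdd e.1 e.2)

/-- Hadamard gates on `K`, then a qubit permutation, then an array of CNOT gates from the first
part to the second part. -/
def stage {a b : ℕ} (K : List (Fin (a + b))) (p : Equiv.Perm (Fin (a + b)))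
    (X : List (Fin a × Fin b)) : Circuit (a + b) :=
  K.map Gate.h ++ Gate.perm p :: X.map crossCnot

/-! ## The recursive constructions

A qubit index map is represented by the list `M` of the rows that it indexes: the qubit that
encodes the row `g` is number `M.idxOf g`, counted from `0`. The algorithms leave the image of the
qubits that carry no row free in their permutations, so each algorithm is the relation
"`C`, `M` is a possible output of the algorithm on the given parameters". -/

/-- The condition on the permutation: the qubit of the row `(π u, u)` goes to the qubit of `π u` in
the first part for `u ∈ G₃`, and the qubit of `(0, v)` goes to the qubit of `v` in the second part
for `v ∈ G₄`. Here `π` is the identity or the puncturing map. -/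
def Routes {a b : ℕ} (π : Word b → Word a) (M : List (Word (a + b))) (M₁ : List (Word a))
    (M₂ : List (Word b)) (G₃ G₄ : List (Word b)) (p : Equiv.Perm (Fin (a + b))) : Prop :=
  (∀ u ∈ G₃, ∀ q : Fin (a + b),
    (q : ℕ) = M.idxOf (Fin.append (π u) u) → (p q : ℕ) = M₁.idxOf (π u)) ∧
  (∀ v ∈ G₄, ∀ q : Fin (a + b),
    (q : ℕ) = M.idxOf (Fin.append 0 v) → (p q : ℕ) = a + M₂.idxOf v)

/-- The condition on the CNOT array: one gate for each `u ∈ G₅`, from the qubit of `π u` in the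
first part to the qubit of `u` in the second part. -/
def FanOut {a b : ℕ} (π : Word b → Word a) (M₁ : List (Word a)) (M₂ : List (Word b))
    (G₅ : List (Word b)) (X : List (Fin a × Fin b)) : Prop :=
  X.map (fun e => ((e.1 : ℕ), (e.2 : ℕ))) = G₅.map (fun u => (M₁.idxOf (π u), M₂.idxOf u))

/-- The rows `(π u, u)`, `u ∈ A`. -/
def dbl {a b : ℕ} (π : Word b → Word a) (A : List (Word b)) : List (Word (a + b)) :=
  A.map (fun u => Fin.append (π u) u)

/-- The matrix `[A; B | B]`. -/
def stack {m : ℕ} (A : List (Word (len (m + 1)))) (B : List (Word (len m))) :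
    List (Word (len m + len m)) :=
  List.append A (dbl id B)

/-- The matrix `[A^*; B^* | B]`, where `^*` is the removal of the first column. -/
def stackP {m : ℕ} (A : List (Word (len (m + 1)))) (B : List (Word (len m))) :
    List (Word (plen m + len m)) :=
  List.append (A.map (punct (m + 1))) (dbl (punct m) B)

/-- `U^c(r, m)`: the recursive encoder of computational basis states `|w⟩`, `w ∈ RM(r, m)`. -/
inductive RecBasisQRM : (r m : ℕ) → Circuit (len m) → List (Word (len m)) → Prop
  | base : RecBasisQRM 0 0 [] (G 0 0)
  | step {r m : ℕ} {C : Circuit (len m)} {M₁ : List (Word (len m))}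
      {p : Equiv.Perm (Fin (len m + len m))} {X : List (Fin (len m) × Fin (len m))}
      (hr : r ≤ m) (hC : RecBasisQRM r m C M₁)
      (hp : Routes id (G r (m + 1)) M₁ M₁ (G r m) (G ((r : ℤ) - 1) m) p)
      (hX : FanOut id M₁ M₁ (G r m) X) :
      RecBasisQRM r (m + 1) (stage [] p X ++ par C C) (G r (m + 1))
  | full {m : ℕ} {C : Circuit (len m)} {M₁ : List (Word (len m))}
      {p : Equiv.Perm (Fin (len m + len m))} {X : List (Fin (len m) × Fin (len m))}
      (hC : RecBasisQRM m m C M₁)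
      (hp : Routes id (G ((m + 1 : ℕ) : ℤ) (m + 1)) M₁ M₁ (G m m) (G m m) p)
      (hX : FanOut id M₁ M₁ (G m m) X) :
      RecBasisQRM (m + 1) (m + 1) (stage [] p X ++ par C C) (G ((m + 1 : ℕ) : ℤ) (m + 1))

/-- `U(r, m)`: the recursive encoder of `QRM(r, m)`, for `(m - 1) / 2 ≤ r ≤ m`. -/
inductive RecQRM : (r m : ℕ) → Circuit (len m) → List (Word (len m)) → Prop
  | full {m : ℕ} {C : Circuit (len m)} {M : List (Word (len m))}
      (hC : RecBasisQRM m m C M) : RecQRM m m C M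
  | step {r m : ℕ} {C : Circuit (len m)} {M₁ : List (Word (len m))}
      {M : List (Word (len m + len m))} {K : List (Fin (len m + len m))}
      {p : Equiv.Perm (Fin (len m + len m))} {X : List (Fin (len m) × Fin (len m))}
      (hr : r ≤ m) (hmr : m ≤ 2 * r) (hC : RecQRM r m C M₁)
      (hM : M = stack (rowDiff (G r (m + 1)) (G ((m : ℤ) - r) (m + 1)))
        (rowDiff (G ((m : ℤ) - r) m) (G ((m : ℤ) - r - 1) m)))
      (hK : K.map Fin.val =
        List.range' (∑ i ∈ Finset.Icc (m + 1 - r) r, (m + 1).choose i) (m.choose (m - r)))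
      (hp : Routes id M M₁ M₁ (rowDiff (G r m) (G ((m : ℤ) - r - 1) m))
        (rowDiff (G ((r : ℤ) - 1) m) (G ((m : ℤ) - r - 1) m)) p)
      (hX : FanOut id M₁ M₁ (rowDiff (G r m) (G ((m : ℤ) - r - 1) m)) X) :
      RecQRM r (m + 1) (stage K p X ++ par C C) M

/-- `U^*(r, m)`: the recursive encoder of the punctured code `QRM*(r, m)`, for
`(m - 1) / 2 ≤ r < m`. -/
inductive RecPQRM : (r m : ℕ) → Circuit (plen m) → List (Word (plen m)) → Prop
  | base : RecPQRM 0 1 [] ((G 0 1).map (punct 1))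
  | diag {r : ℕ} {C₁ : Circuit (plen (r + 1))} {C₂ : Circuit (len (r + 1))}
      {M₁ : List (Word (plen (r + 1)))} {M₂ : List (Word (len (r + 1)))}
      {M : List (Word (plen (r + 1) + len (r + 1)))}
      {p : Equiv.Perm (Fin (plen (r + 1) + len (r + 1)))}
      {X : List (Fin (plen (r + 1)) × Fin (len (r + 1)))}
      {e : Word (len (r + 1))} {c : Fin (len (r + 1))} {t : Fin (plen (r + 1))}
      (hC₁ : RecPQRM r (r + 1) C₁ M₁) (hC₂ : RecBasisQRM r (r + 1) C₂ M₂)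
      (hM : M = (G ((r + 1 : ℕ) : ℤ) (r + 2)).map (punct (r + 2)))
      (hp : Routes (punct (r + 1)) M M₁ M₂ (G r (r + 1)) (G r (r + 1)) p)
      -- `e = 0…01`; `c` and `t` are the last qubits of the second and of the first part
      (hc : (c : ℕ) + 1 = len (r + 1)) (ht : (t : ℕ) + 1 = plen (r + 1)) (he : e = Pi.single c 1)
      (hpe : ∀ q : Fin (plen (r + 1) + len (r + 1)),
        (q : ℕ) = M.idxOf (Fin.append (punct (r + 1) e) e) → p q = Fin.natAdd (plen (r + 1)) c)
      (hX : FanOut (punct (r + 1)) M₁ M₂ (G r (r + 1)) X) :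
      RecPQRM (r + 1) (r + 2)
        (stage [] p X ++ C₁.left (len (r + 1)) ++
          Gate.cnot (Fin.natAdd (plen (r + 1)) c) (Fin.castAdd (len (r + 1)) t)
            (castAdd_ne_natAdd t c).symm :: C₂.right (plen (r + 1))) M
  | step {r m : ℕ} {C₁ : Circuit (plen m)} {C₂ : Circuit (len m)}
      {M₁ : List (Word (plen m))} {M₂ : List (Word (len m))}
      {M : List (Word (plen m + len m))} {K : List (Fin (plen m + len m))}
      {p : Equiv.Perm (Fin (plen m + len m))} {X : List (Fin (plen m) × Fin (len m))}
      (hr : r < m) (hmr : m ≤ 2 * r) (hC₁ : RecPQRM r m C₁ M₁) (hC₂ : RecQRM r m C₂ M₂)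
      (hM : M = stackP (1 :: rowDiff (G r (m + 1)) (G ((m : ℤ) - r) (m + 1)))
        (rowDiff (G ((m : ℤ) - r) m) (G ((m : ℤ) - r - 1) m)))
      (hK : K.map Fin.val =
        List.range' (1 + ∑ i ∈ Finset.Icc (m + 1 - r) r, (m + 1).choose i) (m.choose (m - r)))
      (hp : Routes (punct m) M M₁ M₂ (1 :: rowDiff (G r m) (G ((m : ℤ) - r - 1) m))
        (rowDiff (G ((r : ℤ) - 1) m) (G ((m : ℤ) - r - 1) m)) p)
      (hX : FanOut (punct m) M₁ M₂ (rowDiff (G r m) (G ((m : ℤ) - r - 1) m)) X) :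
      RecPQRM r (m + 1) (stage K p X ++ par C₁ C₂) M

/-- `U^{(*,c)}(r, m)`: the recursive encoder of computational basis states `|w⟩`, `w ∈ RM*(r, m)`,
for `0 ≤ r < m`. -/
inductive RecBasisPQRM : (r m : ℕ) → Circuit (plen m) → List (Word (plen m)) → Prop
  | diag {r : ℕ} {C : Circuit (plen (r + 1))} {M : List (Word (plen (r + 1)))}
      (hC : RecPQRM r (r + 1) C M) : RecBasisPQRM r (r + 1) C M
  | step {r m : ℕ} {C₁ : Circuit (plen m)} {C₂ : Circuit (len m)}
      {M₁ : List (Word (plen m))} {M₂ : List (Word (len m))}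
      {M : List (Word (plen m + len m))}
      {p : Equiv.Perm (Fin (plen m + len m))} {X : List (Fin (plen m) × Fin (len m))}
      (hr : r < m) (hC₁ : RecBasisPQRM r m C₁ M₁) (hC₂ : RecBasisQRM r m C₂ M₂)
      (hM : M = (G r (m + 1)).map (punct (m + 1)))
      (hp : Routes (punct m) M M₁ M₂ (G r m) (G ((r : ℤ) - 1) m) p)
      (hX : FanOut (punct m) M₁ M₂ (G r m) X) :
      RecBasisPQRM r (m + 1) (stage [] p X ++ par C₁ C₂) M

/-- `U^{(*,s)}(r, m)`: the state-preparation variant of `U^*(r, m)`, without the generator `1`, for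
`(m - 1) / 2 ≤ r ≤ m`. -/
inductive RecStatePrepPQRM : (r m : ℕ) → Circuit (plen m) → List (Word (plen m)) → Prop
  | base : RecStatePrepPQRM 0 0 [] []
  | full {r : ℕ} {C₁ : Circuit (plen r)} {C₂ : Circuit (len r)}
      {M₁ : List (Word (plen r))} {M₂ : List (Word (len r))} {M : List (Word (plen r + len r))}
      {p : Equiv.Perm (Fin (plen r + len r))} {X : List (Fin (plen r) × Fin (len r))}
      (hC₁ : RecStatePrepPQRM r r C₁ M₁) (hC₂ : RecQRM r r C₂ M₂)
      (hM : M = (rowDiff (G ((r + 1 : ℕ) : ℤ) (r + 1)) [1]).map (punct (r + 1)))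
      (hp : Routes (punct r) M M₁ M₂ (rowDiff (G r r) [1]) (G r r) p)
      (hX : FanOut (punct r) M₁ M₂ (rowDiff (G r r) [1]) X) :
      RecStatePrepPQRM (r + 1) (r + 1) (stage [] p X ++ par C₁ C₂) M
  | diag {r : ℕ} {C₁ : Circuit (plen r)} {C₂ : Circuit (len r)}
      {M₁ : List (Word (plen r))} {M₂ : List (Word (len r))} {M : List (Word (plen r + len r))}
      {p : Equiv.Perm (Fin (plen r + len r))} {X : List (Fin (plen r) × Fin (len r))}
      (hC₁ : RecStatePrepPQRM r r C₁ M₁) (hC₂ : RecQRM r r C₂ M₂)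
      (hM : M = (rowDiff (G r (r + 1)) [1]).map (punct (r + 1)))
      (hp : Routes (punct r) M M₁ M₂ (rowDiff (G r r) [1]) (G ((r : ℤ) - 1) r) p)
      (hX : FanOut (punct r) M₁ M₂ (rowDiff (G r r) [1]) X) :
      RecStatePrepPQRM r (r + 1) (stage [] p X ++ par C₁ C₂) M
  | step {r m : ℕ} {C₁ : Circuit (plen m)} {C₂ : Circuit (len m)}
      {M₁ : List (Word (plen m))} {M₂ : List (Word (len m))}
      {M : List (Word (plen m + len m))} {K : List (Fin (plen m + len m))}
      {p : Equiv.Perm (Fin (plen m + len m))} {X : List (Fin (plen m) × Fin (len m))}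
      (hr : r < m) (hmr : m ≤ 2 * r)
      (hC₁ : RecStatePrepPQRM r m C₁ M₁) (hC₂ : RecQRM r m C₂ M₂)
      (hM : M = stackP (rowDiff (G r (m + 1)) (G ((m : ℤ) - r) (m + 1)))
        (rowDiff (G ((m : ℤ) - r) m) (G ((m : ℤ) - r - 1) m)))
      (hK : K.map Fin.val =
        List.range' (∑ i ∈ Finset.Icc (m + 1 - r) r, (m + 1).choose i) (m.choose (m - r)))
      (hp : Routes (punct m) M M₁ M₂ (rowDiff (G r m) (G ((m : ℤ) - r - 1) m))
        (rowDiff (G ((r : ℤ) - 1) m) (G ((m : ℤ) - r - 1) m)) p)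
      (hX : FanOut (punct m) M₁ M₂ (rowDiff (G r m) (G ((m : ℤ) - r - 1) m)) X) :
      RecStatePrepPQRM r (m + 1) (stage K p X ++ par C₁ C₂) M

/-- `U^{(0)}(r, m; r₀, m₀)`: the recursive encoder of the zero-rate family
`QRM^{(0)}(r, m; r₀, m₀)`, where `(r, m) = (r₀ - i, m₀ - i)`. -/
inductive RecZQRM (r₀ m₀ : ℕ) : ℤ → (m : ℕ) → Circuit (len m) → List (Word (len m)) → Prop
  | basis {m : ℕ} {C : Circuit (len m)} {M : List (Word (len m))}
      (h : 2 * r₀ + 1 ≤ m₀) (hC : RecBasisQRM r₀ m C M) : RecZQRM r₀ m₀ (-1) m C M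
  | full {C : Circuit (len r₀)} {M : List (Word (len r₀))} {K : List (Fin (len r₀))}
      (h : m₀ < 2 * r₀ + 1) (hC : RecQRM r₀ r₀ C M)
      (hK : K.map Fin.val = (G (2 * (r₀ : ℤ) - m₀) r₀).map (fun g => M.idxOf g)) :
      RecZQRM r₀ m₀ (2 * (r₀ : ℤ) - m₀) r₀ (K.map Gate.h ++ C) M
  | step {r m : ℕ} {C : Circuit (len m)} {M₁ : List (Word (len m))}
      {M : List (Word (len m + len m))} {K : List (Fin (len m + len m))}
      {p : Equiv.Perm (Fin (len m + len m))} {X : List (Fin (len m) × Fin (len m))}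
      (hr : r ≤ r₀) (hm : r₀ ≤ m) (hC : RecZQRM r₀ m₀ ((r : ℤ) - 1) m C M₁)
      (hM : M = stack (rowDiff (G r₀ (m + 1)) (G r (m + 1)))
        (rowDiff (G r m) (G ((r : ℤ) - 1) m)))
      (hK : K.map Fin.val =
        List.range' (∑ i ∈ Finset.Icc (r + 1) r₀, (m + 1).choose i) (m.choose r))
      (hp : Routes id M M₁ M₁ (rowDiff (G r₀ m) (G ((r : ℤ) - 1) m))
        (rowDiff (G ((r₀ : ℤ) - 1) m) (G ((r : ℤ) - 1) m)) p)
      (hX : FanOut id M₁ M₁ (rowDiff (G r₀ m) (G ((r : ℤ) - 1) m)) X) :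
      RecZQRM r₀ m₀ r (m + 1) (stage K p X ++ par C C) M

/-- `U^{(*,0)}(r, m; r₀, m₀)`: the recursive encoder of the punctured zero-rate family
`QRM^{(*,0)}(r, m; r₀, m₀)`, where `(r, m) = (r₀ - i, m₀ - i)`. -/
inductive RecPZQRM (r₀ m₀ : ℕ) : ℕ → (m : ℕ) → Circuit (plen m) → List (Word (plen m)) → Prop
  | basis {m : ℕ} {C : Circuit (plen m)} {M : List (Word (plen m))}
      (h : 2 * r₀ + 1 ≤ m₀) (hC : RecBasisPQRM r₀ m C M) : RecPZQRM r₀ m₀ 0 m C M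
  | full {C : Circuit (plen (r₀ + 1))} {M : List (Word (plen (r₀ + 1)))}
      {K : List (Fin (plen (r₀ + 1)))}
      (h : m₀ < 2 * r₀ + 1) (hC : RecPQRM r₀ (r₀ + 1) C M)
      (hK : K.map Fin.val = (rowDiff (G ((2 * r₀ + 1 - m₀ : ℕ) : ℤ) (r₀ + 1)) [1]).map
        (fun g => M.idxOf (punct (r₀ + 1) g))) :
      RecPZQRM r₀ m₀ (2 * r₀ + 1 - m₀) (r₀ + 1) (K.map Gate.h ++ C) M
  | step {r m : ℕ} {C₁ : Circuit (plen m)} {C₂ : Circuit (len m)}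
      {M₁ : List (Word (plen m))} {M₂ : List (Word (len m))}
      {M : List (Word (plen m + len m))} {K : List (Fin (plen m + len m))}
      {p : Equiv.Perm (Fin (plen m + len m))} {X : List (Fin (plen m) × Fin (len m))}
      (hr : r + 1 ≤ r₀) (hm : r₀ + 1 ≤ m)
      (hC₁ : RecPZQRM r₀ m₀ r m C₁ M₁) (hC₂ : RecZQRM r₀ m₀ r m C₂ M₂)
      (hM : M = stackP (1 :: rowDiff (G r₀ (m + 1)) (G ((r + 1 : ℕ) : ℤ) (m + 1)))
        (rowDiff (G ((r + 1 : ℕ) : ℤ) m) (G r m)))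
      (hK : K.map Fin.val =
        List.range' (1 + ∑ i ∈ Finset.Icc (r + 2) r₀, (m + 1).choose i) (m.choose (r + 1)))
      (hp : Routes (punct m) M M₁ M₂ (1 :: rowDiff (G r₀ m) (G r m))
        (rowDiff (G ((r₀ : ℤ) - 1) m) (G r m)) p)
      (hX : FanOut (punct m) M₁ M₂ (rowDiff (G r₀ m) (G r m)) X) :
      RecPZQRM r₀ m₀ (r + 1) (m + 1) (stage K p X ++ par C₁ C₂) M

/-- The parameters of the zero-rate family: `(r, m) = (r₀ - i, m₀ - i)` with
`0 ≤ i ≤ min (r₀ + 1) (m₀ - r₀)`. -/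
def ZRange (r₀ m₀ : ℕ) (r : ℤ) (m : ℕ) : Prop :=
  -1 ≤ r ∧ r ≤ r₀ ∧ r₀ ≤ m ∧ (m₀ : ℤ) - m = r₀ - r

/-- The parameters of the punctured zero-rate family: `(r, m) = (r₀ - i, m₀ - i)` with
`0 ≤ i ≤ min r₀ (m₀ - r₀ - 1)`. -/
def PZRange (r₀ m₀ r m : ℕ) : Prop :=
  r ≤ r₀ ∧ r₀ + 1 ≤ m ∧ (m₀ : ℤ) - m = r₀ - r

/-- `C'` is a rearrangement of `C`: the same operator, with the same numbers of gates. -/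
structure SameGates {n : ℕ} (C C' : Circuit n) : Prop where
  mat : C.mat = C'.mat
  cnots : C.cnotCount = C'.cnotCount
  hs : C.hCount = C'.hCount

end QRMEnc

open QRMEnc

-- `len (m + 1)` has to unfold to `len m + len m`, and `plen (m + 1)` to `plen m + len m`, whenever
-- a word is split into its two parts.
attribute [reducible] QRMEnc.len QRMEnc.plen

/-! Everything is governed by degrees of rows. The `2 ^ m` rows of the full Plotkin matrix,
`fullRows m`, form a basis of the space of words. The degree `rowDeg` of a row counts the steps of
type `(0, v)` in its construction; a step of type `(u, u)` does not change it. Then `G(r, m)`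
consists of the rows of degree at most `r`, and a difference of two such lists is a `band`, the rows
with degree in an interval `(lo, hi]`. Since the dual of `RM(r, m)` is `RM(m - r - 1, m)`
(`dual_RM`), in every unpunctured construction the code `D` is spanned by the rows of degree at most
some `lo`, and the generators are the rows with degree in `(lo, hi]`.

A circuit is studied through `Enc C T D`: for every pair `(x, w)` of the linear relation `T` the
circuit sends `|x⟩` to the coset state of `w`. Because `T` is a subspace, only the unit words of the
message qubits have to be checked. A Hadamard-free prefix pulls `T` back along a linear map
(`Enc.linear_append`), tensor products combine relations (`Enc.par`), and a Hadamard gate on a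
message qubit in state `|0⟩` moves the row of that qubit from the messages into `D`
(`Enc.hadamard`), since the coset state of `D + ⟨b⟩` is the normalized sum of two coset states of
`D`.

For the recursive step, let both halves be encoded modulo `RM(lo - 1, m)`. The permutation and the
CNOT array turn the input bit of `(u, u)` into the input bits of `u` in both halves, and the bit of
`(0, v)` into that of `v` in the second half. This encodes all the rows concerned modulo `RM(lo - 1,
m) ⊕ RM(lo - 1, m)`, which is spanned by the rows `(u, u)` with `deg u < lo` and all `(0, v)` of
degree at most `lo`. What separates this from `RM(lo, m + 1)` is exactly the rows `(u, u)` with `deg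
u = lo`, and these receive the Hadamard gates (`Encodes.linear_step`, `Encodes.band_step`).

Puncturing loses nothing on the span of a set of rows that omits the all-ones row or the row `0…01`:
in the first case the missing bit is zero, in the second it is determined by parity
(`PunctSafe.injOn`). The dual of a punctured code is spanned by punctured rows of positive degree
(`dual_pRM`). Hence, in the steps with Hadamard gates, the all-ones row is a message in the first
part but belongs to the code of the second part, and it needs no CNOT (`Encodes.punct_step`).

On the diagonal, `D` is zero and the row `(e^*, e)` with `e = 0…01` has no counterpart among the
generators of the halves. It enters at the spare last qubit of the second part. There `U^c(r, r +
1)` encodes `e`, since the permutations have no other place left for this qubit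
(`RecBasisQRM.encodes_fullRows`). As `e^*` is a unit word, the additional CNOT supplies the first
half (`Encodes.diag_step`).

The CNOT counts depend only on the parameters. For the depth, each recursive step with Hadamard
gates adds at most two layers. Only the diagonal step is sequential; there the part of the first
circuit that fixes the target of the additional CNOT is moved behind it and run in parallel with the
second circuit (`RecPQRM.exists_split`). -/

namespace QRMEnc

/-! ## The rows of the Plotkin construction -/

/-- All rows of the Plotkin construction, in order. -/
def fullRows : (m : ℕ) → List (Word (len m))
  | 0 => [1]
  | m + 1 => (fullRows m).map (fun u => Fin.append u u) ++
      (fullRows m).map (fun v => Fin.append 0 v)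

/-- The left half of a word. -/
def leftPart {a b : ℕ} : Word (a + b) →ₗ[ZMod 2] Word a :=
  LinearMap.funLeft (ZMod 2) (ZMod 2) (Fin.castAdd b)

/-- The right half of a word. -/
def rightPart {a b : ℕ} : Word (a + b) →ₗ[ZMod 2] Word b :=
  LinearMap.funLeft (ZMod 2) (ZMod 2) (Fin.natAdd a)

@[simp] theorem leftPart_append {a b : ℕ} (x : Word a) (y : Word b) :
    leftPart (Fin.append x y) = x := by
  ext i; simp [leftPart, LinearMap.funLeft]

@[simp] theorem rightPart_append {a b : ℕ} (x : Word a) (y : Word b) :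
    rightPart (Fin.append x y) = y := by
  ext i; simp [rightPart, LinearMap.funLeft]

@[simp] theorem append_parts {a b : ℕ} (x : Word (a + b)) :
    Fin.append (leftPart x) (rightPart x) = x := by
  ext i
  refine Fin.addCases (fun i => ?_) (fun i => ?_) i <;>
    simp [leftPart, rightPart, LinearMap.funLeft]

theorem append_add {a b : ℕ} (x x' : Word a) (y y' : Word b) :
    Fin.append (x + x') (y + y') = Fin.append x y + Fin.append x' y' := by
  ext i
  refine Fin.addCases (fun i => ?_) (fun i => ?_) i <;> simp

theorem append_smul {a b : ℕ} (t : ZMod 2) (x : Word a) (y : Word b) :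
    Fin.append (t • x) (t • y) = t • Fin.append x y := by
  ext i
  refine Fin.addCases (fun i => ?_) (fun i => ?_) i <;> simp

theorem append_one_one {a b : ℕ} : Fin.append (1 : Word a) (1 : Word b) = 1 := by
  ext i
  refine Fin.addCases (fun i => ?_) (fun i => ?_) i <;> simp

theorem append_inj {a b : ℕ} {x x' : Word a} {y y' : Word b} :
    Fin.append x y = Fin.append x' y' ↔ x = x' ∧ y = y' := by
  refine ⟨fun h => ⟨?_, ?_⟩, fun h => by rw [h.1, h.2]⟩
  · simpa using congrArg leftPart h
  · simpa using congrArg rightPart h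

/-- The number of times the right half was chosen in the construction of a row. -/
def rowDeg : (m : ℕ) → Word (len m) → ℕ
  | 0, _ => 0
  | m + 1, g =>
      if leftPart (a := len m) (b := len m) g = rightPart (a := len m) (b := len m) g
      then rowDeg m (rightPart (a := len m) (b := len m) g)
      else rowDeg m (rightPart (a := len m) (b := len m) g) + 1

theorem len_pos (m : ℕ) : 0 < len m := by rw [len_eq]; positivity

theorem one_ne_zero_word (m : ℕ) : (1 : Word (len m)) ≠ 0 := fun h =>
  absurd (congrFun h ⟨0, len_pos m⟩) (by simp)

theorem mem_fullRows_succ {m : ℕ} {g : Word (len m + len m)} :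
    g ∈ fullRows (m + 1) ↔ (∃ u ∈ fullRows m, g = Fin.append u u) ∨
      ∃ v ∈ fullRows m, g = Fin.append 0 v := by
  simp only [fullRows, List.mem_append, List.mem_map, eq_comm]

theorem ne_zero_of_mem_fullRows {m : ℕ} {g : Word (len m)} (hg : g ∈ fullRows m) : g ≠ 0 := by
  induction m with
  | zero =>
    rw [fullRows, List.mem_singleton] at hg
    rw [hg]; exact one_ne_zero_word 0
  | succ m ih =>
    intro h0
    rcases mem_fullRows_succ.1 hg with ⟨u, hu, rfl⟩ | ⟨u, hu, rfl⟩
    · exact ih hu (by simpa using congrArg (rightPart (a := len m) (b := len m)) h0)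
    · exact ih hu (by simpa using congrArg (rightPart (a := len m) (b := len m)) h0)

@[simp] theorem rowDeg_append_self {m : ℕ} (u : Word (len m)) :
    rowDeg (m + 1) (Fin.append u u) = rowDeg m u := by
  rw [rowDeg, leftPart_append, rightPart_append, if_pos rfl]

theorem rowDeg_append_zero {m : ℕ} {v : Word (len m)} (hv : v ∈ fullRows m) :
    rowDeg (m + 1) (Fin.append 0 v) = rowDeg m v + 1 := by
  rw [rowDeg, leftPart_append, rightPart_append, if_neg (ne_zero_of_mem_fullRows hv).symm]

/-- The rows of degree in the interval `(lo, hi]`. -/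
def band (lo hi : ℤ) (m : ℕ) : List (Word (len m)) :=
  (fullRows m).filter (fun g => lo < rowDeg m g ∧ (rowDeg m g : ℤ) ≤ hi)

theorem mem_band {lo hi : ℤ} {m : ℕ} {g : Word (len m)} :
    g ∈ band lo hi m ↔ g ∈ fullRows m ∧ lo < rowDeg m g ∧ (rowDeg m g : ℤ) ≤ hi := by
  simp [band]

/-- A row `(0, v)` has one more step to the right than `v`, which shifts the interval of degrees by
one in the second list. -/
theorem band_succ (lo hi : ℤ) (m : ℕ) :
    band lo hi (m + 1) = (band lo hi m).map (fun u => Fin.append u u) ++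
      (band (lo - 1) (hi - 1) m).map (fun v => Fin.append 0 v) := by
  unfold band
  rw [fullRows, List.filter_append, List.filter_map, List.filter_map]
  congr 2
  · refine List.filter_congr fun u _ => ?_
    simp
  · refine List.filter_congr fun u hu => ?_
    simp only [Function.comp, rowDeg_append_zero hu, decide_eq_decide]
    push_cast
    constructor <;> rintro ⟨h₁, h₂⟩ <;> constructor <;> linarith

/-- Degrees are nonnegative, so any negative lower end gives the same rows. It is left free because
`band_succ` lowers it in the induction. -/
theorem G_eq_band {lo : ℤ} (hlo : lo < 0) (r : ℤ) (m : ℕ) : G r m = band lo r m := by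
  induction m generalizing r lo with
  | zero =>
    by_cases h : 0 ≤ r <;> simp [G, band, fullRows, rowDeg, h, hlo]
  | succ m ih => rw [G, band_succ, ih hlo, ih (show lo - 1 < 0 by linarith)]

theorem mem_G {r : ℤ} {m : ℕ} {g : Word (len m)} :
    g ∈ G r m ↔ g ∈ fullRows m ∧ (rowDeg m g : ℤ) ≤ r := by
  rw [G_eq_band (show (-1 : ℤ) < 0 by norm_num), mem_band]
  constructor
  · rintro ⟨h, -, h'⟩; exact ⟨h, h'⟩
  · rintro ⟨h, h'⟩; exact ⟨h, by omega, h'⟩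

/-- This turns the row lists of the constructions into intervals of degrees, so that membership
becomes integer arithmetic. -/
theorem rowDiff_G (r s : ℤ) (m : ℕ) : rowDiff (G r m) (G s m) = band s r m := by
  rw [rowDiff, G_eq_band (show (-1 : ℤ) < 0 by norm_num) r, band, band, List.filter_filter]
  refine List.filter_congr fun g hg => ?_
  simp only [mem_G, hg, true_and]
  by_cases h : (rowDeg m g : ℤ) ≤ r <;> by_cases h' : (rowDeg m g : ℤ) ≤ s <;>
    simp [h, h', not_lt.2, not_le.1, show (-1 : ℤ) < rowDeg m g by omega]

theorem rowDeg_le {m : ℕ} {g : Word (len m)} (hg : g ∈ fullRows m) : rowDeg m g ≤ m := by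
  induction m with
  | zero => simp [rowDeg]
  | succ m ih =>
    rcases mem_fullRows_succ.1 hg with ⟨u, hu, rfl⟩ | ⟨u, hu, rfl⟩
    · rw [rowDeg_append_self]; exact (ih hu).trans (Nat.le_succ m)
    · rw [rowDeg_append_zero hu]; exact Nat.succ_le_succ (ih hu)

theorem fullRows_length (m : ℕ) : (fullRows m).length = len m := by
  induction m with
  | zero => rfl
  | succ m ih => rw [fullRows, List.length_append, List.length_map, List.length_map, ih, len]

/-- By the decomposition `(x, y) = (x, x) + (0, y - x)`. -/
theorem span_fullRows (m : ℕ) : Submodule.span (ZMod 2) {g | g ∈ fullRows m} = ⊤ := by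
  induction m with
  | zero =>
    refine (Submodule.eq_top_iff').2 fun x => ?_
    have : x = x (0 : Fin 1) • (1 : Word (len 0)) := by
      ext i
      have : i = (0 : Fin 1) := Subsingleton.elim (α := Fin 1) _ _
      rw [this]; simp
    rw [this]
    exact Submodule.smul_mem _ _ (Submodule.subset_span (by simp [fullRows]))
  | succ m ih =>
    refine (Submodule.eq_top_iff').2 fun x => ?_
    let d : Word (len m) →ₗ[ZMod 2] Word (len (m + 1)) :=
      { toFun := fun u => (Fin.append u u : Word (len m + len m))
        map_add' := fun u v => append_add u v u v
        map_smul' := fun t u => append_smul t u u }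
    let z : Word (len m) →ₗ[ZMod 2] Word (len (m + 1)) :=
      { toFun := fun u => (Fin.append 0 u : Word (len m + len m))
        map_add' := fun u v => by rw [← append_add, add_zero]
        map_smul' := fun t u => by rw [RingHom.id_apply, ← append_smul, smul_zero] }
    have hd : ∀ u, d u ∈ Submodule.span (ZMod 2) {g | g ∈ fullRows (m + 1)} := fun u => by
      have hu : u ∈ Submodule.span (ZMod 2) {g | g ∈ fullRows m} := ih ▸ Submodule.mem_top
      refine (Submodule.span_le.2 fun g hg => ?_ : _ ≤ (Submodule.span (ZMod 2) _).comap d) hu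
      exact Submodule.subset_span (mem_fullRows_succ.2 (Or.inl ⟨g, hg, rfl⟩))
    have hz : ∀ u, z u ∈ Submodule.span (ZMod 2) {g | g ∈ fullRows (m + 1)} := fun u => by
      have hu : u ∈ Submodule.span (ZMod 2) {g | g ∈ fullRows m} := ih ▸ Submodule.mem_top
      refine (Submodule.span_le.2 fun g hg => ?_ : _ ≤ (Submodule.span (ZMod 2) _).comap z) hu
      exact Submodule.subset_span (mem_fullRows_succ.2 (Or.inr ⟨g, hg, rfl⟩))
    have hx : x = d (leftPart (a := len m) (b := len m) x) +
        z (rightPart (a := len m) (b := len m) x - leftPart (a := len m) (b := len m) x) := by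
      refine (append_parts (a := len m) (b := len m) x).symm.trans ?_
      change _ = Fin.append _ _ + Fin.append _ _
      rw [← append_add]; congr 1 <;> abel
    rw [hx]
    exact add_mem (hd _) (hz _)

theorem linearIndependent_fullRows (m : ℕ) :
    LinearIndependent (ZMod 2) (fun j : Fin (fullRows m).length => (fullRows m)[j]) := by
  refine linearIndependent_of_top_le_span_of_card_eq_finrank ?_ ?_
  · rw [← span_fullRows m]
    refine Submodule.span_mono fun g hg => ?_
    obtain ⟨i, hi, rfl⟩ := List.getElem_of_mem hg
    exact ⟨⟨i, hi⟩, rfl⟩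
  · simp [fullRows_length]

theorem nodup_fullRows (m : ℕ) : (fullRows m).Nodup := by
  refine List.nodup_iff_injective_get.2 ?_
  exact (linearIndependent_fullRows m).injective

theorem linearIndepOn_fullRows (m : ℕ) :
    LinearIndepOn (ZMod 2) id {g | g ∈ fullRows m} := by
  have h := (linearIndependent_fullRows m).linearIndepOn_id
  convert h using 1
  ext g
  simp only [Set.mem_ofPred_eq, Set.mem_range, List.mem_iff_getElem]
  constructor
  · rintro ⟨i, hi, rfl⟩; exact ⟨⟨i, hi⟩, rfl⟩
  · rintro ⟨i, rfl⟩; exact ⟨i, i.2, rfl⟩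

theorem nodup_band (lo hi : ℤ) (m : ℕ) : (band lo hi m).Nodup := (nodup_fullRows m).filter _

/-- Pascal's rule: a row of degree `d` is `(u, u)` with `u` of degree `d`, or `(0, v)` with `v` of
degree `d - 1`. -/
theorem countP_rowDeg (m d : ℕ) :
    (fullRows m).countP (fun g => rowDeg m g = d) = m.choose d := by
  induction m generalizing d with
  | zero => cases d <;> simp [fullRows, rowDeg]
  | succ m ih =>
    rw [fullRows, List.countP_append, List.countP_map, List.countP_map]
    have h₁ : (fullRows m).countP
        ((fun g => decide (rowDeg (m + 1) g = d)) ∘ fun u => Fin.append u u) = m.choose d := by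
      rw [← ih d]; refine List.countP_congr fun u _ => ?_
      simp
    rw [h₁]
    cases d with
    | zero =>
      rw [Nat.choose_zero_right, Nat.choose_zero_right, List.countP_eq_zero.2]
      intro u hu; simp [rowDeg_append_zero hu]
    | succ d =>
      rw [Nat.choose_succ_succ, ← ih d, add_comm]
      congr 1
      refine List.countP_congr fun u hu => ?_
      simp [rowDeg_append_zero hu]

/-- The half-open interval `(lo, b]` is `Icc a b`; `lo` is an integer because the value `-1` occurs.
-/
theorem length_band {lo : ℤ} {a : ℕ} (h : lo + 1 = a) (b m : ℕ) :
    (band lo b m).length = ∑ i ∈ Finset.Icc a b, m.choose i := by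
  simp only [← countP_rowDeg]
  rw [band, ← List.countP_eq_length_filter]
  generalize fullRows m = l
  induction l with
  | nil => simp
  | cons g l ih =>
    simp only [List.countP_cons, ih, Finset.sum_add_distrib]
    congr 1
    simp only [decide_eq_true_eq, Finset.sum_ite_eq, Finset.mem_Icc]
    congr 1
    rw [eq_iff_iff]; omega

/-! ### The all-ones row -/

theorem one_mem_fullRows (m : ℕ) : 1 ∈ fullRows m := by
  induction m with
  | zero => simp [fullRows]
  | succ m ih => exact mem_fullRows_succ.2 (Or.inl ⟨1, ih, append_one_one.symm⟩)

theorem rowDeg_one (m : ℕ) : rowDeg m 1 = 0 := by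
  induction m with
  | zero => rfl
  | succ m ih =>
    rw [← append_one_one (a := len m) (b := len m), rowDeg_append_self, ih]

theorem rowDeg_eq_zero {m : ℕ} {g : Word (len m)} (hg : g ∈ fullRows m) :
    rowDeg m g = 0 ↔ g = 1 := by
  refine ⟨fun h => ?_, fun h => h ▸ rowDeg_one m⟩
  induction m with
  | zero => simpa [fullRows] using hg
  | succ m ih =>
    rcases mem_fullRows_succ.1 hg with ⟨u, hu, rfl⟩ | ⟨u, hu, rfl⟩
    · rw [rowDeg_append_self] at h
      rw [ih hu h]; exact append_one_one
    · rw [rowDeg_append_zero hu] at h; omega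

theorem fullRows_eq_cons (m : ℕ) : ∃ l, fullRows m = 1 :: l := by
  induction m with
  | zero => exact ⟨[], rfl⟩
  | succ m ih =>
    obtain ⟨l, hl⟩ := ih
    rw [fullRows, hl, List.map_cons, append_one_one]
    exact ⟨_, rfl⟩

theorem G_eq_one_cons {r : ℤ} (hr : 0 ≤ r) (m : ℕ) : G r m = 1 :: band 0 r m := by
  rw [G_eq_band (show (-1 : ℤ) < 0 by norm_num), band, band]
  obtain ⟨l, hl⟩ := fullRows_eq_cons m
  have hn := nodup_fullRows m
  rw [hl] at hn ⊢
  rw [List.nodup_cons] at hn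
  rw [List.filter_cons_of_pos (by simp [rowDeg_one, hr]),
    List.filter_cons_of_neg (by simp [rowDeg_one])]
  congr 1
  refine List.filter_congr fun g hg => ?_
  have h1 : g ≠ 1 := fun h => hn.1 (h ▸ hg)
  have := mt (rowDeg_eq_zero (show g ∈ fullRows m by rw [hl]; exact List.mem_cons_of_mem _ hg)).1 h1
  rw [decide_eq_decide]; omega

/-- The all-ones row is the only row of degree `0`. Its removal raises the lower end to `0`, unless
it was already there or above. -/
theorem rowDiff_one {lo r : ℤ} {m : ℕ} (l : List (Word (len m))) (hl : l = band lo r m) :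
    rowDiff l [1] = band (max lo 0) r m := by
  rw [rowDiff, hl, band, band, List.filter_filter]
  refine List.filter_congr fun g hg => ?_
  have := rowDeg_eq_zero hg
  rw [← Bool.decide_and, decide_eq_decide, List.mem_singleton, ← this]
  omega

theorem rowDiff_G_one (r : ℤ) (m : ℕ) : rowDiff (G r m) [1] = band 0 r m := by
  rw [rowDiff_one _ (G_eq_band (show (-1 : ℤ) < 0 by norm_num) r m)]
  rfl

/-! ### The row of highest degree -/

/-- The word `0…01`. -/
def lastRow (m : ℕ) : Word (len m) := fun i => if (i : ℕ) + 1 = len m then 1 else 0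

theorem lastRow_succ (m : ℕ) : lastRow (m + 1) = Fin.append 0 (lastRow m) := by
  ext i
  refine Fin.addCases (fun i => ?_) (fun i => ?_) i
  · rw [Fin.append_left]
    have := i.2; have := len_pos m
    simp only [lastRow, Fin.val_castAdd, Pi.zero_apply]
    rw [if_neg]; rw [len]; omega
  · rw [Fin.append_right]
    simp only [lastRow, Fin.val_natAdd]
    congr 1; rw [len, eq_iff_iff]; omega

theorem lastRow_mem (m : ℕ) : lastRow m ∈ fullRows m := by
  induction m with
  | zero =>
    simp only [fullRows, List.mem_singleton]
    ext i; have := i.2; simp only [len] at this; simp [lastRow, len]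
  | succ m ih => exact mem_fullRows_succ.2 (Or.inr ⟨_, ih, lastRow_succ m⟩)

theorem rowDeg_lastRow (m : ℕ) : rowDeg m (lastRow m) = m := by
  induction m with
  | zero => rfl
  | succ m ih => rw [lastRow_succ, rowDeg_append_zero (lastRow_mem m), ih]

/-- The only row of degree `m` goes to the right in every step, so it comes last in the list. Its
number is therefore that of the last qubit, which the diagonal step relies on. -/
theorem G_self_eq_concat (m : ℕ) : fullRows m = G ((m : ℤ) - 1) m ++ [lastRow m] := by
  induction m with
  | zero =>
    simp only [fullRows, G]
    congr 1; ext i; have := i.2; simp only [len] at this; simp [lastRow, len]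
  | succ m ih =>
    rw [G, fullRows, Nat.cast_succ, add_sub_cancel_right, List.append_assoc]
    congr 1
    · rw [G_eq_band (show (-1 : ℤ) < 0 by norm_num), band, List.filter_eq_self.2]
      intro g hg; have := rowDeg_le hg; simp; omega
    · rw [lastRow_succ]
      conv_lhs => rw [ih]
      rw [List.map_append]; rfl

theorem fullRows_eq_G {r : ℤ} {m : ℕ} (h : (m : ℤ) ≤ r) : fullRows m = G r m := by
  rw [G_eq_band (show (-1 : ℤ) < 0 by norm_num), band, List.filter_eq_self.2]
  intro g hg; have := rowDeg_le hg; simp; omega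

theorem rowDeg_lt {m : ℕ} {g : Word (len m)} (hg : g ∈ fullRows m) (h : g ≠ lastRow m) :
    rowDeg m g < m := by
  rw [G_self_eq_concat, List.mem_append, List.mem_singleton, or_iff_left h, mem_G] at hg
  omega

/-! ## Dual codes -/

theorem word_add_self {n : ℕ} (x : Word n) : x + x = 0 := by
  ext i; exact CharTwo.add_self_eq_zero (x i)

theorem RM_eq_span {lo : ℤ} (hlo : lo < 0) (r : ℤ) (m : ℕ) :
    RM r m = Submodule.span (ZMod 2) {g | g ∈ band lo r m} := by
  rw [RM, G_eq_band hlo]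

theorem RM_mono {r s : ℤ} (h : r ≤ s) (m : ℕ) : RM r m ≤ RM s m :=
  Submodule.span_mono fun _ hg => mem_G.2 ⟨(mem_G.1 hg).1, (mem_G.1 hg).2.trans h⟩

/-- Concatenation of words. -/
def appendLin (a b : ℕ) : Word a × Word b →ₗ[ZMod 2] Word (a + b) where
  toFun z := Fin.append z.1 z.2
  map_add' z w := append_add z.1 w.1 z.2 w.2
  map_smul' t z := append_smul t z.1 z.2

/-- The map `u ↦ (π u, u)`. -/
def dblLin {a b : ℕ} (π : Word b →ₗ[ZMod 2] Word a) : Word b →ₗ[ZMod 2] Word (a + b) :=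
  appendLin a b ∘ₗ π.prod LinearMap.id

@[simp] theorem dblLin_apply {a b : ℕ} (π : Word b →ₗ[ZMod 2] Word a) (u : Word b) :
    dblLin π u = Fin.append (π u) u := rfl

/-- The map `v ↦ (0, v)`. -/
def inrLin (a b : ℕ) : Word b →ₗ[ZMod 2] Word (a + b) :=
  appendLin a b ∘ₗ LinearMap.inr (ZMod 2) (Word a) (Word b)

@[simp] theorem inrLin_apply {a b : ℕ} (v : Word b) : inrLin a b v = Fin.append 0 v := rfl

theorem RM_succ (r : ℤ) (m : ℕ) :
    RM r (m + 1) = (RM r m).map (dblLin LinearMap.id) ⊔ (RM (r - 1) m).map (inrLin _ _) := by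
  rw [RM, RM, RM, Submodule.map_span, Submodule.map_span, ← Submodule.span_union]
  congr 1
  ext g
  simp [G, eq_comm]

/-- The `(u, u + v)` form of the code: `u = x`, and `v = x + y` in characteristic two. -/
theorem append_mem_RM {r : ℤ} {m : ℕ} {x y : Word (len m)} :
    (Fin.append x y : Word (len m + len m)) ∈ RM r (m + 1) ↔
      x ∈ RM r m ∧ x + y ∈ RM (r - 1) m := by
  rw [RM_succ, Submodule.mem_sup]
  constructor
  · rintro ⟨_, ⟨u, hu, rfl⟩, _, ⟨v, hv, rfl⟩, h⟩
    rw [dblLin_apply, inrLin_apply, LinearMap.id_apply, ← append_add, append_inj, add_zero] at h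
    obtain ⟨rfl, rfl⟩ := h
    refine ⟨hu, ?_⟩
    rwa [← add_assoc, word_add_self, zero_add]
  · rintro ⟨hx, hxy⟩
    refine ⟨_, ⟨x, hx, rfl⟩, _, ⟨_, hxy, rfl⟩, ?_⟩
    rw [dblLin_apply, inrLin_apply, LinearMap.id_apply, ← append_add, add_zero, ← add_assoc,
      word_add_self, zero_add]

theorem append_dotProduct_append {a b : ℕ} (x x' : Word a) (y y' : Word b) :
    Fin.append x y ⬝ᵥ Fin.append x' y' = x ⬝ᵥ x' + y ⬝ᵥ y' := by
  simp [dotProduct, Fin.sum_univ_add]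

theorem mem_dual {n : ℕ} {C : Submodule (ZMod 2) (Word n)} {x : Word n} :
    x ∈ dual C ↔ ∀ c ∈ C, x ⬝ᵥ c = 0 := Iff.rfl

/-- A word `(y, z)` is orthogonal to all `(u, u)` when `y + z` is orthogonal to `RM(r, m)`, and to
all `(0, v)` when `z` is orthogonal to `RM(r - 1, m)`. By induction these are `y + z ∈ RM(m - r - 1,
m)` and `z ∈ RM(m - r, m)`. The codes are nested, so `z` may be replaced by `y` in the second
condition, and this is the description in `append_mem_RM`. -/
theorem dual_RM (r : ℤ) (m : ℕ) : dual (RM r m) = RM (m - r - 1) m := by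
  induction m generalizing r with
  | zero =>
    by_cases h : 0 ≤ r
    · have h₁ : RM r 0 = ⊤ := by rw [RM, ← fullRows_eq_G (by simpa using h), span_fullRows]
      have h₂ : RM (((0 : ℕ) : ℤ) - r - 1) 0 = ⊥ := by
        rw [RM, G, if_neg (by push_cast; omega)]; simp
      rw [h₁, h₂, eq_bot_iff]
      intro x hx
      have := hx (1 : Word 1) trivial
      rw [dotProduct_one] at this
      rw [Submodule.mem_bot]
      ext i
      rw [show i = (0 : Fin 1) from Subsingleton.elim (α := Fin 1) _ _]
      exact (Fin.sum_univ_one (fun i : Fin 1 => x i)).symm.trans this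
    · have h₁ : RM r 0 = ⊥ := by rw [RM, G, if_neg h]; simp
      have h₂ : RM (((0 : ℕ) : ℤ) - r - 1) 0 = ⊤ := by
        rw [RM, ← fullRows_eq_G (by push_cast; omega), span_fullRows]
      rw [h₁, h₂, eq_top_iff]
      intro x _ c hc
      rw [(Submodule.mem_bot _).1 hc, dotProduct_zero]
  | succ m ih =>
    ext x
    obtain ⟨y, z, rfl⟩ : ∃ y z : Word (len m), x = (Fin.append y z : Word (len m + len m)) :=
      ⟨_, _, (append_parts (a := len m) (b := len m) x).symm⟩
    have h₁ : (Fin.append y z : Word (len m + len m)) ∈ dual (RM r (m + 1)) ↔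
        y + z ∈ dual (RM r m) ∧ z ∈ dual (RM (r - 1) m) := by
      simp only [mem_dual]
      constructor
      · intro h
        refine ⟨fun u hu => ?_, fun v hv => ?_⟩
        · have := h (Fin.append u u : Word (len m + len m)) (append_mem_RM.2
            ⟨hu, by rw [word_add_self]; exact zero_mem _⟩)
          rwa [append_dotProduct_append, ← add_dotProduct] at this
        · have := h (Fin.append 0 v : Word (len m + len m)) (append_mem_RM.2
            ⟨zero_mem _, by rwa [zero_add]⟩)
          rwa [append_dotProduct_append, dotProduct_zero, zero_add] at this
      · rintro ⟨h, h'⟩ c hc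
        obtain ⟨u, v, rfl⟩ : ∃ u v : Word (len m), c = (Fin.append u v : Word (len m + len m)) :=
          ⟨_, _, (append_parts (a := len m) (b := len m) c).symm⟩
        rw [append_mem_RM] at hc
        have e₁ := h _ hc.1
        have e₂ := h' _ hc.2
        rw [add_dotProduct] at e₁
        rw [dotProduct_add] at e₂
        rw [append_dotProduct_append]
        have := CharTwo.add_self_eq_zero (z ⬝ᵥ u)
        linear_combination e₁ + e₂ - this
    rw [h₁, ih, ih, append_mem_RM]
    have e₁ : ((m + 1 : ℕ) : ℤ) - r - 1 - 1 = m - r - 1 := by push_cast; ring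
    have e₂ : ((m + 1 : ℕ) : ℤ) - r - 1 = m - (r - 1) - 1 := by push_cast; ring
    rw [e₁, e₂]
    have hm : RM ((m : ℤ) - r - 1) m ≤ RM (m - (r - 1) - 1) m := RM_mono (by linarith) m
    constructor
    · rintro ⟨h, h'⟩
      refine ⟨?_, h⟩
      have := add_mem (hm h) h'
      rwa [add_assoc, word_add_self, add_zero] at this
    · rintro ⟨h, h'⟩
      refine ⟨h', ?_⟩
      have := add_mem h (hm h')
      rwa [← add_assoc, word_add_self, zero_add] at this

/-! ## Puncturing -/

theorem punct_append {m : ℕ} (x y : Word (len m)) :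
    punct (m + 1) (Fin.append x y : Word (len m + len m)) = Fin.append (punct m x) y := by
  have hp := plen_succ m
  ext i
  refine Fin.addCases (fun i => ?_) (fun i => ?_) i
  · rw [Fin.append_left]
    change (Fin.append x y : Word (len m + len m)) _ = x _
    rw [← Fin.append_left x y]
    congr 1
  · rw [Fin.append_right]
    change (Fin.append x y : Word (len m + len m)) _ = _
    rw [← Fin.append_right x y]
    congr 1
    ext
    simp only [Fin.val_cast, Fin.val_succ, Fin.val_natAdd]
    omega

theorem punct_one (m : ℕ) : punct m 1 = 1 := rfl

/-- The first bit of a word. -/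
def firstBit (m : ℕ) : Word (len m) →ₗ[ZMod 2] ZMod 2 := LinearMap.proj ⟨0, len_pos m⟩

theorem firstBit_append {m : ℕ} (x y : Word (len m)) :
    firstBit (m + 1) (Fin.append x y : Word (len m + len m)) = firstBit m x :=
  Fin.append_left x y ⟨0, len_pos m⟩

theorem dotProduct_eq_firstBit_add {m : ℕ} (x y : Word (len m)) :
    x ⬝ᵥ y = firstBit m x * firstBit m y + punct m x ⬝ᵥ punct m y := by
  rw [dotProduct, ← Equiv.sum_comp (finCongr (plen_succ m)), Fin.sum_univ_succ]
  rfl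

/-- A single step to the right puts a zero in the first position, and no later step removes it. -/
theorem firstBit_of_ne_one {m : ℕ} {g : Word (len m)} (hg : g ∈ fullRows m) (h : g ≠ 1) :
    firstBit m g = 0 := by
  induction m with
  | zero => rw [fullRows, List.mem_singleton] at hg; exact absurd hg h
  | succ m ih =>
    rcases mem_fullRows_succ.1 hg with ⟨u, hu, rfl⟩ | ⟨u, hu, rfl⟩
    · rw [firstBit_append]
      exact ih hu (by rintro rfl; exact h append_one_one)
    · rw [firstBit_append, map_zero]

theorem eq_zero_of_punct {m : ℕ} {x : Word (len m)} (h₀ : firstBit m x = 0) (h : punct m x = 0) :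
    x = 0 := by
  ext i
  obtain ⟨j, rfl⟩ := (finCongr (plen_succ m)).surjective i
  refine Fin.cases ?_ (fun j => ?_) j
  · exact h₀
  · exact congrFun h j

theorem punct_eq_of_firstBit {m : ℕ} {x y : Word (len m)} (h₀ : firstBit m x = firstBit m y)
    (h : punct m x = punct m y) : x = y :=
  sub_eq_zero.1 (eq_zero_of_punct (by rw [map_sub, h₀, sub_self]) (by rw [map_sub, h, sub_self]))

/-- The word with first bit `0` and the given punctured word. -/
def unpunct (m : ℕ) (x : Word (plen m)) : Word (len m) :=
  fun i => Fin.cons (α := fun _ => ZMod 2) 0 x (Fin.cast (plen_succ m).symm i)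

theorem punct_unpunct (m : ℕ) (x : Word (plen m)) : punct m (unpunct m x) = x := rfl

theorem firstBit_unpunct (m : ℕ) (x : Word (plen m)) : firstBit m (unpunct m x) = 0 := rfl

/-- Words of even weight are determined by their punctured words. -/
theorem punct_injOn_RM {r : ℤ} {m : ℕ} (hr : r < m) :
    Set.InjOn (punct m) (RM r m) := by
  intro x hx y hy h
  have h1 : (1 : Word (len m)) ∈ dual (RM r m) := by
    rw [dual_RM]
    exact Submodule.subset_span (mem_G.2 ⟨one_mem_fullRows m, by rw [rowDeg_one]; push_cast; omega⟩)
  have h2 := h1 _ (sub_mem hx hy)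
  have h3 : punct m (x - y) = 0 := by rw [map_sub, h, sub_self]
  rw [dotProduct_eq_firstBit_add, h3, dotProduct_zero, add_zero, show firstBit m 1 = 1 from rfl,
    one_mul] at h2
  exact sub_eq_zero.1 (eq_zero_of_punct h2 h3)

theorem firstBit_of_mem_span {m : ℕ} {S : Set (Word (len m))} (hS : ∀ g ∈ S, g ∈ fullRows m)
    (h1 : 1 ∉ S) {x : Word (len m)} (hx : x ∈ Submodule.span (ZMod 2) S) : firstBit m x = 0 := by
  have : Submodule.span (ZMod 2) S ≤ LinearMap.ker (firstBit m) := Submodule.span_le.2 fun g hg =>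
    firstBit_of_ne_one (hS g hg) fun h => h1 (h ▸ hg)
  exact this hx

/-- Sets of rows on which puncturing keeps linear independence. -/
def PunctSafe {m : ℕ} (S : Set (Word (len m))) : Prop :=
  (∀ g ∈ S, g ∈ fullRows m) ∧ (lastRow m ∉ S ∨ 1 ∉ S)

/-- Without the row `0…01` all degrees are below `m`, so the span consists of words of even weight
and the lost bit is a parity. Without the all-ones row the lost bit is always zero. -/
theorem PunctSafe.injOn {m : ℕ} {S : Set (Word (len m))} (h : PunctSafe S) :
    Set.InjOn (punct m) (Submodule.span (ZMod 2) S) := by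
  rcases h.2 with h' | h'
  · refine (punct_injOn_RM (show (m : ℤ) - 1 < m by omega)).mono
      (Submodule.span_mono fun g hg => ?_)
    have := rowDeg_lt (h.1 g hg) (fun e => h' (e ▸ hg))
    exact mem_G.2 ⟨h.1 g hg, by omega⟩
  · intro x hx y hy e
    exact punct_eq_of_firstBit (by
      rw [firstBit_of_mem_span h.1 h' hx, firstBit_of_mem_span h.1 h' hy]) e

theorem PunctSafe.linearIndepOn {m : ℕ} {S : Set (Word (len m))} (h : PunctSafe S) :
    LinearIndepOn (ZMod 2) id (punct m '' S) :=
  ((linearIndepOn_fullRows m).mono h.1).id_imageₛ h.injOn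

/-- The first bit of a word is its coefficient at the all-ones row. -/
theorem mem_span_of_firstBit {r : ℤ} {m : ℕ} {x : Word (len m)} (hx : x ∈ RM r m)
    (h : firstBit m x = 0) : x ∈ Submodule.span (ZMod 2) {g | g ∈ band 0 r m} := by
  by_cases hr : 0 ≤ r
  · have : {g | g ∈ G r m} = insert 1 {g | g ∈ band 0 r m} := by
      ext g; rw [G_eq_one_cons hr]; simp
    rw [RM, this, Submodule.mem_span_insert] at hx
    obtain ⟨a, z, hz, rfl⟩ := hx
    have hz' := firstBit_of_mem_span (fun g hg => (mem_band.1 hg).1)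
      (fun h1 => by have := (mem_band.1 h1).2.1; rw [rowDeg_one] at this; simp at this) hz
    rw [map_add, hz', map_smul, add_zero, show firstBit m 1 = 1 from rfl, smul_eq_mul,
      mul_one] at h
    rwa [h, zero_smul, zero_add]
  · refine Submodule.span_mono (fun g hg => ?_) hx
    have := (mem_G.1 hg).2
    omega

/-- The dual of a punctured code is the shortened dual: `x` is orthogonal to all punctured words
exactly when `(0, x)` is orthogonal to the original ones. The words of the dual with first bit zero
are spanned by the rows other than the all-ones row. -/
theorem dual_pRM (r : ℤ) (m : ℕ) :
    dual (pRM r m) = Submodule.span (ZMod 2) (punct m '' {g | g ∈ band 0 (m - r - 1) m}) := by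
  rw [← Submodule.map_span]
  ext x
  constructor
  · intro hx
    refine ⟨unpunct m x, mem_span_of_firstBit ?_ (firstBit_unpunct m x), punct_unpunct m x⟩
    rw [← dual_RM]
    intro c hc
    rw [dotProduct_eq_firstBit_add, firstBit_unpunct, zero_mul, zero_add, punct_unpunct]
    exact hx _ ⟨c, hc, rfl⟩
  · rintro ⟨y, hy, rfl⟩ _ ⟨c, hc, rfl⟩
    have h₀ := firstBit_of_mem_span (fun g hg => (mem_band.1 hg).1)
      (fun h1 => by have := (mem_band.1 h1).2.1; rw [rowDeg_one] at this; simp at this) hy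
    have hy' : y ∈ dual (RM r m) := by
      rw [dual_RM]
      refine Submodule.span_mono (fun g hg => ?_) hy
      exact mem_G.2 ⟨(mem_band.1 hg).1, (mem_band.1 hg).2.2⟩
    have := hy' c hc
    rwa [dotProduct_eq_firstBit_add, h₀, zero_mul, zero_add] at this

theorem pRM_eq_span (r : ℤ) (m : ℕ) :
    pRM r m = Submodule.span (ZMod 2) (punct m '' {g | g ∈ G r m}) := by
  rw [pRM, RM, Submodule.map_span]

theorem pRMmod_eq_span (r : ℤ) (m : ℕ) :
    pRMmod r m = Submodule.span (ZMod 2) (punct m '' {g | g ∈ band 0 r m}) := by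
  rw [pRMmod]
  congr 1
  ext c
  simp only [Set.mem_ofPred_eq, Set.mem_image, ← rowDiff_G_one, rowDiff, List.mem_filter,
    List.mem_singleton, decide_eq_true_eq, and_assoc]

/-! ## Operators of circuits -/

theorem mulVec_ket {n : ℕ} (A : Matrix (Word n) (Word n) ℂ) (y : Word n) :
    A.mulVec (ket y) = fun x => A x y := by
  rw [ket, Matrix.mulVec_single_one]; rfl

theorem ket_apply {n : ℕ} (y x : Word n) : ket y x = if x = y then 1 else 0 := by
  rw [ket, Pi.single_apply]

/-- The action of a gate on bit strings; Hadamard gates are ignored. -/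
def Gate.bits {n : ℕ} : Gate n → Word n →ₗ[ZMod 2] Word n
  | .h _ => LinearMap.id
  | .cnot i j _ => LinearMap.id +
      (LinearMap.proj i : Word n →ₗ[ZMod 2] ZMod 2).smulRight (Pi.single j 1 : Word n)
  | .perm p => LinearMap.funLeft (ZMod 2) (ZMod 2) p.symm

theorem Gate.bits_cnot {n : ℕ} (i j : Fin n) (hij : i ≠ j) (y : Word n) :
    (Gate.cnot i j hij).bits y = Function.update y j (y j + y i) := by
  ext k
  by_cases hk : k = j
  · subst hk; simp [Gate.bits]
  · simp [Gate.bits, hk]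

theorem Gate.bits_injective {n : ℕ} (g : Gate n) : Function.Injective g.bits := by
  cases g with
  | h i => exact fun _ _ h => h
  | cnot i j hij =>
    intro x y h
    rw [Gate.bits_cnot, Gate.bits_cnot] at h
    have hk : ∀ k, k ≠ j → x k = y k := fun k hk => by simpa [hk] using congrFun h k
    have hj := congrFun h j
    rw [Function.update_self, Function.update_self, hk i hij] at hj
    ext k
    by_cases hkj : k = j
    · rw [hkj]; exact add_right_cancel hj
    · exact hk k hkj
  | perm p => exact LinearMap.funLeft_injective_of_surjective _ _ _ p.symm.surjective

theorem Gate.mat_eq {n : ℕ} {g : Gate n} (hg : g.isH = false) (x y : Word n) :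
    g.mat x y = if x = g.bits y then 1 else 0 := by
  cases g with
  | h i => simp [Gate.isH] at hg
  | cnot i j hij => rw [Gate.bits_cnot]; rfl
  | perm p => rfl

theorem Gate.mat_mulVec_ket {n : ℕ} {g : Gate n} (hg : g.isH = false) (y : Word n) :
    g.mat.mulVec (ket y) = ket (g.bits y) := by
  rw [mulVec_ket]
  funext x
  rw [Gate.mat_eq hg, ket_apply]

theorem eqOff_iff_update {n : ℕ} (x y : Word n) (i : Fin n) :
    (∀ j, j ≠ i → x j = y j) ↔ x = Function.update y i (x i) := by
  constructor
  · intro h; ext j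
    by_cases hj : j = i
    · subst hj; simp
    · simp [hj, h j hj]
  · intro h j hj
    rw [h]; simp [hj]

theorem zmod_two_cases (a : ZMod 2) : a = 0 ∨ a = 1 := by
  revert a; decide

theorem hadamard_mulVec_ket {n : ℕ} (i : Fin n) (y : Word n) :
    (Gate.h i).mat.mulVec (ket y) = ((1 / Real.sqrt 2 : ℝ) : ℂ) •
      (ket (Function.update y i 0) + (if y i = 1 then (-1 : ℂ) else 1) •
        ket (Function.update y i 1)) := by
  rw [mulVec_ket]
  funext x
  simp only [Gate.mat, Pi.smul_apply, Pi.add_apply, ket_apply, smul_eq_mul, eqOff_iff_update]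
  have h01 : (0 : ZMod 2) ≠ 1 := by decide
  have hne : ∀ a, x i ≠ a → x ≠ Function.update y i a := fun a ha h => ha (by
    conv_lhs => rw [h]
    simp)
  rcases zmod_two_cases (x i) with h | h
  · rw [if_neg (hne 1 (by rw [h]; exact h01)), h]
    simp
  · rw [if_neg (hne 0 (by rw [h]; exact h01.symm)), h]
    simp

theorem two_inv_sqrt_sq : ((1 / Real.sqrt 2 : ℝ) : ℂ) * ((1 / Real.sqrt 2 : ℝ) : ℂ) = 1 / 2 := by
  rw [← Complex.ofReal_mul, div_mul_div_comm, Real.mul_self_sqrt (by norm_num)]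
  norm_num

theorem hadamard_mul_self {n : ℕ} (i : Fin n) : (Gate.h i).mat * (Gate.h i).mat = 1 := by
  refine Matrix.ext_of_mulVec_single fun y => ?_
  change _ = Matrix.mulVec 1 (ket y)
  rw [← Matrix.mulVec_mulVec, Matrix.one_mulVec, ← ket, hadamard_mulVec_ket, Matrix.mulVec_smul,
    Matrix.mulVec_add, Matrix.mulVec_smul, hadamard_mulVec_ket, hadamard_mulVec_ket]
  have h01 : (0 : ZMod 2) ≠ 1 := by decide
  simp only [Function.update_idem, Function.update_self, if_neg h01, if_true]
  have hc := two_inv_sqrt_sq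
  generalize ((1 / Real.sqrt 2 : ℝ) : ℂ) = c at hc ⊢
  funext x
  simp only [Pi.smul_apply, Pi.add_apply, smul_eq_mul]
  rcases zmod_two_cases (y i) with h | h
  · have : Function.update y i 0 = y := by rw [← h, Function.update_eq_self]
    rw [h, if_neg h01, this]
    linear_combination 2 * ket y x * hc
  · have : Function.update y i 1 = y := by rw [← h, Function.update_eq_self]
    rw [h, if_pos rfl, this]
    linear_combination 2 * ket y x * hc

/-- A Hadamard gate is a self-adjoint involution; every other gate permutes the basis states. -/
theorem Gate.mat_mem_unitary {n : ℕ} (g : Gate n) :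
    g.mat ∈ Matrix.unitaryGroup (Word n) ℂ := by
  rw [Matrix.mem_unitaryGroup_iff]
  by_cases hg : g.isH
  · cases g with
    | h i =>
      have : star (Gate.h i).mat = (Gate.h i).mat := by
        ext x y
        rw [Matrix.star_apply]
        simp only [Gate.mat]
        have h1 : (∀ j, j ≠ i → y j = x j) ↔ (∀ j, j ≠ i → x j = y j) :=
          ⟨fun h j hj => (h j hj).symm, fun h j hj => (h j hj).symm⟩
        simp only [h1, and_comm (a := y i = 1)]
        split_ifs <;> simp
      rw [this, hadamard_mul_self]
    | cnot i j hij => simp [Gate.isH] at hg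
    | perm p => simp [Gate.isH] at hg
  · rw [Bool.not_eq_true] at hg
    have hb : Function.Bijective g.bits := Finite.injective_iff_bijective.1 g.bits_injective
    ext x y
    rw [Matrix.mul_apply]
    simp only [Matrix.star_apply, Gate.mat_eq hg]
    obtain ⟨z, rfl⟩ := hb.2 x
    rw [Finset.sum_eq_single z]
    · rw [if_pos rfl, one_mul, Matrix.one_apply]
      simp only [eq_comm (a := y)]
      split_ifs <;> simp
    · intro w _ hw
      rw [if_neg fun h => hw (hb.1 h).symm, zero_mul]
    · simp

theorem Circuit.mat_mem_unitary {n : ℕ} (C : Circuit n) :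
    C.mat ∈ Matrix.unitaryGroup (Word n) ℂ := by
  induction C with
  | nil => exact one_mem _
  | cons g C ih => exact mul_mem ih g.mat_mem_unitary

theorem Circuit.mat_append {n : ℕ} (C C' : Circuit n) : Circuit.mat (C ++ C') = C'.mat * C.mat := by
  induction C with
  | nil => rw [List.nil_append]; exact (mul_one _).symm
  | cons g C ih => rw [List.cons_append, Circuit.mat, ih, Circuit.mat, mul_assoc]

/-- The action of a circuit on bit strings; Hadamard gates are ignored. -/
def Circuit.bits {n : ℕ} : Circuit n → Word n →ₗ[ZMod 2] Word n
  | [] => LinearMap.id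
  | g :: C => Circuit.bits C ∘ₗ g.bits

theorem Circuit.bits_append {n : ℕ} (C C' : Circuit n) :
    Circuit.bits (C ++ C') = C'.bits ∘ₗ C.bits := by
  induction C with
  | nil => rfl
  | cons g C ih => rw [List.cons_append, Circuit.bits, ih]; rfl

theorem Circuit.mat_mulVec_ket {n : ℕ} {C : Circuit n} (hC : C.hCount = 0) (y : Word n) :
    C.mat.mulVec (ket y) = ket (C.bits y) := by
  induction C generalizing y with
  | nil => exact Matrix.one_mulVec _
  | cons g C ih =>
    rw [Circuit.hCount, List.countP_cons] at hC
    have hg : g.isH = false := by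
      cases h : g.isH
      · rfl
      · rw [h] at hC; simp at hC
    rw [Circuit.mat, ← Matrix.mulVec_mulVec, Gate.mat_mulVec_ket hg, ih (by
      rw [Circuit.hCount]; omega)]
    rfl

theorem Circuit.mat_eq_of_bits {n : ℕ} {C C' : Circuit n} (hC : C.hCount = 0) (hC' : C'.hCount = 0)
    (h : ∀ y, C.bits y = C'.bits y) : C.mat = C'.mat :=
  Matrix.ext_of_mulVec_single fun y => by
    change C.mat.mulVec (ket y) = C'.mat.mulVec (ket y)
    rw [mat_mulVec_ket hC, mat_mulVec_ket hC', h]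

/-! ### Tensor products -/

theorem append_comp_perm {α : Type*} {a b : ℕ} (x : Fin a → α) (x' : Fin b → α)
    (p : Equiv.Perm (Fin a)) (q : Equiv.Perm (Fin b)) :
    Fin.append x x' ∘ (finSumFinEquiv.permCongr (Equiv.sumCongr p q)).symm =
      Fin.append (x ∘ p.symm) (x' ∘ q.symm) := by
  ext i
  refine Fin.addCases (fun i => ?_) (fun i => ?_) i <;>
    simp [Equiv.permCongr_def]

theorem append_update_left {α : Type*} {a b : ℕ} (x : Fin a → α) (x' : Fin b → α) (i : Fin a)
    (t : α) :
    Function.update (Fin.append x x') (Fin.castAdd b i) t =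
      Fin.append (Function.update x i t) x' := by
  ext j
  refine Fin.addCases (fun j => ?_) (fun j => ?_) j
  · simp [Function.update_apply]
  · rw [Function.update_of_ne (castAdd_ne_natAdd i j).symm, Fin.append_right, Fin.append_right]

theorem append_update_right {α : Type*} {a b : ℕ} (x : Fin a → α) (x' : Fin b → α) (i : Fin b)
    (t : α) :
    Function.update (Fin.append x x') (Fin.natAdd a i) t =
      Fin.append x (Function.update x' i t) := by
  ext j
  refine Fin.addCases (fun j => ?_) (fun j => ?_) j
  · rw [Function.update_of_ne (castAdd_ne_natAdd j i), Fin.append_left, Fin.append_left]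
  · simp [Function.update_apply]

theorem Gate.left_mat {a : ℕ} (b : ℕ) (g : Gate a) (x y : Word a) (x' y' : Word b) :
    (g.left b).mat (Fin.append x x') (Fin.append y y') =
      g.mat x y * if x' = y' then 1 else 0 := by
  cases g with
  | h i =>
    simp only [Gate.left, Gate.mat, eqOff_iff_update, Fin.append_left, append_update_left,
      append_inj]
    by_cases h : x' = y' <;> simp [h]
  | cnot i j hij =>
    simp only [Gate.left, Gate.mat, Fin.append_left, append_update_left, append_inj]
    by_cases h : x' = y' <;> simp [h]
  | perm p =>
    simp only [Gate.left, Gate.mat, append_comp_perm, append_inj]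
    by_cases h : x' = y' <;> simp [h]

theorem Gate.right_mat (a : ℕ) {b : ℕ} (g : Gate b) (x y : Word a) (x' y' : Word b) :
    (g.right a).mat (Fin.append x x') (Fin.append y y') =
      (if x = y then 1 else 0) * g.mat x' y' := by
  cases g with
  | h i =>
    simp only [Gate.right, Gate.mat, eqOff_iff_update, Fin.append_right, append_update_right,
      append_inj]
    by_cases h : x = y <;> simp [h]
  | cnot i j hij =>
    simp only [Gate.right, Gate.mat, Fin.append_right, append_update_right, append_inj]
    by_cases h : x = y <;> simp [h]
  | perm p =>
    simp only [Gate.right, Gate.mat, append_comp_perm, append_inj]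
    by_cases h : x = y <;> simp [h]

/-- Words of length `a + b` as pairs of words. -/
def splitEquiv (a b : ℕ) : Word (a + b) ≃ Word a × Word b where
  toFun z := (leftPart z, rightPart z)
  invFun z := Fin.append z.1 z.2
  left_inv z := append_parts z
  right_inv z := by simp

open scoped Kronecker in
theorem Circuit.left_mat {a : ℕ} (b : ℕ) (C : Circuit a) :
    (C.left b).mat =
      (C.mat ⊗ₖ (1 : Matrix (Word b) (Word b) ℂ)).submatrix (splitEquiv a b) (splitEquiv a b) := by
  induction C with
  | nil => simp [Circuit.left, Circuit.mat]
  | cons g C ih =>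
    have hg : (g.left b).mat = (g.mat ⊗ₖ (1 : Matrix (Word b) (Word b) ℂ)).submatrix
        (splitEquiv a b) (splitEquiv a b) := by
      ext x y
      conv_lhs => rw [← append_parts x, ← append_parts y, Gate.left_mat]
      rw [Matrix.submatrix_apply, Matrix.kronecker_apply, Matrix.one_apply]
      rfl
    change Circuit.mat (Circuit.left b C) * (g.left b).mat = _
    rw [ih, hg, Matrix.submatrix_mul_equiv, ← Matrix.mul_kronecker_mul, one_mul]
    rfl

open scoped Kronecker in
theorem Circuit.right_mat (a : ℕ) {b : ℕ} (C : Circuit b) :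
    (C.right a).mat =
      ((1 : Matrix (Word a) (Word a) ℂ) ⊗ₖ C.mat).submatrix (splitEquiv a b) (splitEquiv a b) := by
  induction C with
  | nil => simp [Circuit.right, Circuit.mat]
  | cons g C ih =>
    have hg : (g.right a).mat = ((1 : Matrix (Word a) (Word a) ℂ) ⊗ₖ g.mat).submatrix
        (splitEquiv a b) (splitEquiv a b) := by
      ext x y
      conv_lhs => rw [← append_parts x, ← append_parts y, Gate.right_mat]
      rw [Matrix.submatrix_apply, Matrix.kronecker_apply, Matrix.one_apply]
      rfl
    change Circuit.mat (Circuit.right a C) * (g.right a).mat = _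
    rw [ih, hg, Matrix.submatrix_mul_equiv, ← Matrix.mul_kronecker_mul, one_mul]
    rfl

open scoped Kronecker in
theorem par_mat {a b : ℕ} (C₁ : Circuit a) (C₂ : Circuit b) :
    (par C₁ C₂).mat = (C₁.mat ⊗ₖ C₂.mat).submatrix (splitEquiv a b) (splitEquiv a b) := by
  rw [par, Circuit.mat_append, Circuit.left_mat, Circuit.right_mat, Matrix.submatrix_mul_equiv,
    ← Matrix.mul_kronecker_mul, one_mul, mul_one]

theorem par_mulVec_ket {a b : ℕ} (C₁ : Circuit a) (C₂ : Circuit b) (x : Word a) (y : Word b) :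
    (par C₁ C₂).mat.mulVec (ket (Fin.append x y)) = fun z =>
      C₁.mat.mulVec (ket x) (leftPart z) * C₂.mat.mulVec (ket y) (rightPart z) := by
  rw [par_mat, mulVec_ket, mulVec_ket, mulVec_ket]
  funext z
  rw [Matrix.submatrix_apply, Matrix.kronecker_apply]
  simp [splitEquiv]

/-! ### Action on bit strings -/

theorem Gate.left_bits {a : ℕ} (b : ℕ) (g : Gate a) (x : Word a) (x' : Word b) :
    (g.left b).bits (Fin.append x x') = Fin.append (g.bits x) x' := by
  cases g with
  | h i => rfl
  | cnot i j hij =>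
    rw [Gate.left, Gate.bits_cnot, Gate.bits_cnot, Fin.append_left, Fin.append_left,
      append_update_left]
  | perm p => exact append_comp_perm x x' p (Equiv.refl _)

theorem Gate.right_bits (a : ℕ) {b : ℕ} (g : Gate b) (x : Word a) (x' : Word b) :
    (g.right a).bits (Fin.append x x') = Fin.append x (g.bits x') := by
  cases g with
  | h i => rfl
  | cnot i j hij =>
    rw [Gate.right, Gate.bits_cnot, Gate.bits_cnot, Fin.append_right, Fin.append_right,
      append_update_right]
  | perm p => exact append_comp_perm x x' (Equiv.refl _) p

theorem Circuit.left_bits {a : ℕ} (b : ℕ) (C : Circuit a) (x : Word a) (x' : Word b) :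
    (C.left b).bits (Fin.append x x') = Fin.append (C.bits x) x' := by
  induction C generalizing x with
  | nil => rfl
  | cons g C ih =>
    change Circuit.bits (Circuit.left b C) ((g.left b).bits _) = _
    rw [Gate.left_bits, ih]; rfl

theorem Circuit.right_bits (a : ℕ) {b : ℕ} (C : Circuit b) (x : Word a) (x' : Word b) :
    (C.right a).bits (Fin.append x x') = Fin.append x (C.bits x') := by
  induction C generalizing x' with
  | nil => rfl
  | cons g C ih =>
    change Circuit.bits (Circuit.right a C) ((g.right a).bits _) = _
    rw [Gate.right_bits, ih]; rfl

theorem bits_crossCnot {a b : ℕ} (e : Fin a × Fin b) (x : Word a) (y : Word b) :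
    (crossCnot e).bits (Fin.append x y) = Fin.append x (y + x e.1 • Pi.single e.2 1) := by
  rw [crossCnot, Gate.bits_cnot, Fin.append_right, Fin.append_left, append_update_right]
  congr 1
  ext k
  by_cases hk : k = e.2
  · subst hk; simp
  · simp [hk]

/-- All controls lie in the first part, which none of the gates changes, so the contributions to the
second part simply add up. -/
theorem bits_map_crossCnot {a b : ℕ} (X : List (Fin a × Fin b)) (x : Word a) (y : Word b) :
    Circuit.bits (X.map crossCnot) (Fin.append x y) =
      Fin.append x (y + (X.map fun e => x e.1 • (Pi.single e.2 1 : Word b)).sum) := by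
  induction X generalizing y with
  | nil => simp [Circuit.bits]
  | cons e X ih =>
    change Circuit.bits (X.map crossCnot) ((crossCnot e).bits _) = _
    rw [bits_crossCnot, ih, List.map_cons, List.sum_cons, add_assoc]

/-! ## Coset states -/

theorem cosetState_apply {n : ℕ} (D : Submodule (ZMod 2) (Word n)) (w x : Word n)
    [Decidable (w + x ∈ D)] : cosetState D w x =
      if w + x ∈ D then ((1 / Real.sqrt (Nat.card D) : ℝ) : ℂ) else 0 := by
  classical
  rw [cosetState, Pi.smul_apply, Finset.sum_apply]
  simp only [ket_apply, Finset.sum_filter, smul_eq_mul]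
  rw [Finset.sum_eq_single (w + x)]
  · rw [← add_assoc, word_add_self, zero_add, if_pos rfl]
    split_ifs <;> simp
  · intro c _ hc
    rw [if_neg (fun h : x = w + c => hc (by rw [h, ← add_assoc, word_add_self, zero_add])),
      ite_self]
  · simp

theorem cosetState_congr {n : ℕ} {D : Submodule (ZMod 2) (Word n)} {w w' : Word n}
    (h : w + w' ∈ D) : cosetState D w = cosetState D w' := by
  classical
  funext x
  rw [cosetState_apply, cosetState_apply]
  congr 1
  rw [eq_iff_iff]
  have e : w + x + (w' + x) = w + w' := by
    rw [add_add_add_comm, word_add_self, add_zero]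
  constructor
  · intro hx
    have := add_mem hx h
    rw [← e, ← add_assoc, word_add_self, zero_add] at this
    exact this
  · intro hx
    have := add_mem h hx
    rw [← e, add_assoc, word_add_self, add_zero] at this
    exact this

theorem cosetState_bot {n : ℕ} (w : Word n) : cosetState ⊥ w = ket w := by
  classical
  funext x
  rw [cosetState_apply, ket_apply]
  have : w + x ∈ (⊥ : Submodule (ZMod 2) (Word n)) ↔ x = w := by
    rw [Submodule.mem_bot]
    constructor
    · intro h
      have := congrArg (w + ·) h
      simpa [← add_assoc, word_add_self] using this
    · rintro rfl; exact word_add_self x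
  simp [this]

/-- The direct sum of two codes. -/
def prodCode {a b : ℕ} (D₁ : Submodule (ZMod 2) (Word a)) (D₂ : Submodule (ZMod 2) (Word b)) :
    Submodule (ZMod 2) (Word (a + b)) := (D₁.prod D₂).map (appendLin a b)

theorem append_mem_prodCode {a b : ℕ} {D₁ : Submodule (ZMod 2) (Word a)}
    {D₂ : Submodule (ZMod 2) (Word b)} {x : Word a} {y : Word b} :
    Fin.append x y ∈ prodCode D₁ D₂ ↔ x ∈ D₁ ∧ y ∈ D₂ := by
  constructor
  · rintro ⟨⟨u, v⟩, ⟨hu, hv⟩, h⟩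
    obtain ⟨rfl, rfl⟩ := append_inj.1 h
    exact ⟨hu, hv⟩
  · rintro ⟨hx, hy⟩; exact ⟨(x, y), ⟨hx, hy⟩, rfl⟩

theorem appendLin_injective (a b : ℕ) : Function.Injective (appendLin a b) := fun _ _ h =>
  Prod.ext (append_inj.1 h).1 (append_inj.1 h).2

theorem card_prodCode {a b : ℕ} (D₁ : Submodule (ZMod 2) (Word a))
    (D₂ : Submodule (ZMod 2) (Word b)) :
    Nat.card (prodCode D₁ D₂) = Nat.card D₁ * Nat.card D₂ := by
  rw [← Nat.card_prod]
  exact Nat.card_congr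
    ((Submodule.equivMapOfInjective _ (appendLin_injective a b) _).symm.toEquiv.trans
    (Equiv.Set.prod (D₁ : Set (Word a)) (D₂ : Set (Word b))))

theorem cosetState_prodCode {a b : ℕ} (D₁ : Submodule (ZMod 2) (Word a))
    (D₂ : Submodule (ZMod 2) (Word b)) (x : Word a) (y : Word b) :
    cosetState (prodCode D₁ D₂) (Fin.append x y) = fun z =>
      cosetState D₁ x (leftPart z) * cosetState D₂ y (rightPart z) := by
  classical
  funext z
  have h : Fin.append x y + z ∈ prodCode D₁ D₂ ↔
      x + leftPart z ∈ D₁ ∧ y + rightPart z ∈ D₂ := by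
    rw [← append_mem_prodCode, append_add, append_parts]
  rw [cosetState_apply, cosetState_apply, cosetState_apply, card_prodCode, Nat.cast_mul,
    Real.sqrt_mul (Nat.cast_nonneg _)]
  by_cases h₁ : x + leftPart z ∈ D₁ <;> by_cases h₂ : y + rightPart z ∈ D₂ <;>
    simp [h, h₁, h₂, mul_comm]

theorem mem_sup_span_singleton {n : ℕ} {D : Submodule (ZMod 2) (Word n)} {b x : Word n} :
    x ∈ D ⊔ Submodule.span (ZMod 2) {b} ↔ x ∈ D ∨ x + b ∈ D := by
  rw [Submodule.mem_sup]
  constructor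
  · rintro ⟨y, hy, z, hz, rfl⟩
    obtain ⟨t, rfl⟩ := Submodule.mem_span_singleton.1 hz
    rcases zmod_two_cases t with rfl | rfl
    · left; simpa using hy
    · right; rwa [one_smul, add_assoc, word_add_self, add_zero]
  · rintro (h | h)
    · exact ⟨x, h, 0, zero_mem _, add_zero x⟩
    · exact ⟨_, h, b, Submodule.mem_span_singleton_self b, by
        rw [add_assoc, word_add_self, add_zero]⟩

theorem card_sup_span_singleton {n : ℕ} {D : Submodule (ZMod 2) (Word n)} {b : Word n}
    (hb : b ∉ D) : Nat.card ↥(D ⊔ Submodule.span (ZMod 2) {b}) = 2 * Nat.card D := by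
  have hb0 : b ≠ 0 := fun h => hb (h ▸ zero_mem D)
  have h := Submodule.finrank_sup_add_finrank_inf_eq D (Submodule.span (ZMod 2) {b})
  have hinf : D ⊓ Submodule.span (ZMod 2) {b} = ⊥ := by
    rw [eq_bot_iff]
    rintro x ⟨hx, hx'⟩
    obtain ⟨t, rfl⟩ := Submodule.mem_span_singleton.1 hx'
    rcases zmod_two_cases t with rfl | rfl
    · simp
    · exact absurd (by simpa using hx) hb
  rw [hinf, finrank_bot, finrank_span_singleton hb0, add_zero] at h
  rw [Module.natCard_eq_pow_finrank (K := ZMod 2),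
    Module.natCard_eq_pow_finrank (K := ZMod 2) (V := D),
    h, Nat.card_zmod, pow_succ, mul_comm]

/-- The coset of `w` modulo the larger code is the disjoint union of the cosets of `w` and `w + b`
modulo `D`. The factor `1 / √2` accounts for the doubled cardinality. -/
theorem cosetState_sup {n : ℕ} {D : Submodule (ZMod 2) (Word n)} {b : Word n} (hb : b ∉ D)
    (w : Word n) : cosetState (D ⊔ Submodule.span (ZMod 2) {b}) w =
      ((1 / Real.sqrt 2 : ℝ) : ℂ) • (cosetState D w + cosetState D (w + b)) := by
  classical
  funext x
  rw [Pi.smul_apply, Pi.add_apply, cosetState_apply, cosetState_apply, cosetState_apply,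
    card_sup_span_singleton hb, Nat.cast_mul, Real.sqrt_mul (by norm_num), mem_sup_span_singleton,
    add_right_comm w b x]
  by_cases h₁ : w + x ∈ D
  · have h₂ : w + x + b ∉ D := fun h => hb (by
      have := add_mem h₁ h
      rwa [← add_assoc, word_add_self, zero_add] at this)
    simp [h₁, h₂, mul_comm]
  · by_cases h₂ : w + x + b ∈ D <;> simp [h₁, h₂, mul_comm]

/-! ## Encoding relations -/

/-- For all `(x, w) ∈ T`, the circuit maps `|x⟩` to the coset state of `w`. -/
def Enc {n : ℕ} (C : Circuit n) (T : Submodule (ZMod 2) (Word n × Word n))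
    (D : Submodule (ZMod 2) (Word n)) : Prop :=
  ∀ x w, (x, w) ∈ T → C.mat.mulVec (ket x) = cosetState D w

theorem Enc.mono {n : ℕ} {C : Circuit n} {T T' : Submodule (ZMod 2) (Word n × Word n)}
    {D : Submodule (ZMod 2) (Word n)} (h : Enc C T D) (hT : T' ≤ T) : Enc C T' D :=
  fun x w hz => h x w (hT hz)

/-- A coset state does not change when a word of `D` is added to its label. In particular the zero
input also encodes every word of `D`, which is why a row of the code needs no input bit. -/
theorem Enc.sup_code {n : ℕ} {C : Circuit n} {T : Submodule (ZMod 2) (Word n × Word n)}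
    {D : Submodule (ZMod 2) (Word n)} (h : Enc C T D) :
    Enc C (T ⊔ D.map (LinearMap.inr (ZMod 2) (Word n) (Word n))) D := by
  intro x w hz
  obtain ⟨⟨y, v⟩, hy, _, ⟨d, hd, rfl⟩, e⟩ := Submodule.mem_sup.1 hz
  obtain ⟨rfl, rfl⟩ := Prod.ext_iff.1 e
  have hd' : v + d + v ∈ D := by rwa [add_right_comm, word_add_self, zero_add]
  change C.mat.mulVec (ket (y + 0)) = cosetState D (v + d)
  rw [add_zero, h y v hy, cosetState_congr hd']

/-- Without Hadamard gates the prefix maps basis states to basis states by a linear map of the bit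
strings. -/
theorem Enc.linear_append {n : ℕ} {P C : Circuit n} {T : Submodule (ZMod 2) (Word n × Word n)}
    {D : Submodule (ZMod 2) (Word n)} (hP : P.hCount = 0) (h : Enc C T D) :
    Enc (P ++ C) (T.comap (P.bits.prodMap LinearMap.id)) D := by
  intro x w hz
  rw [Circuit.mat_append, ← Matrix.mulVec_mulVec, Circuit.mat_mulVec_ket hP]
  exact h (P.bits x) w hz

theorem Enc.par {a b : ℕ} {C₁ : Circuit a} {C₂ : Circuit b}
    {T₁ : Submodule (ZMod 2) (Word a × Word a)} {T₂ : Submodule (ZMod 2) (Word b × Word b)}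
    {D₁ : Submodule (ZMod 2) (Word a)} {D₂ : Submodule (ZMod 2) (Word b)}
    (h₁ : Enc C₁ T₁ D₁) (h₂ : Enc C₂ T₂ D₂) :
    Enc (par C₁ C₂) (T₁.comap (leftPart.prodMap leftPart) ⊓
      T₂.comap (rightPart.prodMap rightPart)) (prodCode D₁ D₂) := by
  rintro x w ⟨hz₁, hz₂⟩
  have e₁ := h₁ (leftPart x) (leftPart w) hz₁
  have e₂ := h₂ (rightPart x) (rightPart w) hz₂
  rw [← append_parts x, ← append_parts w, par_mulVec_ket, cosetState_prodCode, e₁, e₂]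

/-! ### Hadamard gates enlarge the code -/

/-- Pairs whose first component vanishes on `I`. -/
def vanishOn {n : ℕ} (I : Set (Fin n)) : Submodule (ZMod 2) (Word n × Word n) where
  carrier := {z | ∀ i ∈ I, z.1 i = 0}
  add_mem' := by
    intro x y hx hy i hi
    simp [hx i hi, hy i hi]
  zero_mem' := by intro i _; rfl
  smul_mem' := by
    intro t x hx i hi
    simp [hx i hi]

/-- On a bit equal to zero the gate produces the normalized sum of `|x⟩` and `|x + e_i⟩`. The
circuit sends these to the coset states of `w` and `w + b`, and `cosetState_sup` adds them. -/
theorem Enc.hadamard {n : ℕ} {C : Circuit n} {T : Submodule (ZMod 2) (Word n × Word n)}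
    {D : Submodule (ZMod 2) (Word n)} (h : Enc C T D) {i : Fin n} {b : Word n}
    (hT : ((Pi.single i 1 : Word n), b) ∈ T) (hb : b ∉ D) :
    Enc (Gate.h i :: C) (T ⊓ vanishOn {i}) (D ⊔ Submodule.span (ZMod 2) {b}) := by
  rintro x w ⟨hz, hi⟩
  have hi : x i = 0 := hi i rfl
  have h1 : Function.update x i 0 = x := by rw [← hi, Function.update_eq_self]
  have h2 : Function.update x i 1 = x + Pi.single i 1 := by
    ext k
    by_cases hk : k = i
    · subst hk; simp [hi]
    · simp [hk]
  have e₁ := h x w hz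
  have e₂ := h (x + Pi.single i 1) (w + b) (add_mem hz hT)
  rw [Circuit.mat, ← Matrix.mulVec_mulVec, hadamard_mulVec_ket, h1, h2, hi,
    if_neg (show (0 : ZMod 2) ≠ 1 by decide), one_smul, Matrix.mulVec_smul, Matrix.mulVec_add, e₁,
    e₂, cosetState_sup hb]

theorem Enc.hadamards {n : ℕ} {C : Circuit n} {T : Submodule (ZMod 2) (Word n × Word n)}
    {B : Set (Word n)} (h : Enc C T (Submodule.span (ZMod 2) B)) (L : List (Fin n × Word n))
    (hT : ∀ e ∈ L, ((Pi.single e.1 1 : Word n), e.2) ∈ T) (hL₁ : (L.map Prod.fst).Nodup)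
    (hL₂ : (L.map Prod.snd).Nodup) (hind : LinearIndepOn (ZMod 2) id (B ∪ {b | b ∈ L.map Prod.snd}))
    (hdisj : ∀ b ∈ L.map Prod.snd, b ∉ B) :
    Enc (L.map (fun e => Gate.h e.1) ++ C) (T ⊓ vanishOn {i | i ∈ L.map Prod.fst})
      (Submodule.span (ZMod 2) (B ∪ {b | b ∈ L.map Prod.snd})) := by
  induction L with
  | nil => simpa using h.mono inf_le_left
  | cons e L ih =>
    simp only [List.map_cons, List.nodup_cons, List.mem_cons, forall_eq_or_imp] at *
    have hs : B ∪ {b | b ∈ L.map Prod.snd} ⊆ B ∪ {b | b = e.2 ∨ b ∈ L.map Prod.snd} :=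
      Set.union_subset_union_right _ fun b hb => Or.inr hb
    have ih := ih hT.2 hL₁.2 hL₂.2 (hind.mono hs) hdisj.2
    -- Each new row has to lie outside the code built so far; this is where joint independence
    -- enters.
    have hb : e.2 ∉ Submodule.span (ZMod 2) (B ∪ {b | b ∈ L.map Prod.snd}) := by
      have := hind.notMem_span (show e.2 ∈ B ∪ {b | b = e.2 ∨ b ∈ L.map Prod.snd} from
        Or.inr (Or.inl rfl))
      rw [Set.image_id] at this
      refine fun h' => this
        (Submodule.span_mono (fun b hb => Set.mem_sdiff_singleton.2 ⟨hs hb, ?_⟩) h')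
      rintro rfl
      rcases hb with hb | hb
      · exact hdisj.1 hb
      · exact hL₂.1 hb
    -- The pair of the current gate survives the restriction imposed by the other gates, because the
    -- qubits are distinct.
    have hv : ((Pi.single e.1 1 : Word n), e.2) ∈
        vanishOn {i | i ∈ L.map Prod.fst} := fun i hi => by
      refine Pi.single_eq_of_ne ?_ _
      rintro rfl; exact hL₁.1 hi
    have := ih.hadamard (i := e.1) (b := e.2) ⟨hT.1, hv⟩ hb
    rw [← Submodule.span_union] at this
    rw [List.cons_append]
    convert this.mono (T' := T ⊓ vanishOn {i | i = e.1 ∨ i ∈ L.map Prod.fst}) ?_ using 2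
    · ext b; simp only [Set.mem_union, Set.mem_ofPred_eq, Set.mem_singleton_iff]; tauto
    · rintro z ⟨hz, hz'⟩
      exact ⟨⟨hz, fun i hi => hz' i (Or.inr hi)⟩, fun i hi => hz' i (Or.inl hi)⟩

/-! ### Index maps and message rows -/

/-- The basis word of the qubit number `k`. -/
def unitWord (n k : ℕ) : Word n := fun i => if k = (i : ℕ) then 1 else 0

theorem unitWord_val {n : ℕ} (i : Fin n) : unitWord n i = Pi.single i 1 := by
  ext j
  simp only [unitWord, Pi.single_apply, Fin.ext_iff, eq_comm]

theorem unitWord_left {a b k : ℕ} (hk : k < a) :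
    unitWord (a + b) k = Fin.append (unitWord a k) 0 := by
  ext i
  refine Fin.addCases (fun i => ?_) (fun i => ?_) i
  · rw [Fin.append_left]; rfl
  · rw [Fin.append_right]
    simp only [unitWord, Fin.val_natAdd, Pi.zero_apply]
    rw [if_neg (by omega)]

theorem unitWord_right (a b k : ℕ) :
    unitWord (a + b) (a + k) = Fin.append 0 (unitWord b k) := by
  ext i
  refine Fin.addCases (fun i => ?_) (fun i => ?_) i
  · rw [Fin.append_left]
    simp only [unitWord, Fin.val_castAdd, Pi.zero_apply]
    rw [if_neg (by omega)]
  · rw [Fin.append_right]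
    simp only [unitWord, Fin.val_natAdd, Nat.add_left_cancel_iff]

theorem perm_bits_unitWord {n : ℕ} (p : Equiv.Perm (Fin n)) (q : Fin n) :
    (Gate.perm p).bits (unitWord n q) = unitWord n (p q) := by
  rw [unitWord_val, unitWord_val]
  ext i
  simp [Gate.bits, LinearMap.funLeft, Pi.single_apply, Equiv.symm_apply_eq]

/-- The inputs and outputs of the message rows `S`, for the index map `M`. -/
def msgRel {n : ℕ} (M : List (Word n)) (S : Set (Word n)) :
    Submodule (ZMod 2) (Word n × Word n) :=
  Submodule.span (ZMod 2) ((fun g => (unitWord n (M.idxOf g), g)) '' S)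

theorem mem_msgRel {n : ℕ} {M : List (Word n)} {S : Set (Word n)} {g : Word n} (hg : g ∈ S) :
    (unitWord n (M.idxOf g), g) ∈ msgRel M S :=
  Submodule.subset_span ⟨g, hg, rfl⟩

/-- The circuit `C` with index map `M` encodes the rows `S`, modulo the code spanned by `B`. -/
structure Encodes {n : ℕ} (C : Circuit n) (M : List (Word n)) (S B : Set (Word n)) : Prop where
  nodup : M.Nodup
  length_le : M.length ≤ n
  mem : ∀ g ∈ S, g ∈ M
  enc : Enc C (msgRel M S) (Submodule.span (ZMod 2) B)

theorem Encodes.idxOf_lt {n : ℕ} {C : Circuit n} {M : List (Word n)} {S B : Set (Word n)}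
    (h : Encodes C M S B) {g : Word n} (hg : g ∈ S) : M.idxOf g < n :=
  (List.idxOf_lt_length_iff.2 (h.mem g hg)).trans_le h.length_le

theorem sum_map_ite_eq_of_nodup {α β : Type*} [DecidableEq α] [AddCommMonoid β] {l : List α}
    (hl : l.Nodup) (u : α) (f : α → β) :
    (l.map fun w => if u = w then f w else 0).sum = if u ∈ l then f u else 0 := by
  induction l with
  | nil => simp
  | cons w l ih =>
    rw [List.nodup_cons] at hl
    rw [List.map_cons, List.sum_cons, ih hl.2]
    by_cases h : u = w
    · subst h; simp [hl.1]
    · simp [h]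

theorem hCount_perm_crossCnot {a b : ℕ} (p : Equiv.Perm (Fin (a + b)))
    (X : List (Fin a × Fin b)) : Circuit.hCount (Gate.perm p :: X.map crossCnot) = 0 := by
  rw [Circuit.hCount, List.countP_eq_zero]
  intro g hg
  rcases List.mem_cons.1 hg with rfl | hg
  · simp [Gate.isH]
  · obtain ⟨e, -, rfl⟩ := List.mem_map.1 hg
    simp [crossCnot, Gate.isH]

/-- When the input is the unit word of the qubit of `π u`, only the gate belonging to `u` fires;
`hu` says that no other gate has the same control. -/
theorem sum_fanOut {a b : ℕ} {π : Word b → Word a} {M₁ : List (Word a)} {M₂ : List (Word b)}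
    {G₅ : List (Word b)} {X : List (Fin a × Fin b)} (hX : FanOut π M₁ M₂ G₅ X)
    (hG₅ : G₅.Nodup) {u : Word b} (hu : ∀ w ∈ G₅, M₁.idxOf (π u) = M₁.idxOf (π w) → u = w) :
    (X.map fun e => unitWord a (M₁.idxOf (π u)) e.1 • (Pi.single e.2 1 : Word b)).sum =
      if u ∈ G₅ then unitWord b (M₂.idxOf u) else 0 := by
  have h : (X.map fun e => unitWord a (M₁.idxOf (π u)) e.1 • (Pi.single e.2 1 : Word b)) =
      (X.map (fun e => ((e.1 : ℕ), (e.2 : ℕ)))).map (fun e =>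
        if M₁.idxOf (π u) = e.1 then unitWord b e.2 else 0) := by
    rw [List.map_map]
    refine List.map_congr_left fun e _ => ?_
    simp only [Function.comp, unitWord_val]
    simp only [unitWord]
    split_ifs <;> simp
  rw [h, hX, List.map_map, ← sum_map_ite_eq_of_nodup hG₅ u fun w => unitWord b (M₂.idxOf w)]
  congr 1
  refine List.map_congr_left fun w hw => ?_
  simp only [Function.comp]
  by_cases h' : u = w
  · subst h'; simp
  · rw [if_neg h', if_neg fun e => h' (hu w hw e)]

theorem mem_comap_par {a b : ℕ} {f : Word (a + b) →ₗ[ZMod 2] Word (a + b)}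
    {T₁ : Submodule (ZMod 2) (Word a × Word a)} {T₂ : Submodule (ZMod 2) (Word b × Word b)}
    {x : Word (a + b)} {x₁ w₁ : Word a} {x₂ w₂ : Word b} (hx : f x = Fin.append x₁ x₂)
    (h₁ : (x₁, w₁) ∈ T₁) (h₂ : (x₂, w₂) ∈ T₂) :
    (x, Fin.append w₁ w₂) ∈ (T₁.comap (leftPart.prodMap leftPart) ⊓
      T₂.comap (rightPart.prodMap rightPart)).comap (f.prodMap LinearMap.id) := by
  constructor
  · change (leftPart (f x), leftPart (Fin.append w₁ w₂)) ∈ T₁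
    rwa [hx, leftPart_append, leftPart_append]
  · change (rightPart (f x), rightPart (Fin.append w₁ w₂)) ∈ T₂
    rwa [hx, rightPart_append, rightPart_append]

/-- The part of the recursive step after the Hadamard gates. -/
theorem Encodes.linear_step {a b : ℕ} {C₁ : Circuit a} {C₂ : Circuit b}
    {π : Word b → Word a} {M : List (Word (a + b))} {M₁ : List (Word a)}
    {M₂ : List (Word b)} {S₁ B₁ : Set (Word a)} {S₂ B₂ : Set (Word b)}
    (h₁ : Encodes C₁ M₁ S₁ B₁) (h₂ : Encodes C₂ M₂ S₂ B₂)
    {G₃ G₄ G₅ : List (Word b)} {p : Equiv.Perm (Fin (a + b))} {X : List (Fin a × Fin b)}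
    (hM : M.Nodup) (hM' : M.length ≤ a + b) (hinj : Set.InjOn π {u | u ∈ G₃})
    (h₃ : ∀ u ∈ G₃, π u ∈ S₁) (h₄ : ∀ v ∈ G₄, v ∈ S₂) (h₅ : ∀ u ∈ G₅, u ∈ G₃ ∧ u ∈ S₂)
    (hG₅ : G₅.Nodup) (h₃₅ : ∀ u ∈ G₃, u ∉ G₅ → u ∈ Submodule.span (ZMod 2) B₂)
    (hp : Routes π M M₁ M₂ G₃ G₄ p) (hX : FanOut π M₁ M₂ G₅ X)
    {S B : Set (Word (a + b))} (hSM : ∀ g ∈ S, g ∈ M)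
    (hS : ∀ g ∈ S, (∃ u ∈ G₃, g = Fin.append (π u) u) ∨ ∃ v ∈ G₄, g = Fin.append 0 v)
    (hB : Submodule.span (ZMod 2) B =
      prodCode (Submodule.span (ZMod 2) B₁) (Submodule.span (ZMod 2) B₂)) :
    Encodes ((Gate.perm p :: X.map crossCnot) ++ par C₁ C₂) M S B := by
  refine ⟨hM, hM', hSM, ?_⟩
  rw [hB]
  -- The second relation is enlarged by its code. A row of `G₃` outside `G₅` gets no CNOT, so its
  -- second half starts from the zero input; since that half lies in the code, the zero input
  -- encodes it.
  refine (Enc.linear_append (hCount_perm_crossCnot p X) (h₁.enc.par h₂.enc.sup_code)).mono ?_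
  refine Submodule.span_le.2 ?_
  rintro _ ⟨g, hg, rfl⟩
  have hlt : M.idxOf g < a + b := (List.idxOf_lt_length_iff.2 (hSM g hg)).trans_le hM'
  obtain ⟨q, hq⟩ : ∃ q : Fin (a + b), (q : ℕ) = M.idxOf g := ⟨⟨_, hlt⟩, rfl⟩
  have hbits : Circuit.bits (Gate.perm p :: X.map crossCnot) (unitWord (a + b) (M.idxOf g)) =
      Circuit.bits (X.map crossCnot) (unitWord (a + b) (p q)) := by
    rw [← hq, ← perm_bits_unitWord]; rfl
  rcases hS g hg with ⟨u, hu, rfl⟩ | ⟨v, hv, rfl⟩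
  · have hpq := hp.1 u hu q hq
    have hbits' : Circuit.bits (Gate.perm p :: X.map crossCnot)
        (unitWord (a + b) (M.idxOf (Fin.append (π u) u))) =
        Fin.append (unitWord a (M₁.idxOf (π u)))
          (if u ∈ G₅ then unitWord b (M₂.idxOf u) else 0) := by
      rw [hbits, hpq, unitWord_left (h₁.idxOf_lt (h₃ u hu)), bits_map_crossCnot, zero_add,
        sum_fanOut hX hG₅]
      intro w hw e
      have hw₃ := (h₅ w hw).1
      exact hinj hu hw₃ ((List.idxOf_inj (h₁.mem _ (h₃ u hu))).1 e)
    refine mem_comap_par hbits' (mem_msgRel (h₃ u hu)) ?_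
    by_cases hu₅ : u ∈ G₅
    · rw [if_pos hu₅]
      exact Submodule.mem_sup_left (mem_msgRel (h₅ u hu₅).2)
    · rw [if_neg hu₅]
      exact Submodule.mem_sup_right ⟨u, h₃₅ u hu hu₅, rfl⟩
  · have hpq := hp.2 v hv q hq
    have hbits' : Circuit.bits (Gate.perm p :: X.map crossCnot)
        (unitWord (a + b) (M.idxOf (Fin.append 0 v))) =
        Fin.append 0 (unitWord b (M₂.idxOf v)) := by
      rw [hbits, hpq, unitWord_right, bits_map_crossCnot]
      have : (X.map fun e => (0 : Word a) e.1 • (Pi.single e.2 1 : Word b)).sum = 0 :=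
        List.sum_eq_zero fun x hx => by
          obtain ⟨e, -, rfl⟩ := List.mem_map.1 hx
          simp
      rw [this, add_zero]
    exact mem_comap_par hbits' (zero_mem _) (Submodule.mem_sup_left (mem_msgRel (h₄ v hv)))

/-- Hadamard gates move message rows to the code. -/
theorem Encodes.hadamards {n : ℕ} {C : Circuit n} {M : List (Word n)} {S B S' B' : Set (Word n)}
    (h : Encodes C M S B) {G₂ : List (Word n)} (hG₂ : G₂.Nodup) (hG₂S : ∀ g ∈ G₂, g ∈ S)
    {K : List (Fin n)} (hK : K.map Fin.val = G₂.map fun g => M.idxOf g)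
    (hind : LinearIndepOn (ZMod 2) id (B ∪ {g | g ∈ G₂})) (hdisj : ∀ g ∈ G₂, g ∉ B)
    (hS : S' ⊆ S) (hS' : ∀ g ∈ G₂, g ∉ S')
    (hB : Submodule.span (ZMod 2) B' = Submodule.span (ZMod 2) (B ∪ {g | g ∈ G₂})) :
    Encodes (K.map Gate.h ++ C) M S' B' := by
  refine ⟨h.nodup, h.length_le, fun g hg => h.mem g (hS hg), ?_⟩
  rw [hB]
  have hlen : K.length = G₂.length := by simpa using congrArg List.length hK
  have hfst : (K.zip G₂).map Prod.fst = K := List.map_fst_zip hlen.le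
  have hsnd : (K.zip G₂).map Prod.snd = G₂ := List.map_snd_zip hlen.ge
  have hidx : ∀ e ∈ K.zip G₂, (e.1 : ℕ) = M.idxOf e.2 := by
    intro e he
    obtain ⟨i, hi, rfl⟩ := List.getElem_of_mem he
    rw [List.length_zip, lt_min_iff] at hi
    have h1 : (K.map Fin.val)[i]'(by simpa using hi.1) =
        (G₂.map fun g => M.idxOf g)[i]'(by simpa using hi.2) := by simp only [hK]
    simpa using h1
  have hKn : K.Nodup := by
    refine List.Nodup.of_map Fin.val ?_
    rw [hK]
    exact List.Nodup.map_on (fun x hx y _ e => (List.idxOf_inj (h.mem x (hG₂S x hx))).1 e) hG₂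
  have hmain := h.enc.hadamards (K.zip G₂) (fun e he => by
    rw [← unitWord_val, hidx e he]
    exact mem_msgRel (hG₂S _ (List.of_mem_zip he).2)) (by rwa [hfst]) (by rwa [hsnd])
    (by rwa [hsnd]) (by rwa [hsnd])
  have hmap : (K.zip G₂).map (fun e => Gate.h e.1) = K.map Gate.h := by
    conv_rhs => rw [← hfst, List.map_map]
    rfl
  rw [hsnd, hfst, hmap] at hmain
  refine hmain.mono (le_inf (Submodule.span_mono (Set.image_mono hS)) ?_)
  -- The remaining message rows have numbers different from those of `G₂`, so their unit words
  -- vanish on the qubits of the Hadamard gates.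
  refine Submodule.span_le.2 ?_
  rintro _ ⟨g, hg, rfl⟩ i hi
  have hi' : (i : ℕ) ∈ K.map Fin.val := List.mem_map_of_mem hi
  rw [hK, List.mem_map] at hi'
  obtain ⟨g', hg', e⟩ := hi'
  simp only [unitWord]
  rw [if_neg]
  rw [← e]
  exact fun e' => hS' g' hg' ((List.idxOf_inj (h.mem g (hS hg))).1 e' ▸ hg)

/-! ### From message rows to unitary encoders -/

theorem place_eq_sum {n k : ℕ} (pos : Fin k → ℕ) (μ : Word k) :
    (place pos μ : Word n) = ∑ j, μ j • unitWord n (pos j) := by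
  ext i
  simp [place, unitWord]

theorem linearIndependent_getElem {n : ℕ} {l : List (Word n)} (hl : l.Nodup)
    (h : LinearIndepOn (ZMod 2) id {g | g ∈ l}) :
    LinearIndependent (ZMod 2) (fun j : Fin l.length => l[j]) := by
  let f : Fin l.length → {g | g ∈ l} := fun j => ⟨l[j], List.getElem_mem j.2⟩
  have hf : Function.Injective f := fun i j e =>
    Fin.ext ((List.Nodup.getElem_inj_iff hl).1 (congrArg Subtype.val e))
  exact h.linearIndependent.comp f hf

/-- Both the input and the codeword are linear in the message, so each pair formed by them is a
combination of the pairs of single generators, which lie in `msgRel`. Joint independence of `S ∪ B`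
gives the complement. -/
theorem Encodes.isEncoder {n : ℕ} {C : Circuit n} {M : List (Word n)} {S B : Set (Word n)}
    (h : Encodes C M S B) {D E : Submodule (ZMod 2) (Word n)} {gens : List (Word n)}
    {pos : Fin gens.length → ℕ} (hgens : gens.Nodup) (hS : {g | g ∈ gens} = S)
    (hind : LinearIndepOn (ZMod 2) id (S ∪ B)) (hdisj : Disjoint S B)
    (hD : D = Submodule.span (ZMod 2) B) (hE : E = Submodule.span (ZMod 2) (S ∪ B))
    (hpos : ∀ j, pos j = M.idxOf gens[j]) : IsEncoder D E gens pos C.mat := by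
  subst hS hD hE
  refine ⟨linearIndependent_getElem hgens (hind.mono Set.subset_union_left),
    ((linearIndepOn_id_union_iff hdisj).1 hind).2.2, (Submodule.span_union _ _).symm,
    C.mat_mem_unitary, fun φ => ?_⟩
  rw [Matrix.mulVec_sum]
  refine Finset.sum_congr rfl fun μ _ => ?_
  rw [Matrix.mulVec_smul, place_eq_sum]
  congr 1
  refine h.enc _ _ ?_
  have : ((∑ j, μ j • unitWord n (pos j), ∑ j, μ j • gens[j]) : Word n × Word n) =
      ∑ j, μ j • (unitWord n (pos j), gens[j]) := by
    simp only [Prod.smul_mk]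
    rw [Prod.ext_iff, Prod.fst_sum, Prod.snd_sum]
    exact ⟨rfl, rfl⟩
  rw [this]
  refine sum_mem fun j _ => Submodule.smul_mem _ _ ?_
  rw [hpos]
  exact mem_msgRel (List.getElem_mem j.2)

/-! ## The recursive step on bands of rows -/

theorem length_band_one {lo hi : ℤ} {d : ℕ} (h : lo + 1 = d) (h' : hi = d) (m : ℕ) :
    (band lo hi m).length = m.choose d := by
  rw [h', length_band h, Finset.Icc_self, Finset.sum_singleton]

theorem length_le_of_subset_fullRows {m : ℕ} {M : List (Word (len m))} (hM : M.Nodup)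
    (h : ∀ g ∈ M, g ∈ fullRows m) : M.length ≤ len m := by
  exact (List.subperm_of_subset hM h).length_le.trans_eq (fullRows_length m)

/-- Rows appended at the end of an index map have consecutive numbers; this is the interval of
qubits on which the Hadamard gates are prescribed. -/
theorem map_idxOf_append {α : Type*} [DecidableEq α] {A L : List α} (h : (A ++ L).Nodup) :
    (L.map fun g => (A ++ L).idxOf g) = List.range' A.length L.length := by
  refine List.ext_getElem (by simp) fun i h₁ h₂ => ?_
  rw [List.length_map] at h₁
  rw [List.getElem_map, List.getElem_range', one_mul]
  have : (A ++ L)[A.length + i]'(by simpa using h₁) = L[i] := by simp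
  rw [← this, h.idxOf_getElem]

theorem append_self_mem_fullRows {m : ℕ} {u : Word (len m)} (hu : u ∈ fullRows m) :
    Fin.append u u ∈ fullRows (m + 1) := mem_fullRows_succ.2 (Or.inl ⟨u, hu, rfl⟩)

theorem append_self_mem_band {lo hi : ℤ} {m : ℕ} {u : Word (len m)} :
    Fin.append u u ∈ band lo hi (m + 1) ↔ u ∈ band lo hi m := by
  rw [band_succ, List.mem_append, List.mem_map, List.mem_map]
  constructor
  · rintro (⟨v, hv, e⟩ | ⟨v, hv, e⟩)
    · rwa [← (append_inj.1 e).1]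
    · obtain ⟨rfl, e'⟩ := append_inj.1 e
      exact absurd e' (ne_zero_of_mem_fullRows (mem_band.1 hv).1)
  · exact fun h => Or.inl ⟨u, h, rfl⟩

theorem append_zero_mem_band {lo hi : ℤ} {m : ℕ} {u : Word (len m)} :
    Fin.append 0 u ∈ band lo hi (m + 1) ↔ u ∈ band (lo - 1) (hi - 1) m := by
  rw [band_succ, List.mem_append, List.mem_map, List.mem_map]
  constructor
  · rintro (⟨v, hv, e⟩ | ⟨v, hv, e⟩)
    · exact absurd (append_inj.1 e).1 (ne_zero_of_mem_fullRows (mem_band.1 hv).1)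
    · rwa [← (append_inj.1 e).2]
  · exact fun h => Or.inr ⟨u, h, rfl⟩

theorem mem_band_succ {lo hi : ℤ} {m : ℕ} {g : Word (len m + len m)} :
    g ∈ band lo hi (m + 1) ↔ (∃ u ∈ band lo hi m, g = Fin.append u u) ∨
      ∃ v ∈ band (lo - 1) (hi - 1) m, g = Fin.append 0 v := by
  rw [band_succ, List.mem_append, List.mem_map, List.mem_map]
  simp only [eq_comm]

theorem band_subset {lo hi lo' hi' : ℤ} {m : ℕ} (hlo : lo' ≤ lo) (hhi : hi ≤ hi')
    {g : Word (len m)} (hg : g ∈ band lo hi m) : g ∈ band lo' hi' m := by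
  obtain ⟨h₁, h₂, h₃⟩ := mem_band.1 hg
  exact mem_band.2 ⟨h₁, by omega, by omega⟩

theorem one_mem_band {lo hi : ℤ} {m : ℕ} : 1 ∈ band lo hi m ↔ lo < 0 ∧ 0 ≤ hi := by
  rw [mem_band, rowDeg_one]
  simp [one_mem_fullRows]

theorem band_eq_nil {lo hi : ℤ} (h : hi ≤ lo) (m : ℕ) : band lo hi m = [] := by
  rw [List.eq_nil_iff_forall_not_mem]
  intro g hg
  have := mem_band.1 hg
  omega

/-- A spanning set of the direct sum of two codes, the first of which is an image of a subcode of
the second. -/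
theorem span_union_image_eq_prodCode {a b : ℕ} (π : Word b →ₗ[ZMod 2] Word a)
    {B₁ B₂ : Set (Word b)} (h : B₁ ⊆ B₂) :
    Submodule.span (ZMod 2) (dblLin π '' B₁ ∪ inrLin a b '' B₂) =
      prodCode (Submodule.span (ZMod 2) (π '' B₁)) (Submodule.span (ZMod 2) B₂) := by
  apply le_antisymm
  · refine Submodule.span_le.2 ?_
    rintro _ (⟨u, hu, rfl⟩ | ⟨v, hv, rfl⟩)
    · exact append_mem_prodCode.2 ⟨Submodule.subset_span ⟨u, hu, rfl⟩,
        Submodule.subset_span (h hu)⟩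
    · exact append_mem_prodCode.2 ⟨zero_mem _, Submodule.subset_span hv⟩
  · rintro _ ⟨⟨x, y⟩, ⟨hx, hy⟩, rfl⟩
    change x ∈ _ at hx
    change y ∈ _ at hy
    rw [Submodule.span_union, ← Submodule.map_span, ← Submodule.map_span]
    rw [← Submodule.map_span] at hx
    obtain ⟨u, hu, rfl⟩ := hx
    -- `(π u, y) = (π u, u) + (0, u + y)`, where `u + y` lies in the second span because `B₁ ⊆ B₂`.
    refine Submodule.mem_sup.2 ⟨dblLin π u, ⟨u, hu, rfl⟩, inrLin a b (u + y),
      ⟨u + y, add_mem (Submodule.span_mono h hu) hy, rfl⟩, ?_⟩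
    rw [dblLin_apply, inrLin_apply, ← append_add, add_zero, ← add_assoc, word_add_self, zero_add]
    rfl

theorem mem_dbl {a b : ℕ} {π : Word b → Word a} {A : List (Word b)} {g : Word (a + b)} :
    g ∈ dbl π A ↔ ∃ u ∈ A, g = Fin.append (π u) u := by
  simp only [dbl, List.mem_map, eq_comm]

/-- Degrees exceed `lo` in the first list and are at most `lo` in the second. -/
theorem nodup_stack {lo hi : ℤ} (m : ℕ) :
    (band lo hi (m + 1) ++ dbl id (band (lo - 1) lo m) : List (Word (len m + len m))).Nodup := by
  refine List.Nodup.append (nodup_band _ _ _)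
    ((nodup_band _ _ _).map fun u v e => (append_inj.1 e).2) ?_
  intro g hg hg'
  obtain ⟨u, hu, rfl⟩ := mem_dbl.1 hg'
  have h₁ := mem_band.1 (append_self_mem_band.1 (show Fin.append u u ∈ _ from hg))
  have h₂ := mem_band.1 hu
  omega

theorem stage_append_par {a b : ℕ} (K : List (Fin (a + b))) (p : Equiv.Perm (Fin (a + b)))
    (X : List (Fin a × Fin b)) (C : Circuit (a + b)) :
    stage K p X ++ C = K.map Gate.h ++ ((Gate.perm p :: X.map crossCnot) ++ C) := by
  rw [stage, List.append_assoc]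

theorem linearIndepOn_of_subset_fullRows {m : ℕ} {S : Set (Word (len m))}
    (h : ∀ g ∈ S, g ∈ fullRows m) : LinearIndepOn (ZMod 2) id S :=
  (linearIndepOn_fullRows m).mono h

theorem mem_stack {m : ℕ} {A : List (Word (len (m + 1)))} {B : List (Word (len m))}
    {g : Word (len m + len m)} : g ∈ stack A B ↔ g ∈ A ∨ ∃ u ∈ B, g = Fin.append u u := by
  exact List.mem_append.trans (or_congr_right mem_dbl)

/-- The recursive step of the encoders of the unpunctured codes. -/
theorem Encodes.band_step {lo hi : ℤ} {m : ℕ} {C : Circuit (len m)} {M₁ : List (Word (len m))}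
    (h : Encodes C M₁ {g | g ∈ band (lo - 1) hi m} {g | g ∈ band (-1) (lo - 1) m})
    (hlo : lo ≤ hi) {M : List (Word (len m + len m))} {K : List (Fin (len m + len m))}
    {p : Equiv.Perm (Fin (len m + len m))} {X : List (Fin (len m) × Fin (len m))}
    (hM : M = stack (band lo hi (m + 1)) (band (lo - 1) lo m))
    (hK : K.map Fin.val = List.range' (band lo hi (m + 1)).length (band (lo - 1) lo m).length)
    (hp : Routes id M M₁ M₁ (band (lo - 1) hi m) (band (lo - 1) (hi - 1) m) p)
    (hX : FanOut id M₁ M₁ (band (lo - 1) hi m) X) :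
    Encodes (stage K p X ++ par C C : Circuit (len (m + 1))) M {g | g ∈ band lo hi (m + 1)}
      {g | g ∈ band (-1) lo (m + 1)} := by
  have hMn : M.Nodup := hM ▸ nodup_stack m
  have hMF : ∀ g ∈ M, g ∈ fullRows (m + 1) := by
    intro g hg
    rw [hM, mem_stack] at hg
    rcases hg with hg | ⟨u, hu, rfl⟩
    · exact (mem_band.1 hg).1
    · exact append_self_mem_fullRows (mem_band.1 hu).1
  have hspan := span_union_image_eq_prodCode (π := (LinearMap.id : Word (len m) →ₗ[ZMod 2] _))
    (B₁ := {g | g ∈ band (-1) (lo - 1) m}) (B₂ := {g | g ∈ band (-1) (lo - 1) m}) subset_rfl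
  rw [show ((LinearMap.id : Word (len m) →ₗ[ZMod 2] _) '' {g | g ∈ band (-1) (lo - 1) m}) =
    {g | g ∈ band (-1) (lo - 1) m} from Set.image_id _] at hspan
  -- Before the Hadamard gates all rows of `M` are messages, including the final block `(u, u)` that
  -- the gates will move into the code.
  have hlin := Encodes.linear_step h h hMn (length_le_of_subset_fullRows (m := m + 1) hMn hMF)
    (fun _ _ _ _ e => e) (fun u hu => hu) (fun v hv => band_subset le_rfl (by omega) hv)
    (fun u hu => ⟨hu, hu⟩) (nodup_band _ _ _) (fun u hu hu' => absurd hu hu') hp hX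
    (S := {g | g ∈ M}) (fun g hg => hg) (by
      intro g hg
      rcases mem_stack.1 (hM ▸ hg : g ∈ stack _ _) with hg | ⟨u, hu, rfl⟩
      · rcases mem_band_succ.1 hg with ⟨u, hu, rfl⟩ | ⟨v, hv, rfl⟩
        · exact Or.inl ⟨u, band_subset (by omega) le_rfl hu, rfl⟩
        · exact Or.inr ⟨v, hv, rfl⟩
      · exact Or.inl ⟨u, band_subset le_rfl hlo hu, rfl⟩) hspan
  rw [stage_append_par]
  -- The rows of degree at most `lo` are the `(0, v)` with `deg v ≤ lo - 1`, and the `(u, u)` with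
  -- `deg u ≤ lo - 1` or `deg u = lo`. Only the last kind is missing from the direct sum of the two
  -- codes.
  have hsub : (dblLin LinearMap.id '' {g | g ∈ band (-1) (lo - 1) m} ∪
      inrLin _ _ '' {g | g ∈ band (-1) (lo - 1) m}) ∪ {g | g ∈ dbl id (band (lo - 1) lo m)} =
      {g | g ∈ band (-1) lo (m + 1)} := by
    ext g
    simp only [Set.mem_union, Set.mem_image, Set.mem_ofPred_eq, dblLin_apply, inrLin_apply]
    rw [mem_dbl, mem_band_succ]
    simp only [mem_band]
    constructor
    · rintro ((⟨u, hu, rfl⟩ | ⟨u, hu, rfl⟩) | ⟨u, hu, rfl⟩)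
      · exact Or.inl ⟨u, ⟨hu.1, by omega, by omega⟩, rfl⟩
      · exact Or.inr ⟨u, ⟨hu.1, by omega, by omega⟩, rfl⟩
      · exact Or.inl ⟨u, ⟨hu.1, by omega, by omega⟩, rfl⟩
    · rintro (⟨u, hu, rfl⟩ | ⟨u, hu, rfl⟩)
      · by_cases h' : (rowDeg m u : ℤ) ≤ lo - 1
        · exact Or.inl (Or.inl ⟨u, ⟨hu.1, by omega, by omega⟩, rfl⟩)
        · exact Or.inr ⟨u, ⟨hu.1, by omega, by omega⟩, rfl⟩
      · exact Or.inl (Or.inr ⟨u, ⟨hu.1, by omega, by omega⟩, rfl⟩)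
  refine hlin.hadamards (G₂ := dbl id (band (lo - 1) lo m))
    ((nodup_band _ _ _).map fun u v e => (append_inj.1 e).2) ?_ ?_ ?_ ?_ ?_ ?_ ?_
  · intro g hg
    change g ∈ M
    rw [hM]
    exact mem_stack.2 (Or.inr (mem_dbl.1 hg))
  · rw [hK, hM]
    refine Eq.trans ?_ (map_idxOf_append (nodup_stack m)).symm
    rw [dbl, List.length_map]
  · rw [hsub]
    exact linearIndepOn_of_subset_fullRows (m := m + 1) fun g hg => (mem_band.1 hg).1
  · rintro g hg (⟨u, hu, e⟩ | ⟨v, hv, e⟩) <;> obtain ⟨w, hw, rfl⟩ := mem_dbl.1 hg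
    · obtain rfl : u = w := (append_inj.1 e).2
      have h₁ := mem_band.1 hw
      have h₂ := mem_band.1 hu
      omega
    · exact ne_zero_of_mem_fullRows (mem_band.1 hw).1 (append_inj.1 e).1.symm
  · intro g hg
    change g ∈ M
    rw [hM]
    exact mem_stack.2 (Or.inl hg)
  · intro g hg hg'
    obtain ⟨u, hu, rfl⟩ := mem_dbl.1 hg
    have h₁ := mem_band.1 (append_self_mem_band.1 (show Fin.append u u ∈ _ from hg'))
    have h₂ := mem_band.1 hu
    omega
  · rw [hsub]

/-! ### The recursive step for punctured codes -/

theorem PunctSafe.mono {m : ℕ} {S T : Set (Word (len m))} (h : PunctSafe T) (hS : S ⊆ T) :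
    PunctSafe S :=
  ⟨fun g hg => h.1 g (hS hg), h.2.imp (fun h h' => h (hS h')) fun h h' => h (hS h')⟩

theorem PunctSafe.nodup_map {m : ℕ} {A : List (Word (len m))} (h : PunctSafe {u | u ∈ A})
    (hA : A.Nodup) : (A.map (punct m)).Nodup :=
  List.Nodup.map_on (fun _ hx _ hy e => h.injOn (Submodule.subset_span hx)
    (Submodule.subset_span hy) e) hA

/-- At least one of the `2 ^ m` rows is absent, which makes room for the loss of one bit. -/
theorem PunctSafe.length_le {m : ℕ} {A : List (Word (len m))} (h : PunctSafe {u | u ∈ A})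
    (hA : A.Nodup) : (A.map (punct m)).length ≤ plen m := by
  rw [List.length_map]
  have hm := plen_succ m
  obtain ⟨x, hx, hxA⟩ : ∃ x ∈ fullRows m, x ∉ A := by
    rcases h.2 with h' | h'
    · exact ⟨_, lastRow_mem m, h'⟩
    · exact ⟨_, one_mem_fullRows m, h'⟩
  have := length_le_of_subset_fullRows (M := x :: A) (List.nodup_cons.2 ⟨hxA, hA⟩) fun g hg => by
    rcases List.mem_cons.1 hg with rfl | hg
    · exact hx
    · exact h.1 g hg
  rw [List.length_cons] at this
  omega

theorem punctSafe_of_rowDeg_lt {m : ℕ} {S : Set (Word (len m))}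
    (h : ∀ g ∈ S, g ∈ fullRows m ∧ rowDeg m g < m) : PunctSafe S :=
  ⟨fun g hg => (h g hg).1, Or.inl fun h' => by
    have := (h _ h').2
    rw [rowDeg_lastRow] at this
    exact lt_irrefl _ this⟩

theorem stackP_eq_map {m : ℕ} (A : List (Word (len (m + 1)))) (B : List (Word (len m))) :
    stackP A B = (A ++ dbl id B : List (Word (len (m + 1)))).map (punct (m + 1)) := by
  rw [List.map_append, dbl, List.map_map]
  unfold stackP
  change A.map (punct (m + 1)) ++ dbl (punct m) B = _
  congr 1
  refine List.map_congr_left fun u _ => ?_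
  exact (punct_append u u).symm

/-- The number `k` of copies of the all-ones row, `0` or `1`, treats the variants with and without
this generator at once. If it is listed, `1 ≤ lo` keeps it out of both bands. All degrees stay below
`m + 1`, so `0…01` is absent and puncturing is harmless. -/
theorem stack_ones {lo hi : ℤ} {m k : ℕ} (hlo : lo ≤ hi) (hhi : hi < m) (hk : k ≤ 1)
    (hklo : k = 1 → 1 ≤ lo) :
    let N : List (Word (len (m + 1))) :=
      (List.replicate k 1 ++ band lo hi (m + 1)) ++ dbl id (band (lo - 1) lo m)
    N.Nodup ∧ PunctSafe {g | g ∈ N} := by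
  intro N
  have h1 : ∀ {g : Word (len (m + 1))}, g ∈ List.replicate k (1 : Word (len (m + 1))) →
      g = 1 ∧ 1 ≤ lo := by
    intro g hg
    obtain ⟨hk0, rfl⟩ := List.mem_replicate.1 hg
    exact ⟨rfl, hklo (by omega)⟩
  constructor
  · have := nodup_stack (lo := lo) (hi := hi) m
    change ((List.replicate k 1 ++ band lo hi (m + 1)) ++ _).Nodup
    rw [List.append_assoc]
    refine List.Nodup.append (List.nodup_replicate.2 hk) this ?_
    intro g hg hg'
    obtain ⟨rfl, h1lo⟩ := h1 hg
    rcases List.mem_append.1 hg' with hg' | hg'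
    · have := (one_mem_band.1 hg').1; omega
    · obtain ⟨u, hu, e⟩ := mem_dbl.1 hg'
      have e' : (Fin.append 1 1 : Word (len m + len m)) = Fin.append u u := append_one_one.trans e
      rw [← (append_inj.1 e').1] at hu
      have := (one_mem_band.1 hu).1
      omega
  · refine punctSafe_of_rowDeg_lt fun g hg => ?_
    rcases List.mem_append.1 hg with hg | hg
    · rcases List.mem_append.1 hg with hg | hg
      · obtain ⟨rfl, -⟩ := h1 hg
        rw [rowDeg_one]; exact ⟨one_mem_fullRows _, by omega⟩
      · have := mem_band.1 hg; exact ⟨this.1, by omega⟩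
    · obtain ⟨u, hu, rfl⟩ := mem_dbl.1 hg
      have := mem_band.1 hu
      rw [id_eq, rowDeg_append_self]
      exact ⟨append_self_mem_fullRows this.1, by omega⟩

theorem punctSafe_ones_band {lo hi : ℤ} {m k : ℕ} (hlo : lo ≤ hi) (hhi : hi < m)
    (hklo : k = 1 → 1 ≤ lo) (hk : k ≤ 1) :
    PunctSafe {u | u ∈ List.replicate k 1 ++ band (lo - 1) hi m} := by
  refine punctSafe_of_rowDeg_lt fun g hg => ?_
  rcases List.mem_append.1 hg with hg | hg
  · obtain ⟨hk0, rfl⟩ := List.mem_replicate.1 hg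
    have := hklo (by omega)
    rw [rowDeg_one]; exact ⟨one_mem_fullRows _, by omega⟩
  · have := mem_band.1 hg; exact ⟨this.1, by omega⟩

/-- The recursive step of the encoders of the punctured codes, where the list `ones` is empty or
consists of the all-ones row. -/
theorem Encodes.punct_step {lo hi : ℤ} {m : ℕ} {C₁ : Circuit (plen m)} {C₂ : Circuit (len m)}
    {M₁ : List (Word (plen m))} {M₂ : List (Word (len m))} {k : ℕ}
    (h₁ : Encodes C₁ M₁ (punct m '' {g | g ∈ List.replicate k 1 ++ band (lo - 1) hi m})
      (punct m '' {g | g ∈ band 0 (lo - 1) m}))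
    (h₂ : Encodes C₂ M₂ {g | g ∈ band (lo - 1) hi m} {g | g ∈ band (-1) (lo - 1) m})
    (hlo : lo ≤ hi) (hlo₀ : lo ≠ 0) (hhi : hi < m) (hk : k ≤ 1) (hklo : k = 1 → 1 ≤ lo)
    {M : List (Word (plen m + len m))} {K : List (Fin (plen m + len m))}
    {p : Equiv.Perm (Fin (plen m + len m))} {X : List (Fin (plen m) × Fin (len m))}
    (hM : M = stackP (List.replicate k 1 ++ band lo hi (m + 1)) (band (lo - 1) lo m))
    (hK : K.map Fin.val = List.range' (k + (band lo hi (m + 1)).length)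
      (band (lo - 1) lo m).length)
    (hp : Routes (punct m) M M₁ M₂ (List.replicate k 1 ++ band (lo - 1) hi m)
      (band (lo - 1) (hi - 1) m) p)
    (hX : FanOut (punct m) M₁ M₂ (band (lo - 1) hi m) X) :
    Encodes (stage K p X ++ par C₁ C₂ : Circuit (plen (m + 1))) M
      (punct (m + 1) '' {g | g ∈ List.replicate k 1 ++ band lo hi (m + 1)})
      (punct (m + 1) '' {g | g ∈ band 0 lo (m + 1)}) := by
  have h1 : ∀ {n : ℕ} {g : Word (len n)}, g ∈ List.replicate k (1 : Word (len n)) →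
      g = 1 ∧ 1 ≤ lo := by
    intro n g hg
    obtain ⟨hk0, rfl⟩ := List.mem_replicate.1 hg
    exact ⟨rfl, hklo (by omega)⟩
  let A : List (Word (len (m + 1))) := List.replicate k 1 ++ band lo hi (m + 1)
  let N : List (Word (len (m + 1))) := A ++ dbl id (band (lo - 1) lo m)
  have hMN : M = N.map (punct (m + 1)) := hM.trans (stackP_eq_map _ _)
  have hA1 : ∀ g ∈ A, g = 1 ∧ 1 ≤ lo ∨ g ∈ band lo hi (m + 1) := fun g hg =>
    (List.mem_append.1 hg).imp h1 id
  obtain ⟨hNn, hNsafe⟩ := stack_ones hlo hhi hk hklo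
  have hG₃safe := punctSafe_ones_band hlo hhi hklo hk
  have hspan := span_union_image_eq_prodCode (π := punct m)
    (B₁ := {g | g ∈ band 0 (lo - 1) m}) (B₂ := {g | g ∈ band (-1) (lo - 1) m})
    (fun g hg => band_subset (by omega) le_rfl hg)
  have hlin := Encodes.linear_step h₁ h₂ (hMN ▸ hNsafe.nodup_map hNn)
    (hMN ▸ hNsafe.length_le hNn)
    (fun _ hx _ hy e => hG₃safe.injOn (Submodule.subset_span hx) (Submodule.subset_span hy) e)
    (fun u hu => ⟨u, hu, rfl⟩) (fun v hv => band_subset le_rfl (by omega) hv)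
    (fun u hu => ⟨List.mem_append_right _ hu, hu⟩) (nodup_band _ _ _) (fun u hu hu' => by
      rcases List.mem_append.1 hu with hu | hu
      -- The all-ones row is routed to the first part but has no CNOT. In the second part it belongs
      -- to the code, since its degree `0` is at most `lo - 1`.
      · obtain ⟨rfl, h1lo⟩ := h1 hu
        exact Submodule.subset_span (one_mem_band.2 ⟨by omega, by omega⟩)
      · exact absurd hu hu') hp hX
    (S := {g | g ∈ M}) (fun g hg => hg) (by
      intro g hg
      rw [hMN, Set.mem_ofPred_eq, List.mem_map] at hg
      obtain ⟨g, hg, rfl⟩ := hg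
      rcases List.mem_append.1 hg with hg | hg
      · rcases List.mem_append.1 hg with hg | hg
        · refine Or.inl ⟨1, List.mem_append_left _ ?_, ?_⟩
          · exact List.mem_replicate.2 ⟨(List.mem_replicate.1 hg).1, rfl⟩
          · rw [(h1 hg).1]; exact append_one_one.symm
        · rcases mem_band_succ.1 hg with ⟨u, hu, rfl⟩ | ⟨v, hv, rfl⟩
          · exact Or.inl ⟨u, List.mem_append_right _ (band_subset (by omega) le_rfl hu),
              punct_append u u⟩
          · exact Or.inr ⟨v, hv, by rw [punct_append, map_zero]⟩
      · obtain ⟨u, hu, rfl⟩ := mem_dbl.1 hg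
        exact Or.inl ⟨u, List.mem_append_right _ (band_subset le_rfl hlo hu),
          punct_append u u⟩) hspan
  rw [stage_append_par]
  have hdblp : (dbl id (band (lo - 1) lo m)).map (punct (m + 1)) =
      dbl (punct m) (band (lo - 1) lo m) := by
    rw [dbl, List.map_map]
    exact List.map_congr_left fun u _ => punct_append u u
  have hsub : (dblLin (punct m) '' {g | g ∈ band 0 (lo - 1) m} ∪
      inrLin _ _ '' {g | g ∈ band (-1) (lo - 1) m}) ∪
        {g | g ∈ dbl (punct m) (band (lo - 1) lo m)} =
      punct (m + 1) '' {g | g ∈ band 0 lo (m + 1)} := by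
    ext g
    simp only [Set.mem_union, Set.mem_image, Set.mem_ofPred_eq, dblLin_apply, inrLin_apply]
    rw [mem_dbl]
    constructor
    · rintro ((⟨u, hu, rfl⟩ | ⟨u, hu, rfl⟩) | ⟨u, hu, rfl⟩)
      · exact ⟨_, append_self_mem_band.2 (band_subset le_rfl (by omega) hu), punct_append u u⟩
      · exact ⟨_, append_zero_mem_band.2 (band_subset (by omega) le_rfl hu),
          by rw [punct_append, map_zero]⟩
      -- Here `u` has degree exactly `lo`, and `lo ≠ 0` makes this degree positive: the all-ones row
      -- must not enter the punctured code.
      · refine ⟨_, append_self_mem_band.2 (mem_band.2 ?_), punct_append u u⟩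
        have := mem_band.1 hu
        exact ⟨this.1, by omega, by omega⟩
    · rintro ⟨g, hg, rfl⟩
      rcases mem_band_succ.1 hg with ⟨u, hu, rfl⟩ | ⟨u, hu, rfl⟩
      · rw [punct_append]
        rw [mem_band] at hu
        by_cases h' : (rowDeg m u : ℤ) ≤ lo - 1
        · exact Or.inl (Or.inl ⟨u, mem_band.2 ⟨hu.1, by omega, by omega⟩, rfl⟩)
        · exact Or.inr ⟨u, mem_band.2 ⟨hu.1, by omega, by omega⟩, rfl⟩
      · rw [punct_append, map_zero]
        exact Or.inl (Or.inr ⟨u, band_subset (by omega) le_rfl hu, rfl⟩)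
  have hG₂n : (dbl (punct m) (band (lo - 1) lo m)).Nodup :=
    (nodup_band _ _ _).map fun u v e => (append_inj.1 e).2
  refine hlin.hadamards (G₂ := dbl (punct m) (band (lo - 1) lo m)) hG₂n ?_ ?_ ?_ ?_ ?_ ?_ ?_
  · intro g hg
    change g ∈ M
    rw [hMN, List.map_append, hdblp]
    exact List.mem_append_right _ hg
  · have hMe : M = A.map (punct (m + 1)) ++ dbl (punct m) (band (lo - 1) lo m) := by
      rw [hMN, List.map_append, hdblp]
    have hMn : M.Nodup := hMN ▸ hNsafe.nodup_map hNn
    rw [hMe] at hMn ⊢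
    rw [hK]
    refine Eq.trans ?_ (map_idxOf_append hMn).symm
    simp only [A, dbl, List.length_map, List.length_append, List.length_replicate]
  · rw [hsub]
    refine (punctSafe_of_rowDeg_lt fun g hg => ?_).linearIndepOn
    have := mem_band.1 hg
    exact ⟨this.1, by omega⟩
  · rintro g hg (⟨u, hu, e⟩ | ⟨v, hv, e⟩) <;> obtain ⟨w, hw, rfl⟩ := mem_dbl.1 hg
    · obtain rfl : u = w := (append_inj.1 e).2
      have h₁ := mem_band.1 hw
      have h₂ := mem_band.1 hu
      omega
    · obtain rfl : v = w := (append_inj.1 e).2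
      have h₁ := mem_band.1 hv
      have h₂ := mem_band.1 hw
      omega
  · rintro _ ⟨g, hg, rfl⟩
    change _ ∈ M
    rw [hMN]
    exact List.mem_map_of_mem (List.mem_append_left _ hg)
  · rintro g hg ⟨g', hg', e⟩
    have hg₂ : g ∈ (dbl id (band (lo - 1) lo m)).map (punct (m + 1)) := hdblp ▸ hg
    obtain ⟨g₂, hg₂, e₂⟩ := List.mem_map.1 hg₂
    have := hNsafe.injOn (Submodule.subset_span (List.mem_append_left _ hg'))
      (Submodule.subset_span (List.mem_append_right _ hg₂)) (e.trans e₂.symm)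
    subst this
    exact (List.nodup_append.1 hNn).2.2 _ hg' _ hg₂ rfl
  · rw [hsub]

/-! ## The encoders of the unpunctured codes -/

theorem band_eq_nil_of_neg {lo hi : ℤ} (h : hi < 0) (m : ℕ) : band lo hi m = [] := by
  rw [List.eq_nil_iff_forall_not_mem]
  intro g hg
  have := mem_band.1 hg
  omega

theorem band_congr_lo {lo lo' hi : ℤ} (h : lo < 0) (h' : lo' < 0) (m : ℕ) :
    band lo hi m = band lo' hi m := by
  rw [← G_eq_band h, G_eq_band h']

/-- The step of `Encodes.band_step` at `lo = -1`: there are no rows of negative degree, so no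
Hadamard gate occurs and the code remains zero. -/
theorem Encodes.basis_step {hi : ℤ} {m : ℕ} {C : Circuit (len m)} {M₁ : List (Word (len m))}
    (h : Encodes C M₁ {g | g ∈ band (-1) hi m} ∅) (hhi : -1 ≤ hi)
    {p : Equiv.Perm (Fin (len m + len m))} {X : List (Fin (len m) × Fin (len m))}
    (hp : Routes id (G hi (m + 1)) M₁ M₁ (G hi m) (G (hi - 1) m) p)
    (hX : FanOut id M₁ M₁ (G hi m) X) :
    Encodes (stage [] p X ++ par C C : Circuit (len (m + 1))) (G hi (m + 1))
      {g | g ∈ band (-1) hi (m + 1)} ∅ := by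
  have h2 : (-1 - 1 : ℤ) < 0 := by norm_num
  have := Encodes.band_step (lo := -1) (hi := hi) (m := m) (C := C) (M₁ := M₁) (K := [])
    (p := p) (X := X) (M := G hi (m + 1)) (by
      rw [band_congr_lo h2 (show (-1 : ℤ) < 0 by norm_num),
        band_eq_nil_of_neg (hi := -1 - 1) (by norm_num)]
      simpa using h) hhi
    (by rw [band_eq_nil_of_neg (hi := -1) (by norm_num), G_eq_band (show (-1 : ℤ) < 0 by norm_num)]
        exact (List.append_nil _).symm)
    (by rw [band_eq_nil_of_neg (hi := -1) (by norm_num)]; rfl)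
    (by rwa [← G_eq_band h2, ← G_eq_band h2])
    (by rwa [← G_eq_band h2])
  rw [band_eq_nil_of_neg (hi := -1) (by norm_num)] at this
  simpa using this

theorem RecBasisQRM.index_eq {r m : ℕ} {C : Circuit (len m)} {M : List (Word (len m))}
    (h : RecBasisQRM r m C M) : M = G r m := by
  cases h <;> rfl

theorem unitWord_one_zero : unitWord 1 0 = 1 := by
  ext i
  simp [unitWord]

theorem encodes_one : Encodes (n := 1) [] [1] {1} ∅ := by
  refine ⟨List.nodup_singleton _, le_rfl, by simp, ?_⟩
  rw [Submodule.span_empty]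
  intro x w hxw
  have : msgRel [(1 : Word 1)] {1} ≤ LinearMap.ker
      (LinearMap.fst (ZMod 2) (Word 1) (Word 1) - LinearMap.snd _ _ _) := by
    refine Submodule.span_le.2 ?_
    rintro _ ⟨g, hg, rfl⟩
    rw [Set.mem_singleton_iff] at hg
    subst hg
    simp [unitWord_one_zero]
  have e : x - w = 0 := this hxw
  rw [cosetState_bot, sub_eq_zero.1 e]
  exact Matrix.one_mulVec _

theorem RecBasisQRM.encodes {r m : ℕ} {C : Circuit (len m)} {M : List (Word (len m))}
    (h : RecBasisQRM r m C M) : Encodes C M {g | g ∈ band (-1) r m} ∅ := by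
  induction h with
  | base =>
    have : {g | g ∈ band (-1) ((0 : ℕ) : ℤ) 0} = {(1 : Word (len 0))} := by
      rw [← G_eq_band (by norm_num)]
      ext g; simp [G]
    rw [this]
    exact encodes_one
  | step hr hC hp hX ih => exact ih.basis_step (by omega) hp hX
  | @full m C M₁ p X hC hp hX ih =>
    -- No row of length `2 ^ m` has degree `m + 1`, so this case is the general step with upper end
    -- `m + 1`.
    have e₁ : G ((m + 1 : ℕ) : ℤ) m = G m m := by
      rw [← fullRows_eq_G (by push_cast; omega), ← fullRows_eq_G le_rfl]
    have e₂ : ((m + 1 : ℕ) : ℤ) - 1 = m := by push_cast; ring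
    refine Encodes.basis_step (M₁ := M₁) ?_ (by omega) ?_ ?_
    · rwa [← G_eq_band (by norm_num), e₁, G_eq_band (show (-1 : ℤ) < 0 by norm_num)]
    · rwa [e₁, e₂]
    · rwa [e₁]

theorem RecQRM.encodes {r m : ℕ} {C : Circuit (len m)} {M : List (Word (len m))}
    (h : RecQRM r m C M) : Encodes C M {g | g ∈ band ((m : ℤ) - r - 1) r m}
      {g | g ∈ band (-1) ((m : ℤ) - r - 1) m} := by
  induction h with
  | @full C M hC =>
    have e : (r : ℤ) - r - 1 = -1 := by ring
    rw [e, band_eq_nil_of_neg (hi := -1) (by norm_num)]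
    simpa using hC.encodes
  | @step m C M₁ M K p X hr hmr hC hM hK hp hX ih =>
    simp only [rowDiff_G] at hM hp hX
    have e : ((m + 1 : ℕ) : ℤ) - r - 1 = m - r := by push_cast; ring
    rw [e]
    refine ih.band_step (by omega) hM ?_ hp hX
    rw [hK, length_band (a := m + 1 - r) (by omega), length_band_one (d := m - r) (by omega)
      (by omega)]

theorem RecQRM.index_eq {r m : ℕ} {C : Circuit (len m)} {M : List (Word (len m))}
    (h : RecQRM r m C M) : ∃ l, M = band ((m : ℤ) - r - 1) r m ++ l := by
  cases h with
  | full hC =>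
    refine ⟨[], ?_⟩
    rw [List.append_nil, hC.index_eq, G_eq_band (show (r : ℤ) - r - 1 < 0 by linarith)]
  | @step m C M₁ M K p X hr hmr hC hM hK hp hX =>
    refine ⟨dbl id (rowDiff (G ((m : ℤ) - r) m) (G ((m : ℤ) - r - 1) m)), hM.trans ?_⟩
    rw [rowDiff_G, show ((m + 1 : ℕ) : ℤ) - r - 1 = m - r by push_cast; ring]
    rfl

theorem RecZQRM.encodes {r₀ m₀ : ℕ} {r : ℤ} {m : ℕ} {C : Circuit (len m)}
    {M : List (Word (len m))} (h : RecZQRM r₀ m₀ r m C M) :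
    Encodes C M {g | g ∈ band r r₀ m} {g | g ∈ band (-1) r m} := by
  induction h with
  | @basis m C M h hC =>
    rw [band_eq_nil_of_neg (hi := -1) (by norm_num)]
    simpa using hC.encodes
  | @full C M K h hC hK =>
    -- `U(r₀, r₀)` carries every row as a message and has the zero code; the Hadamard gates turn the
    -- rows of degree at most `2 r₀ - m₀` into the code.
    have hE := hC.encodes
    rw [show (r₀ : ℤ) - r₀ - 1 = -1 by ring, band_eq_nil_of_neg (hi := -1) (by norm_num)] at hE
    have hF : ∀ g : Word (len r₀), g ∈ fullRows r₀ → g ∈ band (-1) r₀ r₀ := fun g hg => by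
      rwa [← G_eq_band (by norm_num), ← fullRows_eq_G le_rfl]
    have hemp : {g : Word (len r₀) | g ∈ []} = (∅ : Set (Word (len r₀))) := by simp
    rw [hemp] at hE
    have hGb := G_eq_band (show (-1 : ℤ) < 0 by norm_num) (2 * (r₀ : ℤ) - m₀) r₀
    refine hE.hadamards (G₂ := G (2 * (r₀ : ℤ) - m₀) r₀) (hGb ▸ nodup_band _ _ _)
      (fun g hg => hF g (mem_G.1 hg).1) hK ?_ (fun g _ hg => hg) ?_ ?_ ?_
    · exact linearIndepOn_of_subset_fullRows fun g hg => hg.elim False.elim fun hg => (mem_G.1 hg).1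
    · exact fun g hg => hF g (mem_band.1 hg).1
    · intro g hg hg'
      have h₁ := (mem_G.1 hg).2
      have h₂ := (mem_band.1 hg').2.1
      omega
    · rw [Set.empty_union, hGb]
  | @step r m C M₁ M K p X hr hm hC hM hK hp hX ih =>
    simp only [rowDiff_G] at hM hp hX
    refine ih.band_step (by omega) hM ?_ hp hX
    rw [hK, length_band (a := r + 1) (by push_cast; omega), length_band_one (d := r) (by omega)
      (by omega)]

/-! ## The encoders of the punctured codes -/

theorem fullRows_idxOf_lastRow (m : ℕ) : (fullRows m).idxOf (lastRow m) + 1 = len m := by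
  have hnm : lastRow m ∉ G ((m : ℤ) - 1) m := fun h => by
    have := (mem_G.1 h).2
    rw [rowDeg_lastRow] at this
    omega
  have hl := fullRows_length m
  rw [G_self_eq_concat, List.length_append, List.length_singleton] at hl
  rw [G_self_eq_concat, List.idxOf_append_of_notMem hnm, List.idxOf_cons_self]
  exact hl

/-- `U^c(r, r+1)` encodes the row `0…01` at its last qubit. -/
theorem RecBasisQRM.encodes_fullRows {r : ℕ} {C : Circuit (len (r + 1))}
    {M : List (Word (len (r + 1)))} (h : RecBasisQRM r (r + 1) C M) :
    Encodes C (fullRows (r + 1)) {g | g ∈ fullRows (r + 1)} ∅ := by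
  cases h with
  | @step _ _ C M₁ p X hr hC hp hX =>
    have hM₁ := hC.index_eq
    subst hM₁
    have hFG : G r r = fullRows r := (fullRows_eq_G le_rfl).symm
    have hE := hC.encodes
    have hband : {g | g ∈ band (-1) r r} = {g | g ∈ fullRows r} := by
      rw [← G_eq_band (by norm_num), hFG]
    rw [hband] at hE
    have hcat : fullRows (r + 1) = G r (r + 1) ++ [lastRow (r + 1)] := by
      rw [G_self_eq_concat]; push_cast; rw [add_sub_cancel_right]
    have hidx : ∀ g ∈ G r (r + 1), (fullRows (r + 1)).idxOf g = (G r (r + 1)).idxOf g :=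
      fun g hg => by rw [hcat, List.idxOf_append_of_mem hg]
    have hnG : (G (r : ℤ) (r + 1)).Nodup := by
      rw [G_eq_band (show (-1 : ℤ) < 0 by norm_num)]; exact nodup_band _ _ _
    have hlast := fullRows_idxOf_lastRow r
    have hp' : Routes id (fullRows (r + 1)) (G r r) (G r r) (fullRows r) (fullRows r) p := by
      refine ⟨fun u hu q hq => hp.1 u (hFG ▸ hu) q ?_, fun v hv q hq => ?_⟩
      · rw [hq]
        refine hidx _ (mem_G.2 ⟨append_self_mem_fullRows hu, ?_⟩)
        rw [id_eq, rowDeg_append_self]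
        exact_mod_cast rowDeg_le hu
      by_cases hv' : v = lastRow r
      · subst hv'
        rw [← lastRow_succ] at hq
        have hq' := fullRows_idxOf_lastRow (r + 1)
        rw [← hq] at hq'
        have hlen := fullRows_length (r + 1)
        rw [hcat, List.length_append, List.length_singleton] at hlen
        rw [hFG]
        -- The routing condition says nothing about the last qubit, but a permutation has only one
        -- place left for it. The preimage of that place is not the number of a row of `G(r, r +
        -- 1)`, since all those rows are routed elsewhere; so it is the last qubit.
        obtain ⟨q', hq''⟩ := p.surjective ⟨len r + (fullRows r).idxOf (lastRow r), by omega⟩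
        rcases Nat.lt_or_ge q' (G (r : ℤ) (r + 1)).length with hlt | hge
        · exfalso
          have hmem := List.getElem_mem hlt
          have hi : (q' : ℕ) = (G (r : ℤ) (r + 1)).idxOf (G (r : ℤ) (r + 1))[(q' : ℕ)] :=
            (hnG.idxOf_getElem _ hlt).symm
          generalize (G (r : ℤ) (r + 1))[(q' : ℕ)] = g at hmem hi
          rw [G, List.mem_append, List.mem_map, List.mem_map] at hmem
          rcases hmem with ⟨u, hu, rfl⟩ | ⟨v, hv, rfl⟩
          · have h₁ := hp.1 u hu q' hi
            have h₂ := hE.idxOf_lt (hFG ▸ hu : u ∈ fullRows r)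
            have hq'' := congrArg Fin.val hq''
            simp only [id_eq] at h₁ hq''
            have := len_pos r
            omega
          · have h₁ := hp.2 v hv q' hi
            have hq'' := congrArg Fin.val hq''
            simp only at hq''
            have hvF := (mem_G.1 hv).1
            have h₂ : (fullRows r).idxOf v = (fullRows r).idxOf (lastRow r) := by
              rw [← hFG]; rw [hFG] at h₁ ⊢; omega
            have h₃ := (List.idxOf_inj hvF).1 h₂
            have h₄ := (mem_G.1 hv).2
            rw [h₃, rowDeg_lastRow] at h₄
            omega
        · have : q' = q := by
            have := q'.2
            have := q.2
            ext
            simp only [len] at *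
            omega
          rw [← this, hq'']
      · have hvG : v ∈ G ((r : ℤ) - 1) r := by
          have := rowDeg_lt hv hv'
          exact mem_G.2 ⟨hv, by omega⟩
        refine hp.2 v hvG q (hq.trans (hidx _ ?_))
        rw [G]
        exact List.mem_append_right _ (List.mem_map_of_mem hvG)
    rw [hFG] at hE hp' hX
    refine Encodes.linear_step hE hE (nodup_fullRows (r + 1)) (fullRows_length (r + 1)).le
      (fun _ _ _ _ e => e) (fun u hu => hu) (fun v hv => hv) (fun u hu => ⟨hu, hu⟩)
      (nodup_fullRows r) (fun u hu hu' => absurd hu hu') hp' hX (fun g hg => hg)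
      (fun g hg => mem_fullRows_succ.1 hg) ?_
    rw [Submodule.span_empty, Submodule.span_empty, prodCode, Submodule.prod_bot,
      Submodule.map_bot]

theorem Circuit.left_mulVec_ket {a : ℕ} (b : ℕ) {C : Circuit a} {x w : Word a}
    (h : C.mat.mulVec (ket x) = ket w) (y : Word b) :
    (Circuit.left b C).mat.mulVec (ket (Fin.append x y)) = ket (Fin.append w y) := by
  have e : par C ([] : Circuit b) = Circuit.left b C := List.append_nil _
  rw [← e, par_mulVec_ket, h, ← cosetState_bot (Fin.append w y)]
  funext z
  have : (⊥ : Submodule (ZMod 2) (Word (a + b))) = prodCode ⊥ ⊥ := by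
    rw [prodCode, Submodule.prod_bot, Submodule.map_bot]
  rw [this, cosetState_prodCode, cosetState_bot, cosetState_bot]
  congr 1
  exact congrFun (Matrix.one_mulVec (ket y)) _

theorem Circuit.right_mulVec_ket (a : ℕ) {b : ℕ} {C : Circuit b} {y w : Word b}
    (h : C.mat.mulVec (ket y) = ket w) (x : Word a) :
    (Circuit.right a C).mat.mulVec (ket (Fin.append x y)) = ket (Fin.append x w) := by
  have e : par ([] : Circuit a) C = Circuit.right a C := rfl
  rw [← e, par_mulVec_ket, h, ← cosetState_bot (Fin.append x w)]
  funext z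
  have : (⊥ : Submodule (ZMod 2) (Word (a + b))) = prodCode ⊥ ⊥ := by
    rw [prodCode, Submodule.prod_bot, Submodule.map_bot]
  rw [this, cosetState_prodCode, cosetState_bot, cosetState_bot]
  congr 1
  exact congrFun (Matrix.one_mulVec (ket x)) _

/-- The map `(x, w) ↦ (x₁, w₁ + x₂(c) e_t)`, where `x = (x₁, x₂)` and `w = (w₁, w₂)`. -/
def feedback {a b : ℕ} (c : Fin b) (t : Fin a) :
    Word (a + b) × Word (a + b) →ₗ[ZMod 2] Word a × Word a :=
  leftPart.prodMap leftPart +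
    (LinearMap.inr (ZMod 2) (Word a) (Word a)) ∘ₗ
      ((LinearMap.proj (Fin.natAdd a c) : Word (a + b) →ₗ[ZMod 2] ZMod 2).smulRight
        (Pi.single t 1 : Word a)) ∘ₗ LinearMap.fst _ _ _

theorem feedback_append {a b : ℕ} (c : Fin b) (t : Fin a) (x w : Word a) (y v : Word b) :
    feedback c t (Fin.append x y, Fin.append w v) = (x, w + y c • (Pi.single t 1 : Word a)) := by
  simp [feedback]

/-- Two circuits with a CNOT gate from the second part to the first part between them. -/
theorem Enc.par_feedback {a b : ℕ} {C₁ : Circuit a} {C₂ : Circuit b}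
    {T₁ : Submodule (ZMod 2) (Word a × Word a)} {T₂ : Submodule (ZMod 2) (Word b × Word b)}
    (h₁ : Enc C₁ T₁ ⊥) (h₂ : Enc C₂ T₂ ⊥) (c : Fin b) (t : Fin a) :
    Enc (C₁.left b ++ Gate.cnot (Fin.natAdd a c) (Fin.castAdd b t) (castAdd_ne_natAdd t c).symm ::
      C₂.right a) (T₁.comap (feedback c t) ⊓ T₂.comap (rightPart.prodMap rightPart)) ⊥ := by
  intro x w
  obtain ⟨x, y, rfl⟩ : ∃ (x' : Word a) (y' : Word b), x = Fin.append x' y' :=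
    ⟨_, _, (append_parts x).symm⟩
  obtain ⟨w, v, rfl⟩ : ∃ (w' : Word a) (v' : Word b), w = Fin.append w' v' :=
    ⟨_, _, (append_parts w).symm⟩
  rintro ⟨hz₁, hz₂⟩
  have hz₁ : feedback c t (Fin.append x y, Fin.append w v) ∈ T₁ := hz₁
  have hz₂ : (rightPart (Fin.append x y), rightPart (Fin.append w v)) ∈ T₂ := hz₂
  rw [feedback_append] at hz₁
  rw [rightPart_append, rightPart_append] at hz₂
  have e₁ := h₁ _ _ hz₁
  have e₂ := h₂ _ _ hz₂
  rw [cosetState_bot] at e₁ e₂ ⊢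
  rw [Circuit.mat_append, ← Matrix.mulVec_mulVec, Circuit.left_mulVec_ket b e₁, Circuit.mat,
    ← Matrix.mulVec_mulVec, Gate.mat_mulVec_ket rfl, Gate.bits_cnot, Fin.append_left,
    Fin.append_right, append_update_left]
  -- `C₁` produces `w + y c • e_t`, and the CNOT adds `y c • e_t` a second time. Its control still
  -- holds the input bit `y c`, because `C₂` has not acted yet.
  have : Function.update (w + y c • (Pi.single t 1 : Word a)) t
      ((w + y c • (Pi.single t 1 : Word a)) t + y c) = w := by
    ext i
    by_cases hi : i = t
    · subst hi
      simp [add_assoc, CharTwo.add_self_eq_zero]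
    · simp [hi]
  rw [this]
  exact Circuit.right_mulVec_ket a e₂ w

theorem mem_comap_feedback {a b : ℕ} {f : Word (a + b) →ₗ[ZMod 2] Word (a + b)}
    {T₁ : Submodule (ZMod 2) (Word a × Word a)} {T₂ : Submodule (ZMod 2) (Word b × Word b)}
    {c : Fin b} {t : Fin a} {x : Word (a + b)} {x₁ w₁ : Word a} {x₂ w₂ : Word b}
    (hx : f x = Fin.append x₁ x₂) (h₁ : (x₁, w₁ + x₂ c • (Pi.single t 1 : Word a)) ∈ T₁)
    (h₂ : (x₂, w₂) ∈ T₂) :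
    (x, Fin.append w₁ w₂) ∈ (T₁.comap (feedback c t) ⊓
      T₂.comap (rightPart.prodMap rightPart)).comap (f.prodMap LinearMap.id) := by
  constructor
  · change feedback c t (f x, Fin.append w₁ w₂) ∈ T₁
    rwa [hx, feedback_append]
  · change (rightPart (f x), rightPart (Fin.append w₁ w₂)) ∈ T₂
    rwa [hx, rightPart_append, rightPart_append]

theorem bits_perm_crossCnot_left {a b : ℕ} {p : Equiv.Perm (Fin (a + b))}
    {X : List (Fin a × Fin b)} {q : Fin (a + b)} {k : ℕ} (hq : (p q : ℕ) = k) (hk : k < a) :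
    Circuit.bits (Gate.perm p :: X.map crossCnot) (unitWord (a + b) q) =
      Fin.append (unitWord a k)
        (X.map fun e => unitWord a k e.1 • (Pi.single e.2 1 : Word b)).sum := by
  change Circuit.bits (X.map crossCnot) ((Gate.perm p).bits _) = _
  rw [perm_bits_unitWord, hq, unitWord_left hk, bits_map_crossCnot, zero_add]

theorem bits_perm_crossCnot_right {a b : ℕ} {p : Equiv.Perm (Fin (a + b))}
    {X : List (Fin a × Fin b)} {q : Fin (a + b)} {k : ℕ} (hq : (p q : ℕ) = a + k) :
    Circuit.bits (Gate.perm p :: X.map crossCnot) (unitWord (a + b) q) =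
      Fin.append 0 (unitWord b k) := by
  change Circuit.bits (X.map crossCnot) ((Gate.perm p).bits _) = _
  rw [perm_bits_unitWord, hq, unitWord_right, bits_map_crossCnot]
  have : (X.map fun e => (0 : Word a) e.1 • (Pi.single e.2 1 : Word b)).sum = 0 :=
    List.sum_eq_zero fun x hx => by
      obtain ⟨e, -, rfl⟩ := List.mem_map.1 hx
      simp
  rw [this, add_zero]

theorem single_last_eq {m : ℕ} {c : Fin (len m)} (hc : (c : ℕ) + 1 = len m) :
    (Pi.single c 1 : Word (len m)) = lastRow m := by
  ext i
  simp only [Pi.single_apply, lastRow, Fin.ext_iff]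
  congr 1
  rw [eq_iff_iff]; omega

theorem punct_lastRow {m : ℕ} {t : Fin (plen m)} (ht : (t : ℕ) + 1 = plen m) :
    punct m (lastRow m) = Pi.single t 1 := by
  have := plen_succ m
  ext i
  change (if ((Fin.cast (plen_succ m) i.succ : Fin (len m)) : ℕ) + 1 = len m then (1 : ZMod 2)
    else 0) = _
  rw [Pi.single_apply]
  congr 1
  rw [Fin.val_cast, Fin.val_succ, Fin.ext_iff, eq_iff_iff]
  omega

theorem punctSafe_G {r : ℤ} {m : ℕ} (h : r < m) : PunctSafe {g | g ∈ G r m} :=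
  punctSafe_of_rowDeg_lt fun g hg => ⟨(mem_G.1 hg).1, by have := (mem_G.1 hg).2; omega⟩

theorem nodup_G (r : ℤ) (m : ℕ) : (G r m).Nodup := by
  rw [G_eq_band (show (-1 : ℤ) < 0 by norm_num)]; exact nodup_band _ _ _

/-- The diagonal step of the encoder of the punctured code. -/
theorem Encodes.diag_step {r : ℕ} {C₁ : Circuit (plen (r + 1))} {C₂ : Circuit (len (r + 1))}
    {M₁ : List (Word (plen (r + 1)))} {M₂ : List (Word (len (r + 1)))}
    {M : List (Word (plen (r + 1) + len (r + 1)))}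
    {p : Equiv.Perm (Fin (plen (r + 1) + len (r + 1)))}
    {X : List (Fin (plen (r + 1)) × Fin (len (r + 1)))}
    {c : Fin (len (r + 1))} {t : Fin (plen (r + 1))}
    (h₁ : Encodes C₁ M₁ (punct (r + 1) '' {g | g ∈ G r (r + 1)}) ∅)
    (hC₂ : RecBasisQRM r (r + 1) C₂ M₂)
    (hM : M = (G ((r + 1 : ℕ) : ℤ) (r + 2)).map (punct (r + 2)))
    (hp : Routes (punct (r + 1)) M M₁ M₂ (G r (r + 1)) (G r (r + 1)) p)
    (hc : (c : ℕ) + 1 = len (r + 1)) (ht : (t : ℕ) + 1 = plen (r + 1))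
    (hpe : ∀ q : Fin (plen (r + 1) + len (r + 1)),
      (q : ℕ) = M.idxOf (Fin.append (punct (r + 1) (lastRow (r + 1))) (lastRow (r + 1))) →
        p q = Fin.natAdd (plen (r + 1)) c)
    (hX : FanOut (punct (r + 1)) M₁ M₂ (G r (r + 1)) X) :
    Encodes (n := plen (r + 2)) (stage [] p X ++ C₁.left (len (r + 1)) ++
      Gate.cnot (Fin.natAdd (plen (r + 1)) c) (Fin.castAdd (len (r + 1)) t)
        (castAdd_ne_natAdd t c).symm :: C₂.right (plen (r + 1))) M
      (punct (r + 2) '' {g | g ∈ G ((r + 1 : ℕ) : ℤ) (r + 2)}) ∅ := by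
  have h₂ := hC₂.encodes_fullRows
  have hM₂ := hC₂.index_eq
  subst hM₂
  have hsafe := punctSafe_G (r := ((r + 1 : ℕ) : ℤ)) (m := r + 2) (by push_cast; omega)
  have hsafe₁ := punctSafe_G (r := r) (m := r + 1) (by push_cast; omega)
  have hMn : M.Nodup := hM ▸ hsafe.nodup_map (nodup_G _ _)
  have hMl : M.length ≤ plen (r + 1) + len (r + 1) := hM ▸ hsafe.length_le (nodup_G _ _)
  have hcat : fullRows (r + 1) = G r (r + 1) ++ [lastRow (r + 1)] := by
    rw [G_self_eq_concat]; push_cast; rw [add_sub_cancel_right]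
  have hl := fullRows_idxOf_lastRow (r + 1)
  have hnm : lastRow (r + 1) ∉ G (r : ℤ) (r + 1) := fun h => by
    have := (mem_G.1 h).2
    rw [rowDeg_lastRow] at this
    push_cast at this; omega
  have hidx : ∀ v ∈ G (r : ℤ) (r + 1), (fullRows (r + 1)).idxOf v = (G r (r + 1)).idxOf v ∧
      (G (r : ℤ) (r + 1)).idxOf v ≠ c := by
    intro v hv
    have h₁ : (fullRows (r + 1)).idxOf v = (G r (r + 1)).idxOf v := by
      rw [hcat, List.idxOf_append_of_mem hv]
    refine ⟨h₁, fun h => hnm ?_⟩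
    have : (fullRows (r + 1)).idxOf v = (fullRows (r + 1)).idxOf (lastRow (r + 1)) := by
      rw [h₁]; omega
    rwa [← (List.idxOf_inj (mem_G.1 hv).1).1 this]
  refine ⟨hMn, hMl, ?_, ?_⟩
  · rw [hM]; rintro _ ⟨g, hg, rfl⟩; exact List.mem_map_of_mem hg
  have e₁ := h₁.enc
  have e₂ := h₂.enc
  rw [Submodule.span_empty] at e₁ e₂ ⊢
  have hfb := (e₁.par_feedback e₂ c t).linear_append (hCount_perm_crossCnot p X)
  rw [List.append_assoc, show stage [] p X = Gate.perm p :: X.map crossCnot from rfl]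
  refine hfb.mono (Submodule.span_le.2 ?_)
  rintro _ ⟨_, ⟨g, hg, rfl⟩, rfl⟩
  have hlt : M.idxOf (punct (r + 2) g) < plen (r + 1) + len (r + 1) :=
    (List.idxOf_lt_length_iff.2 (hM ▸ List.mem_map_of_mem hg)).trans_le hMl
  obtain ⟨q, hq⟩ : ∃ q : Fin (plen (r + 1) + len (r + 1)), (q : ℕ) = M.idxOf (punct (r + 2) g) :=
    ⟨⟨_, hlt⟩, rfl⟩
  have hG : g ∈ (G ((r + 1 : ℕ) : ℤ) (r + 1)).map (fun u => Fin.append u u) ++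
    (G (((r + 1 : ℕ) : ℤ) - 1) (r + 1)).map (fun v => Fin.append 0 v) := hg
  rw [← fullRows_eq_G le_rfl, show ((r + 1 : ℕ) : ℤ) - 1 = r by push_cast; ring, List.mem_append,
    List.mem_map, List.mem_map] at hG
  -- No row of `G(r, r + 1)` uses the last qubit of the second part, so the additional CNOT does
  -- nothing for these rows.
  have hz : ∀ v ∈ G (r : ℤ) (r + 1), unitWord (len (r + 1)) ((G (r : ℤ) (r + 1)).idxOf v) c = 0 :=
    fun v hv => if_neg (hidx v hv).2
  have hmsg : ∀ v ∈ G (r : ℤ) (r + 1), (unitWord (len (r + 1)) ((G (r : ℤ) (r + 1)).idxOf v), v) ∈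
      msgRel (fullRows (r + 1)) {g | g ∈ fullRows (r + 1)} := fun v hv => by
    rw [← (hidx v hv).1]
    exact mem_msgRel (mem_G.1 hv).1
  rcases hG with ⟨u, hu, rfl⟩ | ⟨v, hv, rfl⟩
  · rw [punct_append] at hq ⊢
    by_cases hul : u = lastRow (r + 1)
    · subst hul
      have hbits := bits_perm_crossCnot_right (X := X) (congrArg Fin.val (hpe q hq))
      rw [hq] at hbits
      refine mem_comap_feedback hbits ?_ ?_
      -- The punctured row `e^*` is the unit word of the target `t`. The CNOT alone creates the
      -- first half, and `C₁` only has to fix zero.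
      · rw [punct_lastRow ht, show unitWord (len (r + 1)) c c = 1 from if_pos rfl, one_smul,
          word_add_self]
        exact zero_mem _
      · rw [show (c : ℕ) = (fullRows (r + 1)).idxOf (lastRow (r + 1)) by omega]
        exact mem_msgRel (lastRow_mem _)
    · have hu' : u ∈ G (r : ℤ) (r + 1) := by
        have := rowDeg_lt hu hul
        exact mem_G.2 ⟨hu, by omega⟩
      have hk := h₁.idxOf_lt ⟨u, hu', rfl⟩
      have hbits := bits_perm_crossCnot_left (X := X) (hp.1 u hu' q hq) hk
      rw [hq, sum_fanOut hX (nodup_G _ _) (fun w hw e => hsafe₁.injOn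
        (Submodule.subset_span hu') (Submodule.subset_span hw)
        ((List.idxOf_inj (h₁.mem _ ⟨u, hu', rfl⟩)).1 e)), if_pos hu'] at hbits
      refine mem_comap_feedback hbits ?_ (hmsg u hu')
      rw [hz u hu', zero_smul, add_zero]
      exact mem_msgRel ⟨u, hu', rfl⟩
  · rw [punct_append, map_zero] at hq ⊢
    have hbits := bits_perm_crossCnot_right (X := X) (hp.2 v hv q hq)
    rw [hq] at hbits
    refine mem_comap_feedback hbits ?_ (hmsg v hv)
    rw [hz v hv, zero_smul, add_zero]
    exact zero_mem _

theorem setOf_one_cons_band {r : ℤ} (hr : 0 ≤ r) (m : ℕ) :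
    {g | g ∈ 1 :: band 0 r m} = {g | g ∈ G r m} := by
  rw [G_eq_one_cons hr]

theorem RecPQRM.lt {r m : ℕ} {C : Circuit (plen m)} {M : List (Word (plen m))}
    (h : RecPQRM r m C M) : r < m := by
  cases h <;> omega

theorem RecPQRM.encodes {r m : ℕ} {C : Circuit (plen m)} {M : List (Word (plen m))}
    (h : RecPQRM r m C M) : Encodes C M (punct m '' {g | g ∈ 1 :: band ((m : ℤ) - r - 1) r m})
      (punct m '' {g | g ∈ band 0 ((m : ℤ) - r - 1) m}) := by
  induction h with
  | base =>
    rw [band_eq_nil (show ((0 : ℕ) : ℤ) ≤ ((1 : ℕ) : ℤ) - ((0 : ℕ) : ℤ) - 1 by norm_num),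
      band_eq_nil (show ((1 : ℕ) : ℤ) - ((0 : ℕ) : ℤ) - 1 ≤ 0 by norm_num)]
    have e₁ : punct 1 '' {g | g ∈ [1]} = {1} := by
      simp [punct_one 1]
    have e₂ : punct 1 '' {g | g ∈ ([] : List (Word (len 1)))} = ∅ := by simp
    have e₃ : (G 0 1).map (punct 1) = [1] := by
      rw [G_eq_one_cons le_rfl, band_eq_nil le_rfl, List.map_singleton, punct_one]
    rw [e₁, e₂, e₃]
    exact encodes_one
  | @diag r C₁ C₂ M₁ M₂ M p X e c t hC₁ hC₂ hM hp hc ht he hpe hX ih =>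
    -- On the diagonal the bound `m - r - 1` is `0`: the band spanning the code is empty, and the
    -- all-ones row together with the rows of positive degree is all of `G(r, m)`.
    have e₁ : ((r + 1 : ℕ) : ℤ) - r - 1 = 0 := by push_cast; ring
    have e₂ : ((r + 2 : ℕ) : ℤ) - ((r + 1 : ℕ) : ℤ) - 1 = 0 := by push_cast; ring
    have hnil : ∀ n, punct n '' {g | g ∈ band 0 0 n} = ∅ := fun n => by
      rw [band_eq_nil le_rfl]; simp
    rw [e₁, setOf_one_cons_band (by omega), hnil] at ih
    rw [e₂, setOf_one_cons_band (by omega), hnil]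
    rw [he, single_last_eq hc] at hpe
    exact ih.diag_step hC₂ hM hp hc ht hpe hX
  | @step r m C₁ C₂ M₁ M₂ M K p X hr hmr hC₁ hC₂ hM hK hp hX ih =>
    simp only [rowDiff_G] at hM hp hX
    have e : ((m + 1 : ℕ) : ℤ) - r - 1 = m - r := by push_cast; ring
    rw [e]
    refine Encodes.punct_step (k := 1) ih hC₂.encodes (by omega) (by omega) (by omega) le_rfl
      (by omega) hM ?_ hp hX
    rw [hK, length_band (a := m + 1 - r) (by omega), length_band_one (d := m - r) (by omega)
      (by omega)]

theorem RecBasisPQRM.lt {r m : ℕ} {C : Circuit (plen m)} {M : List (Word (plen m))}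
    (h : RecBasisPQRM r m C M) : r < m := by
  cases h <;> omega

theorem RecBasisPQRM.encodes {r m : ℕ} {C : Circuit (plen m)} {M : List (Word (plen m))}
    (h : RecBasisPQRM r m C M) : Encodes C M (punct m '' {g | g ∈ band (-1) r m}) ∅ := by
  have hnil : ∀ lo hi n, hi ≤ lo ∨ hi < 0 → punct n '' {g | g ∈ band lo hi n} = ∅ := by
    rintro lo hi n (h | h)
    · rw [band_eq_nil h]; simp
    · rw [band_eq_nil_of_neg h]; simp
  induction h with
  | @diag C M hC =>
    have := hC.encodes
    rw [show ((r + 1 : ℕ) : ℤ) - r - 1 = 0 by push_cast; ring, setOf_one_cons_band (by omega),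
      hnil 0 0 _ (Or.inl le_rfl)] at this
    rwa [← G_eq_band (by norm_num)]
  | @step m C₁ C₂ M₁ M₂ M p X hr hC₁ hC₂ hM hp hX ih =>
    have h2 : (-1 - 1 : ℤ) < 0 := by norm_num
    -- With `lo = -1` and `k = 0` the all-ones row is an ordinary row of the band and has its own
    -- CNOT; the code is zero and no Hadamard gate occurs.
    have := Encodes.punct_step (lo := -1) (hi := r) (k := 0) (C₁ := C₁) (C₂ := C₂) (M₁ := M₁)
      (M₂ := M₂) (K := []) (p := p) (X := X) (M := M) (m := m) (by
        rw [hnil 0 (-1 - 1) _ (Or.inr h2), band_congr_lo h2 (show (-1 : ℤ) < 0 by norm_num)]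
        exact ih) (by
        rw [band_congr_lo h2 (show (-1 : ℤ) < 0 by norm_num),
          band_eq_nil_of_neg (hi := -1 - 1) (by norm_num)]
        simpa using hC₂.encodes) (by omega) (by norm_num) (by omega) (by omega) (by omega)
      (by
        rw [hM, band_eq_nil_of_neg (hi := -1) (by norm_num),
          G_eq_band (show (-1 : ℤ) < 0 by norm_num)]
        exact (List.append_nil _).symm)
      (by rw [band_eq_nil_of_neg (hi := -1) (by norm_num)]; rfl)
      (by rw [← G_eq_band h2, ← G_eq_band h2]; exact hp)
      (by rwa [← G_eq_band h2])
    rw [hnil 0 (-1) _ (Or.inl (by norm_num))] at this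
    exact this

theorem RecBasisPQRM.index_eq {r m : ℕ} {C : Circuit (plen m)} {M : List (Word (plen m))}
    (h : RecBasisPQRM r m C M) : M = (G r m).map (punct m) := by
  cases h with
  | diag hC =>
    cases hC with
    | base => rfl
    | diag hC₁ hC₂ hM => exact hM
    | step hr => omega
  | step hr hC₁ hC₂ hM => exact hM

theorem RecPQRM.index_eq {r m : ℕ} {C : Circuit (plen m)} {M : List (Word (plen m))}
    (h : RecPQRM r m C M) :
    ∃ l, M = (1 :: band ((m : ℤ) - r - 1) r m).map (punct m) ++ l := by
  cases h with
  | base =>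
    refine ⟨[], ?_⟩
    rw [List.append_nil, G_eq_one_cons le_rfl]
    rfl
  | diag hC₁ hC₂ hM =>
    refine ⟨[], ?_⟩
    rw [List.append_nil, hM, G_eq_one_cons (by omega)]
    congr 3
    push_cast; ring
  | @step r m C₁ C₂ M₁ M₂ M K p X hr hmr hC₁ hC₂ hM hK hp hX =>
    refine ⟨dbl (punct m) (rowDiff (G ((m : ℤ) - r) m) (G ((m : ℤ) - r - 1) m)), hM.trans ?_⟩
    rw [rowDiff_G, show ((m + 1 : ℕ) : ℤ) - r - 1 = m - r by push_cast; ring]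
    rfl

/-- The steps of the state preparation circuits without Hadamard gates. -/
theorem Encodes.prep_step {r : ℕ} {hi : ℤ} {C₁ : Circuit (plen r)} {C₂ : Circuit (len r)}
    {M₁ : List (Word (plen r))} {M₂ : List (Word (len r))}
    (h₁ : Encodes C₁ M₁ (punct r '' {g | g ∈ band 0 r r}) ∅) (hC₂ : RecQRM r r C₂ M₂)
    {M : List (Word (plen r + len r))} {p : Equiv.Perm (Fin (plen r + len r))}
    {X : List (Fin (plen r) × Fin (len r))}
    (hM : M = (band 0 hi (r + 1)).map (punct (r + 1)))
    (hp : Routes (punct r) M M₁ M₂ (band 0 r r) (G (hi - 1) r) p)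
    (hX : FanOut (punct r) M₁ M₂ (band 0 r r) X) :
    Encodes (stage [] p X ++ par C₁ C₂ : Circuit (plen (r + 1))) M
      (punct (r + 1) '' {g | g ∈ band 0 hi (r + 1)}) ∅ := by
  have hsafe : ∀ hi n, PunctSafe {g | g ∈ band 0 hi n} := fun hi n =>
    ⟨fun g hg => (mem_band.1 hg).1, Or.inr fun h => by have := (one_mem_band.1 h).1; omega⟩
  have h₂ := hC₂.encodes
  rw [show (r : ℤ) - r - 1 = -1 by ring, band_eq_nil_of_neg (hi := -1) (by norm_num),
    ← G_eq_band (by norm_num), ← fullRows_eq_G le_rfl] at h₂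
  rw [show {g : Word (len r) | g ∈ []} = (∅ : Set (Word (len r))) by simp] at h₂
  have hG : ∀ (k : ℤ) u, u ∈ band 0 k r → u ∈ band 0 r r := fun k u hu => by
    have h := mem_band.1 hu
    have := rowDeg_le h.1
    exact mem_band.2 ⟨h.1, h.2.1, by omega⟩
  refine Encodes.linear_step h₁ h₂ (hM ▸ (hsafe _ _).nodup_map (nodup_band _ _ _))
    (hM ▸ (hsafe _ _).length_le (nodup_band _ _ _))
    (fun _ hx _ hy e => (hsafe r r).injOn (Submodule.subset_span hx) (Submodule.subset_span hy) e)
    (fun u hu => ⟨u, hu, rfl⟩) (fun v hv => (mem_G.1 hv).1) (fun u hu => ⟨hu, (mem_band.1 hu).1⟩)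
    (nodup_band _ _ _) (fun u hu hu' => absurd hu hu') hp hX ?_ ?_ ?_
  · rw [hM]; rintro _ ⟨g, hg, rfl⟩; exact List.mem_map_of_mem hg
  · rintro _ ⟨g, hg, rfl⟩
    rcases mem_band_succ.1 hg with ⟨u, hu, rfl⟩ | ⟨v, hv, rfl⟩
    · exact Or.inl ⟨u, hG _ _ hu, punct_append u u⟩
    · refine Or.inr ⟨v, ?_, by rw [punct_append, map_zero]⟩
      have := mem_band.1 hv
      exact mem_G.2 ⟨this.1, this.2.2⟩
  · rw [Submodule.span_empty, Submodule.span_empty, Submodule.span_empty, prodCode,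
      Submodule.prod_bot, Submodule.map_bot]

/-- For `r = m` the bound `m - r - 1` equals `-1`, and the interval would contain the degree of the
all-ones row; the maximum with `0` excludes it. -/
theorem RecStatePrepPQRM.encodes {r m : ℕ} {C : Circuit (plen m)} {M : List (Word (plen m))}
    (h : RecStatePrepPQRM r m C M) :
    Encodes C M (punct m '' {g | g ∈ band (max ((m : ℤ) - r - 1) 0) r m})
      (punct m '' {g | g ∈ band 0 ((m : ℤ) - r - 1) m}) := by
  have hnil : ∀ hi n, hi ≤ 0 → punct n '' {g | g ∈ band 0 hi n} = ∅ := by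
    rintro hi n h
    rw [band_eq_nil h]; simp
  induction h with
  | base =>
    rw [show max (((0 : ℕ) : ℤ) - ((0 : ℕ) : ℤ) - 1) 0 = 0 by simp, hnil _ _ (by simp),
      hnil _ _ (by simp)]
    refine ⟨List.nodup_nil, le_rfl, fun _ h => h.elim, fun x w _ => ?_⟩
    rw [Submodule.span_empty, cosetState_bot, Subsingleton.elim (α := Fin 0 → ZMod 2) x w]
    exact Matrix.one_mulVec _
  | @full r C₁ C₂ M₁ M₂ M p X hC₁ hC₂ hM hp hX ih =>
    rw [rowDiff_G_one] at hM hp hX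
    have e : ∀ n : ℕ, max ((n : ℤ) - n - 1) 0 = 0 := fun n => by omega
    rw [e, hnil ((r : ℤ) - r - 1) r (by omega)] at ih
    rw [e, hnil (((r + 1 : ℕ) : ℤ) - (r + 1 : ℕ) - 1) (r + 1) (by omega)]
    refine ih.prep_step hC₂ hM ?_ hX
    rwa [show ((r + 1 : ℕ) : ℤ) - 1 = r by push_cast; ring]
  | @diag r C₁ C₂ M₁ M₂ M p X hC₁ hC₂ hM hp hX ih =>
    rw [rowDiff_G_one] at hM hp hX
    have e : max ((r : ℤ) - r - 1) 0 = 0 := by omega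
    have e' : max (((r + 1 : ℕ) : ℤ) - r - 1) 0 = 0 := by omega
    rw [e, hnil ((r : ℤ) - r - 1) r (by omega)] at ih
    rw [e', hnil (((r + 1 : ℕ) : ℤ) - r - 1) (r + 1) (by omega)]
    exact ih.prep_step hC₂ hM hp hX
  | @step r m C₁ C₂ M₁ M₂ M K p X hr hmr hC₁ hC₂ hM hK hp hX ih =>
    simp only [rowDiff_G] at hM hp hX
    have e : ((m + 1 : ℕ) : ℤ) - r - 1 = m - r := by push_cast; ring
    rw [max_eq_left (by omega)] at ih
    rw [e, max_eq_left (by omega)]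
    refine Encodes.punct_step (k := 0) ih hC₂.encodes (by omega) (by omega) (by omega) (by omega)
      (by omega) hM ?_ hp hX
    rw [hK, length_band (a := m + 1 - r) (by omega), length_band_one (d := m - r) (by omega)
      (by omega), zero_add]

theorem RecStatePrepPQRM.index_eq {r m : ℕ} {C : Circuit (plen m)} {M : List (Word (plen m))}
    (h : RecStatePrepPQRM r m C M) :
    ∃ l, M = (band (max ((m : ℤ) - r - 1) 0) r m).map (punct m) ++ l := by
  cases h with
  | base => exact ⟨[], rfl⟩
  | full hC₁ hC₂ hM =>
    refine ⟨[], ?_⟩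
    rw [List.append_nil, hM, rowDiff_G_one]
    congr 2; omega
  | diag hC₁ hC₂ hM =>
    refine ⟨[], ?_⟩
    rw [List.append_nil, hM, rowDiff_G_one]
    congr 2; omega
  | @step r m C₁ C₂ M₁ M₂ M K p X hr hmr hC₁ hC₂ hM hK hp hX =>
    refine ⟨dbl (punct m) (rowDiff (G ((m : ℤ) - r) m) (G ((m : ℤ) - r - 1) m)), hM.trans ?_⟩
    rw [rowDiff_G, max_eq_left (by omega),
      show ((m + 1 : ℕ) : ℤ) - r - 1 = m - r by push_cast; ring]
    rfl

theorem RecPZQRM.encodes {r₀ m₀ r m : ℕ} {C : Circuit (plen m)} {M : List (Word (plen m))}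
    (h : RecPZQRM r₀ m₀ r m C M) (hr : r ≤ r₀) :
    Encodes C M (punct m '' {g | g ∈ 1 :: band r r₀ m}) (punct m '' {g | g ∈ band 0 r m}) := by
  have hnil : ∀ n, punct n '' {g | g ∈ band 0 0 n} = ∅ := fun n => by
    rw [band_eq_nil le_rfl]; simp
  induction h with
  | @basis m C M h hC =>
    rw [Nat.cast_zero, setOf_one_cons_band (by omega), hnil,
      G_eq_band (show (-1 : ℤ) < 0 by norm_num)]
    exact hC.encodes
  | @full C M K h hC hK =>
    have hE := hC.encodes
    rw [rowDiff_G_one] at hK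
    rw [show ((r₀ + 1 : ℕ) : ℤ) - r₀ - 1 = 0 by push_cast; ring, hnil] at hE
    -- Only `s ≤ r₀`, which is `hr`, matters from here on: it puts every row that gets a Hadamard
    -- gate among the messages of `U^*(r₀, r₀ + 1)`.
    generalize 2 * r₀ + 1 - m₀ = s at hK hr ⊢
    have hsafe : PunctSafe {g | g ∈ band 0 r₀ (r₀ + 1)} :=
      (punctSafe_G (r := (r₀ : ℤ)) (m := r₀ + 1) (by omega)).mono fun g hg =>
        mem_G.2 ⟨(mem_band.1 hg).1, (mem_band.1 hg).2.2⟩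
    have hsub : ∀ g ∈ band 0 s (r₀ + 1), g ∈ band 0 r₀ (r₀ + 1) := fun g hg =>
      band_subset le_rfl (by omega) hg
    have hset : {g | g ∈ (band 0 s (r₀ + 1)).map (punct (r₀ + 1))} =
        punct (r₀ + 1) '' {g | g ∈ band 0 s (r₀ + 1)} := by ext; simp
    have hsafe₁ : PunctSafe {g | g ∈ G r₀ (r₀ + 1)} := punctSafe_G (by omega)
    refine hE.hadamards (G₂ := (band 0 s (r₀ + 1)).map (punct (r₀ + 1)))
      ((hsafe.mono hsub).nodup_map (nodup_band _ _ _)) ?_ ?_ ?_ (fun g _ hg => hg) ?_ ?_ ?_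
    · intro g hg
      obtain ⟨u, hu, rfl⟩ := List.mem_map.1 hg
      exact ⟨u, List.mem_cons_of_mem _ (hsub u hu), rfl⟩
    · rw [hK, List.map_map]; rfl
    · rw [Set.empty_union, hset]
      exact (hsafe.mono hsub).linearIndepOn
    · rintro _ ⟨g, hg, rfl⟩
      refine ⟨g, ?_, rfl⟩
      exact (List.mem_cons.1 hg).elim (fun h => h ▸ List.mem_cons_self)
        fun h => List.mem_cons_of_mem _ (band_subset (by omega) le_rfl h)
    · rintro g hg ⟨v, hv, e⟩
      obtain ⟨u, hu, rfl⟩ := List.mem_map.1 hg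
      have hv' : v ∈ G (r₀ : ℤ) (r₀ + 1) := by
        rw [G_eq_one_cons (by omega)]
        exact (List.mem_cons.1 hv).elim (fun h => h ▸ List.mem_cons_self)
          fun h => List.mem_cons_of_mem _ (band_subset (by omega) le_rfl h)
      have hu' : u ∈ G (r₀ : ℤ) (r₀ + 1) := by
        rw [G_eq_one_cons (by omega)]
        exact List.mem_cons_of_mem _ (hsub u hu)
      have := hsafe₁.injOn (Submodule.subset_span hv') (Submodule.subset_span hu') e
      subst this
      have h₁ := mem_band.1 hu
      rcases List.mem_cons.1 hv with rfl | hv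
      · rw [rowDeg_one] at h₁; omega
      · have := mem_band.1 hv; omega
    · rw [Set.empty_union, hset]
  | @step r m C₁ C₂ M₁ M₂ M K p X hr' hm hC₁ hC₂ hM hK hp hX ih =>
    simp only [rowDiff_G] at hM hp hX
    have e : ((r + 1 : ℕ) : ℤ) - 1 = r := by push_cast; ring
    refine Encodes.punct_step (k := 1) (lo := ((r + 1 : ℕ) : ℤ)) (hi := r₀) (C₁ := C₁) (C₂ := C₂)
      (M₁ := M₁) (M₂ := M₂) ?_ ?_ (by omega) (by omega) (by omega) le_rfl
      (by omega) (M := M) ?_ ?_ ?_ ?_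
    · rw [e]; exact ih (by omega)
    · rw [e]; exact hC₂.encodes
    · rw [e]; exact hM
    · rw [hK, length_band (a := r + 2) (by push_cast; omega),
        length_band_one (d := r + 1) (by omega) (by omega)]
    · rw [e]; exact hp
    · rw [e]; exact hX

/-! ## The encoder property -/

/-- An index map that begins with the generators assigns message bit `j` to qubit `j`, as the
position map `Fin.val` requires. -/
theorem idxOf_prefix {α : Type*} [DecidableEq α] {A M : List α} (hM : M.Nodup)
    (h : ∃ l, M = A ++ l) (j : Fin A.length) : (j : ℕ) = M.idxOf A[j] := by
  obtain ⟨l, rfl⟩ := h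
  change _ = List.idxOf A[(j : ℕ)] (A ++ l)
  rw [List.idxOf_append_of_mem (List.getElem_mem j.2)]
  exact ((List.nodup_append.1 hM).1.idxOf_getElem j j.2).symm

theorem disjoint_band {lo lo' hi : ℤ} (m : ℕ) :
    Disjoint {g | g ∈ band lo hi m} {g | g ∈ band lo' lo m} :=
  Set.disjoint_left.2 fun _ h h' => by
    have h₁ := mem_band.1 h
    have h₂ := mem_band.1 h'
    omega

theorem band_union {lo mid hi : ℤ} (h₁ : lo ≤ mid) (h₂ : mid ≤ hi) (m : ℕ) :
    {g | g ∈ band mid hi m} ∪ {g | g ∈ band lo mid m} = {g | g ∈ band lo hi m} := by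
  ext g
  simp only [Set.mem_union, Set.mem_ofPred_eq, mem_band]
  constructor
  · rintro (h | h) <;> exact ⟨h.1, by omega, by omega⟩
  · rintro ⟨h, h', h''⟩
    by_cases hg : mid < rowDeg m g
    · exact Or.inl ⟨h, hg, h''⟩
    · exact Or.inr ⟨h, h', by omega⟩

theorem Encodes.isEncoder_band {lo hi : ℤ} {m : ℕ} {C : Circuit (len m)} {M : List (Word (len m))}
    (h : Encodes C M {g | g ∈ band lo hi m} {g | g ∈ band (-1) lo m}) (h₁ : -1 ≤ lo)
    (h₂ : lo ≤ hi) {pos : Fin (band lo hi m).length → ℕ}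
    (hpos : ∀ j, pos j = M.idxOf (band lo hi m)[j]) :
    IsEncoder (RM lo m) (RM hi m) (band lo hi m) pos C.mat := by
  have h0 : (-1 : ℤ) < 0 := by norm_num
  refine h.isEncoder (nodup_band _ _ _) rfl ?_ (disjoint_band m) (RM_eq_span h0 _ _) ?_ hpos
  · rw [band_union h₁ h₂]
    exact linearIndepOn_of_subset_fullRows fun g hg => (mem_band.1 hg).1
  · rw [band_union h₁ h₂, RM_eq_span h0]

theorem PunctSafe.disjoint_image {m : ℕ} {S T : Set (Word (len m))} (h : PunctSafe (S ∪ T))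
    (hd : Disjoint S T) : Disjoint (punct m '' S) (punct m '' T) :=
  Set.disjoint_left.2 fun _ ⟨s, hs, e⟩ ⟨t, ht, e'⟩ => by
    obtain rfl := h.injOn (Submodule.subset_span (Or.inl hs)) (Submodule.subset_span (Or.inr ht))
      (e.trans e'.symm)
    exact Set.disjoint_left.1 hd hs ht

theorem Encodes.isEncoder_punct {m : ℕ} {C : Circuit (plen m)} {M : List (Word (plen m))}
    {A B : List (Word (len m))} (h : Encodes C M (punct m '' {g | g ∈ A}) (punct m '' {g | g ∈ B}))
    (hA : A.Nodup) (hd : Disjoint {g | g ∈ A} {g | g ∈ B})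
    (hs : PunctSafe ({g | g ∈ A} ∪ {g | g ∈ B})) {D E : Submodule (ZMod 2) (Word (plen m))}
    (hD : D = Submodule.span (ZMod 2) (punct m '' {g | g ∈ B}))
    (hE : E = Submodule.span (ZMod 2) (punct m '' ({g | g ∈ A} ∪ {g | g ∈ B})))
    {pos : Fin (A.map (punct m)).length → ℕ}
    (hpos : ∀ j, pos j = M.idxOf (A.map (punct m))[j]) :
    IsEncoder D E (A.map (punct m)) pos C.mat := by
  refine h.isEncoder ((hs.mono Set.subset_union_left).nodup_map hA) ?_ ?_ (hs.disjoint_image hd)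
    hD ?_ hpos
  · ext g; simp
  · rw [← Set.image_union]
    exact hs.linearIndepOn
  · rw [hE, Set.image_union]

theorem Encodes.isEncoder_punct_band {lo hi : ℤ} {m : ℕ} {C : Circuit (plen m)}
    {M : List (Word (plen m))}
    (h : Encodes C M (punct m '' {g | g ∈ 1 :: band lo hi m}) (punct m '' {g | g ∈ band 0 lo m}))
    (h₁ : 0 ≤ lo) (h₂ : lo ≤ hi) (h₃ : hi < m) {D : Submodule (ZMod 2) (Word (plen m))}
    (hD : D = Submodule.span (ZMod 2) (punct m '' {g | g ∈ band 0 lo m}))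
    {pos : Fin ((1 :: band lo hi m).map (punct m)).length → ℕ}
    (hpos : ∀ j, pos j = M.idxOf ((1 :: band lo hi m).map (punct m))[j]) :
    IsEncoder D (pRM hi m) ((1 :: band lo hi m).map (punct m)) pos C.mat := by
  have hU : {g | g ∈ 1 :: band lo hi m} ∪ {g | g ∈ band 0 lo m} = {g | g ∈ G hi m} := by
    rw [G_eq_one_cons (h₁.trans h₂)]
    have : ∀ l : List (Word (len m)), {g | g ∈ 1 :: l} = {1} ∪ {g | g ∈ l} := fun l => by
      ext; simp
    rw [this, this, Set.union_assoc, band_union h₁ h₂]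
  refine h.isEncoder_punct (List.nodup_cons.2 ⟨fun h => ?_, nodup_band _ _ _⟩) ?_ ?_ hD ?_ hpos
  · have := one_mem_band.1 h; omega
  · refine Set.disjoint_left.2 fun g hg hg' => ?_
    rcases List.mem_cons.1 hg with rfl | hg
    · have := one_mem_band.1 hg'; omega
    · exact Set.disjoint_left.1 (disjoint_band m) hg hg'
  · rw [hU]; exact punctSafe_G h₃
  · rw [hU, pRM_eq_span]

/-! ### The seven constructions are unitary encoders -/

theorem RecQRM.isEncoder {r m : ℕ} {C : Circuit (len m)} {M : List (Word (len m))}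
    (hm : m ≤ 2 * r + 1) (hr : r ≤ m) (h : RecQRM r m C M) :
    IsEncoder (dual (RM r m)) (RM r m) (rowDiff (G r m) (G ((m : ℤ) - r - 1) m)) Fin.val C.mat := by
  rw [dual_RM, rowDiff_G]
  exact h.encodes.isEncoder_band (by omega) (by omega)
    (idxOf_prefix h.encodes.nodup h.index_eq)

theorem RecBasisQRM.isEncoder {r m : ℕ} {C : Circuit (len m)} {M : List (Word (len m))}
    (h : RecBasisQRM r m C M) : IsEncoder ⊥ (RM r m) (G r m) Fin.val C.mat := by
  have h0 : (-1 : ℤ) < 0 := by norm_num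
  have e : (⊥ : Submodule (ZMod 2) (Word (len m))) = RM (-1) m := by
    rw [RM_eq_span h0, band_eq_nil_of_neg h0]; simp
  have hG : G r m = band (-1) r m := G_eq_band h0 r m
  rw [e, hG]
  refine Encodes.isEncoder_band (M := M) ?_ le_rfl (by omega)
    (idxOf_prefix h.encodes.nodup ⟨[], by rw [h.index_eq, hG, List.append_nil]⟩)
  have := h.encodes
  rwa [band_eq_nil_of_neg h0, show {g : Word (len m) | g ∈ []} = ∅ by simp]

theorem RecZQRM.isEncoder {r₀ m₀ : ℕ} {r : ℤ} {m : ℕ} {C : Circuit (len m)}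
    {M : List (Word (len m))} (hz : ZRange r₀ m₀ r m) (h : RecZQRM r₀ m₀ r m C M) :
    IsEncoder (RM r m) (RM r₀ m) (rowDiff (G r₀ m) (G r m))
      (fun j => M.idxOf ((rowDiff (G r₀ m) (G r m)).get j)) C.mat := by
  -- The domain of the position map depends on the list of generators, so the list is generalized
  -- before it is replaced by a band.
  suffices H : ∀ L : List (Word (len m)), L = band r r₀ m →
      IsEncoder (RM r m) (RM r₀ m) L (fun j => M.idxOf (L.get j)) C.mat from H _ (rowDiff_G _ _ _)
  rintro _ rfl
  exact h.encodes.isEncoder_band hz.1 hz.2.1 fun j => rfl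

theorem RecPQRM.isEncoder {r m : ℕ} {C : Circuit (plen m)} {M : List (Word (plen m))}
    (hm : m ≤ 2 * r + 1) (hr : r < m) (h : RecPQRM r m C M) :
    IsEncoder (dual (pRM r m)) (pRM r m)
      ((1 :: rowDiff (G r m) (G ((m : ℤ) - r - 1) m)).map (punct m)) Fin.val C.mat := by
  rw [rowDiff_G]
  exact h.encodes.isEncoder_punct_band (by omega) (by omega) (by omega) (dual_pRM _ _)
    (idxOf_prefix h.encodes.nodup h.index_eq)

theorem RecBasisPQRM.isEncoder {r m : ℕ} {C : Circuit (plen m)} {M : List (Word (plen m))}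
    (h : RecBasisPQRM r m C M) :
    IsEncoder ⊥ (pRM r m) ((G r m).map (punct m)) Fin.val C.mat := by
  have hG : G r m = 1 :: band 0 r m := G_eq_one_cons (by omega) m
  have hB : punct m '' {g | g ∈ band 0 0 m} = ∅ := by rw [band_eq_nil le_rfl]; simp
  have hE := h.encodes
  have hlt := h.lt
  rw [← G_eq_band (by norm_num), hG, ← hB] at hE
  rw [hG]
  refine hE.isEncoder_punct_band le_rfl (by omega) (by omega) ?_
    (idxOf_prefix hE.nodup ⟨[], by rw [h.index_eq, hG, List.append_nil]⟩)
  rw [hB, Submodule.span_empty]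

theorem RecPZQRM.isEncoder {r₀ m₀ r m : ℕ} {C : Circuit (plen m)} {M : List (Word (plen m))}
    (hz : PZRange r₀ m₀ r m) (h : RecPZQRM r₀ m₀ r m C M) :
    IsEncoder (pRMmod r m) (pRM r₀ m) ((1 :: rowDiff (G r₀ m) (G r m)).map (punct m))
      (fun j => M.idxOf (((1 :: rowDiff (G r₀ m) (G r m)).map (punct m)).get j)) C.mat := by
  obtain ⟨h₁, h₂, -⟩ := hz
  suffices H : ∀ L : List (Word (len m)), L = band r r₀ m →
      IsEncoder (pRMmod r m) (pRM r₀ m) ((1 :: L).map (punct m))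
        (fun j => M.idxOf (((1 :: L).map (punct m)).get j)) C.mat from H _ (rowDiff_G _ _ _)
  rintro _ rfl
  exact (h.encodes h₁).isEncoder_punct_band (by omega) (by omega) (by omega)
    (pRMmod_eq_span _ _) fun j => rfl

theorem RecStatePrepPQRM.isEncoder {r m : ℕ} {C : Circuit (plen m)} {M : List (Word (plen m))}
    (hm : m ≤ 2 * r + 1) (hr : r ≤ m) (h : RecStatePrepPQRM r m C M) :
    IsEncoder (dual (pRM r m)) (pRMmod r m)
      ((rowDiff (rowDiff (G r m) (G ((m : ℤ) - r - 1) m)) [1]).map (punct m)) Fin.val C.mat := by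
  rw [rowDiff_G, rowDiff_one _ rfl]
  -- If `m - r - 1` is negative, both bands are empty.
  have hB : band 0 ((m : ℤ) - r - 1) m = band 0 (max ((m : ℤ) - r - 1) 0) m := by
    by_cases h : 0 ≤ (m : ℤ) - r - 1
    · rw [max_eq_left h]
    · rw [band_eq_nil (by omega), band_eq_nil (by omega)]
  have hE := h.encodes
  have hU := band_union (lo := 0) (mid := max ((m : ℤ) - r - 1) 0) (hi := r) (le_max_right _ _)
    (by omega) m
  rw [dual_pRM, hB]
  rw [hB] at hE
  refine hE.isEncoder_punct (nodup_band _ _ _) (disjoint_band m) ?_ rfl ?_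
    (idxOf_prefix h.encodes.nodup h.index_eq)
  · rw [hU]
    exact ⟨fun g hg => (mem_band.1 hg).1, Or.inr fun h => by have := one_mem_band.1 h; omega⟩
  · rw [hU, pRMmod_eq_span]

/-! ## Existence -/

theorem exists_list_map_eq {α β : Type*} (f : α → β) (L : List β) (h : ∀ y ∈ L, ∃ x, f x = y) :
    ∃ K : List α, K.map f = L := by
  have : L ∈ Set.range (List.map f) := by rw [Set.range_list_map]; exact h
  exact this

theorem exists_list_fin (n : ℕ) (L : List ℕ) (h : ∀ k ∈ L, k < n) :
    ∃ K : List (Fin n), K.map Fin.val = L :=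
  exists_list_map_eq _ _ fun k hk => ⟨⟨k, h k hk⟩, rfl⟩

/-- A bijection between two subsets of a finite set extends to a permutation, since the complements
have equal size. -/
theorem exists_perm_extending {n : ℕ} {ι : Type*} (s t : ι → ℕ) (hs : Function.Injective s)
    (ht : Function.Injective t) (hsn : ∀ i, s i < n) (htn : ∀ i, t i < n) :
    ∃ p : Equiv.Perm (Fin n), ∀ i, ∀ q : Fin n, (q : ℕ) = s i → (p q : ℕ) = t i := by
  classical
  let f : ι → Fin n := fun i => ⟨s i, hsn i⟩
  let g : ι → Fin n := fun i => ⟨t i, htn i⟩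
  have hf : Function.Injective f := fun i j e => hs (congrArg Fin.val e)
  have hg : Function.Injective g := fun i j e => ht (congrArg Fin.val e)
  let e : {x // x ∈ Set.range f} ≃ {x // x ∈ Set.range g} :=
    (Equiv.ofInjective f hf).symm.trans (Equiv.ofInjective g hg)
  refine ⟨e.extendSubtype, fun i q hq => ?_⟩
  obtain rfl : q = f i := Fin.ext hq
  rw [e.extendSubtype_apply_of_mem _ (Set.mem_range_self i)]
  have : e ⟨f i, Set.mem_range_self i⟩ = ⟨g i, Set.mem_range_self i⟩ := by
    change Equiv.ofInjective g hg ((Equiv.ofInjective f hf).symm ⟨f i, _⟩) = _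
    rw [Equiv.ofInjective_symm_apply hf]; rfl
  rw [this]

/-- A permutation that routes the rows `(π u, u)`, `u ∈ G₃`, and `(σ v, v)`, `v ∈ G₄`. -/
theorem exists_perm_routing {a b : ℕ} {π σ : Word b → Word a} {M : List (Word (a + b))}
    {M₁ : List (Word a)} {M₂ G₃ G₄ : List (Word b)}
    (h₃ : ∀ u ∈ G₃, Fin.append (π u) u ∈ M) (h₄ : ∀ v ∈ G₄, Fin.append (σ v) v ∈ M)
    (hM : M.length ≤ a + b) (h₁ : ∀ u ∈ G₃, π u ∈ M₁) (hM₁ : M₁.length ≤ a)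
    (h₂ : ∀ v ∈ G₄, v ∈ M₂) (hM₂ : M₂.length ≤ b) (hπ : Set.InjOn π {u | u ∈ G₃})
    (hne : ∀ u ∈ G₃, u ∈ G₄ → π u ≠ σ u) :
    ∃ p : Equiv.Perm (Fin (a + b)),
      (∀ u ∈ G₃, ∀ q : Fin (a + b),
        (q : ℕ) = M.idxOf (Fin.append (π u) u) → (p q : ℕ) = M₁.idxOf (π u)) ∧
      ∀ v ∈ G₄, ∀ q : Fin (a + b),
        (q : ℕ) = M.idxOf (Fin.append (σ v) v) → (p q : ℕ) = a + M₂.idxOf v := by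
  let s : {u // u ∈ G₃} ⊕ {v // v ∈ G₄} → ℕ :=
    Sum.elim (fun u => M.idxOf (Fin.append (π u) u.1)) fun v => M.idxOf (Fin.append (σ v) v.1)
  let t : {u // u ∈ G₃} ⊕ {v // v ∈ G₄} → ℕ :=
    Sum.elim (fun u => M₁.idxOf (π u)) fun v => a + M₂.idxOf v.1
  have hlt₁ : ∀ u ∈ G₃, M₁.idxOf (π u) < a := fun u hu =>
    (List.idxOf_lt_length_iff.2 (h₁ u hu)).trans_le hM₁
  refine (exists_perm_extending s t (n := a + b) ?_ ?_ ?_ ?_).imp fun p hp =>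
    ⟨fun u hu => hp (Sum.inl ⟨u, hu⟩), fun v hv => hp (Sum.inr ⟨v, hv⟩)⟩
  · rintro (⟨u, hu⟩ | ⟨v, hv⟩) (⟨u', hu'⟩ | ⟨v', hv'⟩) e
    · obtain rfl := (append_inj.1 ((List.idxOf_inj (h₃ u hu)).1 e)).2
      rfl
    · obtain ⟨e₁, rfl⟩ := append_inj.1 ((List.idxOf_inj (h₃ u hu)).1 e)
      exact absurd e₁ (hne u hu hv')
    · obtain ⟨e₁, rfl⟩ := append_inj.1 ((List.idxOf_inj (h₄ v hv)).1 e)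
      exact absurd e₁.symm (hne v hu' hv)
    · obtain rfl := (append_inj.1 ((List.idxOf_inj (h₄ v hv)).1 e)).2
      rfl
  · rintro (⟨u, hu⟩ | ⟨v, hv⟩) (⟨u', hu'⟩ | ⟨v', hv'⟩) e
    · obtain rfl := hπ hu hu' ((List.idxOf_inj (h₁ u hu)).1 e)
      rfl
    · have := hlt₁ u hu
      simp only [t, Sum.elim_inl, Sum.elim_inr] at e
      omega
    · have := hlt₁ u' hu'
      simp only [t, Sum.elim_inl, Sum.elim_inr] at e
      omega
    · simp only [t, Sum.elim_inr] at e
      obtain rfl := (List.idxOf_inj (h₂ v hv)).1 (Nat.add_left_cancel e)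
      rfl
  · rintro (⟨u, hu⟩ | ⟨v, hv⟩)
    · exact (List.idxOf_lt_length_iff.2 (h₃ u hu)).trans_le hM
    · exact (List.idxOf_lt_length_iff.2 (h₄ v hv)).trans_le hM
  · rintro (⟨u, hu⟩ | ⟨v, hv⟩)
    · exact (hlt₁ u hu).trans_le (Nat.le_add_right a b)
    · exact Nat.add_lt_add_left ((List.idxOf_lt_length_iff.2 (h₂ v hv)).trans_le hM₂) a

theorem exists_fanOut {a b : ℕ} {π : Word b → Word a} {M₁ : List (Word a)} {M₂ G₅ : List (Word b)}
    (h₁ : ∀ u ∈ G₅, π u ∈ M₁) (hM₁ : M₁.length ≤ a) (h₂ : ∀ u ∈ G₅, u ∈ M₂)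
    (hM₂ : M₂.length ≤ b) : ∃ X, FanOut π M₁ M₂ G₅ X := by
  refine exists_list_map_eq _ _ fun y hy => ?_
  obtain ⟨u, hu, rfl⟩ := List.mem_map.1 hy
  exact ⟨(⟨_, (List.idxOf_lt_length_iff.2 (h₁ u hu)).trans_le hM₁⟩,
    ⟨_, (List.idxOf_lt_length_iff.2 (h₂ u hu)).trans_le hM₂⟩), rfl⟩

theorem exists_stage {a b : ℕ} {π : Word b → Word a} {M : List (Word (a + b))}
    {M₁ : List (Word a)} {M₂ G₃ G₄ G₅ : List (Word b)}
    (h₃ : ∀ u ∈ G₃, Fin.append (π u) u ∈ M) (h₄ : ∀ v ∈ G₄, Fin.append 0 v ∈ M)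
    (hM : M.length ≤ a + b) (h₁ : ∀ u ∈ G₃, π u ∈ M₁) (hM₁ : M₁.length ≤ a)
    (h₂ : ∀ v ∈ G₄, v ∈ M₂) (hM₂ : M₂.length ≤ b) (hπ : Set.InjOn π {u | u ∈ G₃})
    (hne : ∀ u ∈ G₃, π u ≠ 0) (h₅ : ∀ u ∈ G₅, u ∈ G₃ ∧ u ∈ M₂) :
    ∃ p X, Routes π M M₁ M₂ G₃ G₄ p ∧ FanOut π M₁ M₂ G₅ X := by
  obtain ⟨p, hp⟩ := exists_perm_routing (σ := fun _ => 0) h₃ h₄ hM h₁ hM₁ h₂ hM₂ hπ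
    fun u hu _ => hne u hu
  obtain ⟨X, hX⟩ := exists_fanOut (fun u hu => h₁ u (h₅ u hu).1) hM₁ (fun u hu => (h₅ u hu).2) hM₂
  exact ⟨p, X, hp, hX⟩

theorem append_self_mem_G {r : ℤ} {m : ℕ} {u : Word (len m)} (h : u ∈ G r m) :
    Fin.append u u ∈ G r (m + 1) := by
  rw [G, List.mem_append, List.mem_map]; exact Or.inl ⟨u, h, rfl⟩

theorem append_zero_mem_G {r : ℤ} {m : ℕ} {v : Word (len m)} (h : v ∈ G (r - 1) m) :
    Fin.append 0 v ∈ G r (m + 1) := by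
  rw [G, List.mem_append, List.mem_map, List.mem_map]; exact Or.inr ⟨v, h, rfl⟩

theorem length_G_le (r : ℤ) (m : ℕ) : (G r m).length ≤ len m :=
  length_le_of_subset_fullRows (nodup_G r m) fun _ hg => (mem_G.1 hg).1

theorem ne_zero_of_mem_G {r : ℤ} {m : ℕ} {u : Word (len m)} (h : u ∈ G r m) : u ≠ 0 :=
  ne_zero_of_mem_fullRows (mem_G.1 h).1

theorem exists_recBasisQRM {r m : ℕ} (h : r ≤ m) : ∃ C M, RecBasisQRM r m C M := by
  induction m generalizing r with
  | zero => obtain rfl : r = 0 := by omega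
            exact ⟨_, _, .base⟩
  | succ m ih =>
    by_cases hr : r ≤ m
    · obtain ⟨C, M₁, hC⟩ := ih hr
      obtain rfl := hC.index_eq
      obtain ⟨p, X, hp, hX⟩ := exists_stage (π := id) (M := G r (m + 1)) (M₁ := G r m)
        (M₂ := G r m) (G₃ := G r m) (G₄ := G (r - 1) m) (G₅ := G r m)
        (fun u hu => append_self_mem_G hu) (fun v hv => append_zero_mem_G hv) (length_G_le _ _)
        (fun u hu => hu) (length_G_le _ _)
        (fun v hv => mem_G.2 ⟨(mem_G.1 hv).1, by have := (mem_G.1 hv).2; omega⟩)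
        (length_G_le _ _) (Set.injOn_id _) (fun u hu => ne_zero_of_mem_G hu) fun u hu => ⟨hu, hu⟩
      exact ⟨_, _, .step hr hC hp hX⟩
    · obtain rfl : r = m + 1 := by omega
      obtain ⟨C, M₁, hC⟩ := ih le_rfl
      obtain rfl := hC.index_eq
      obtain ⟨p, X, hp, hX⟩ := exists_stage (π := id) (M := G ((m + 1 : ℕ) : ℤ) (m + 1))
        (M₁ := G m m) (M₂ := G m m) (G₃ := G m m) (G₄ := G m m) (G₅ := G m m)
        (fun u hu => append_self_mem_G (u := u)
          (mem_G.2 ⟨(mem_G.1 hu).1, by have := (mem_G.1 hu).2; omega⟩))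
        (fun v hv => append_zero_mem_G (by push_cast; rwa [add_sub_cancel_right]))
        (length_G_le _ _) (fun u hu => hu) (length_G_le _ _) (fun v hv => hv)
        (length_G_le _ _) (Set.injOn_id _) (fun u hu => ne_zero_of_mem_G hu) fun u hu => ⟨hu, hu⟩
      exact ⟨_, _, .full hC hp hX⟩

theorem exists_band_step {lo hi : ℤ} {m : ℕ} {C : Circuit (len m)} {M₁ : List (Word (len m))}
    {B : Set (Word (len m))} (h : Encodes C M₁ {g | g ∈ band (lo - 1) hi m} B) :
    ∃ (M : List (Word (len m + len m))) (K : List (Fin (len m + len m)))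
      (p : Equiv.Perm (Fin (len m + len m))) (X : List (Fin (len m) × Fin (len m))),
      M = stack (band lo hi (m + 1)) (band (lo - 1) lo m) ∧
      K.map Fin.val = List.range' (band lo hi (m + 1)).length (band (lo - 1) lo m).length ∧
      Routes id M M₁ M₁ (band (lo - 1) hi m) (band (lo - 1) (hi - 1) m) p ∧
      FanOut id M₁ M₁ (band (lo - 1) hi m) X := by
  have hMF : ∀ g ∈ (stack (band lo hi (m + 1)) (band (lo - 1) lo m) : List (Word (len (m + 1)))),
      g ∈ fullRows (m + 1) := by
    intro g hg
    rcases mem_stack.1 hg with hg | ⟨u, hu, rfl⟩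
    · exact (mem_band.1 hg).1
    · exact append_self_mem_fullRows (mem_band.1 hu).1
  have hlen := length_le_of_subset_fullRows (m := m + 1) (nodup_stack (lo := lo) (hi := hi) m) hMF
  obtain ⟨K, hK⟩ := exists_list_fin (len m + len m)
    (List.range' (band lo hi (m + 1)).length (band (lo - 1) lo m).length) fun k hk => by
      have := (List.mem_range'_1.1 hk).2
      rw [List.length_append, dbl, List.length_map] at hlen
      exact this.trans_le hlen
  obtain ⟨p, X, hp, hX⟩ := exists_stage (π := id)
    (M := stack (band lo hi (m + 1)) (band (lo - 1) lo m)) (M₁ := M₁) (M₂ := M₁)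
    (G₃ := band (lo - 1) hi m) (G₄ := band (lo - 1) (hi - 1) m) (G₅ := band (lo - 1) hi m)
    (fun u hu => by
      have hu' := mem_band.1 hu
      by_cases hlo' : lo < rowDeg m u
      · exact mem_stack.2 (Or.inl (append_self_mem_band.2 (mem_band.2 ⟨hu'.1, hlo', hu'.2.2⟩)))
      · exact mem_stack.2 (Or.inr ⟨u, mem_band.2 ⟨hu'.1, hu'.2.1, by omega⟩, rfl⟩))
    (fun v hv => mem_stack.2 (Or.inl (append_zero_mem_band.2 hv))) hlen h.mem h.length_le
    (fun v hv => h.mem v (band_subset le_rfl (by omega) hv)) h.length_le (Set.injOn_id _)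
    (fun u hu => ne_zero_of_mem_fullRows (mem_band.1 hu).1) fun u hu => ⟨hu, h.mem u hu⟩
  exact ⟨_, K, p, X, rfl, hK, hp, hX⟩

theorem exists_recQRM {r m : ℕ} (hm : m ≤ 2 * r + 1) (h : r ≤ m) : ∃ C M, RecQRM r m C M := by
  induction m with
  | zero =>
    obtain rfl : r = 0 := by omega
    obtain ⟨C, M, hC⟩ := exists_recBasisQRM (le_refl 0)
    exact ⟨_, _, .full hC⟩
  | succ m ih =>
    by_cases hr : r ≤ m
    · obtain ⟨C, M₁, hC⟩ := ih (by omega) hr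
      obtain ⟨M, K, p, X, hM, hK, hp, hX⟩ := exists_band_step (lo := m - r) hC.encodes
      refine ⟨_, _, .step (M := M) (K := K) (p := p) (X := X) hr (by omega) hC
        (by simpa only [rowDiff_G] using hM) ?_ (by simpa only [rowDiff_G] using hp)
        (by simpa only [rowDiff_G] using hX)⟩
      rw [hK, length_band (a := m + 1 - r) (by omega), length_band_one (d := m - r) (by omega)
        (by omega)]
    · obtain rfl : r = m + 1 := by omega
      obtain ⟨C, M, hC⟩ := exists_recBasisQRM (le_refl (m + 1))
      exact ⟨_, _, .full hC⟩

theorem exists_recZQRM_full {r₀ m₀ : ℕ} (h : m₀ < 2 * r₀ + 1) (h' : r₀ ≤ m₀) :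
    ∃ C M, RecZQRM r₀ m₀ (2 * (r₀ : ℤ) - m₀) r₀ C M := by
  obtain ⟨C, M, hC⟩ := exists_recQRM (r := r₀) (m := r₀) (by omega) le_rfl
  obtain ⟨K, hK⟩ := exists_list_fin (len r₀)
    ((G (2 * (r₀ : ℤ) - m₀) r₀).map fun g => M.idxOf g) (fun k hk => by
    obtain ⟨g, hg, rfl⟩ := List.mem_map.1 hk
    have := mem_G.1 hg
    exact hC.encodes.idxOf_lt (mem_band.2 ⟨this.1, by omega, by omega⟩))
  exact ⟨_, _, .full h hC hK⟩

theorem exists_recZQRM {r₀ m₀ : ℕ} {r : ℤ} {m : ℕ} (h : ZRange r₀ m₀ r m) :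
    ∃ C M, RecZQRM r₀ m₀ r m C M := by
  induction m generalizing r with
  | zero =>
    obtain ⟨h₁, h₂, h₃, h₄⟩ := h
    by_cases hb : 2 * r₀ + 1 ≤ m₀
    · obtain rfl : r = -1 := by omega
      obtain ⟨C, M, hC⟩ := exists_recBasisQRM h₃
      exact ⟨C, M, .basis hb hC⟩
    · obtain rfl : r = 2 * (r₀ : ℤ) - m₀ := by omega
      obtain rfl : r₀ = 0 := by omega
      exact exists_recZQRM_full (by omega) (by omega)
  | succ m ih =>
    obtain ⟨h₁, h₂, h₃, h₄⟩ := h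
    by_cases hb : r = -1 ∧ 2 * r₀ + 1 ≤ m₀
    · obtain ⟨rfl, hb⟩ := hb
      obtain ⟨C, M, hC⟩ := exists_recBasisQRM h₃
      exact ⟨C, M, .basis hb hC⟩
    by_cases hf : m + 1 = r₀
    · obtain rfl : r = 2 * (r₀ : ℤ) - m₀ := by omega
      subst hf
      exact exists_recZQRM_full (by omega) (by omega)
    -- If `r = -1` and `m₀ ≤ 2 r₀`, then the relation between the parameters would put `m + 1` below
    -- `r₀`. Hence `r` is nonnegative outside the two initial cases.
    · obtain ⟨n, rfl⟩ := Int.eq_ofNat_of_zero_le (show 0 ≤ r by omega)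
      obtain ⟨C, M₁, hC⟩ := ih (r := (n : ℤ) - 1) ⟨by omega, by omega, by omega, by omega⟩
      obtain ⟨M, K, p, X, hM, hK, hp, hX⟩ := exists_band_step hC.encodes
      refine ⟨_, _, .step (M := M) (K := K) (p := p) (X := X) (by omega) (by omega) hC
        (by simpa only [rowDiff_G] using hM) ?_ (by simpa only [rowDiff_G] using hp)
        (by simpa only [rowDiff_G] using hX)⟩
      rw [hK, length_band (a := n + 1) (by omega), length_band_one (d := n) (by omega)
        (by omega)]

theorem PunctSafe.punct_ne_zero {m : ℕ} {S : Set (Word (len m))} (h : PunctSafe S)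
    {u : Word (len m)} (hu : u ∈ S) : punct m u ≠ 0 := fun e =>
  ne_zero_of_mem_fullRows (h.1 u hu) (h.injOn (Submodule.subset_span hu) (zero_mem _)
    (e.trans (map_zero _).symm))

theorem exists_punct_step {lo hi : ℤ} {m k : ℕ} {C₁ : Circuit (plen m)} {C₂ : Circuit (len m)}
    {M₁ : List (Word (plen m))} {M₂ : List (Word (len m))} {B₁ : Set (Word (plen m))}
    {B₂ : Set (Word (len m))}
    (h₁ : Encodes C₁ M₁ (punct m '' {g | g ∈ List.replicate k 1 ++ band (lo - 1) hi m}) B₁)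
    (h₂ : Encodes C₂ M₂ {g | g ∈ band (lo - 1) hi m} B₂)
    (hlo : lo ≤ hi) (hhi : hi < m) (hk : k ≤ 1) (hklo : k = 1 → 1 ≤ lo) :
    ∃ (M : List (Word (plen m + len m))) (K : List (Fin (plen m + len m)))
      (p : Equiv.Perm (Fin (plen m + len m))) (X : List (Fin (plen m) × Fin (len m))),
      M = stackP (List.replicate k 1 ++ band lo hi (m + 1)) (band (lo - 1) lo m) ∧
      K.map Fin.val = List.range' (k + (band lo hi (m + 1)).length) (band (lo - 1) lo m).length ∧
      Routes (punct m) M M₁ M₂ (List.replicate k 1 ++ band (lo - 1) hi m)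
        (band (lo - 1) (hi - 1) m) p ∧
      FanOut (punct m) M₁ M₂ (band (lo - 1) hi m) X := by
  obtain ⟨hNn, hNsafe⟩ := stack_ones hlo hhi hk hklo
  have hG₃ := punctSafe_ones_band hlo hhi hklo hk
  have hMN := stackP_eq_map (List.replicate k 1 ++ band lo hi (m + 1)) (band (lo - 1) lo m)
  have hlen := hNsafe.length_le hNn
  rw [← hMN] at hlen
  obtain ⟨K, hK⟩ := exists_list_fin (plen m + len m)
    (List.range' (k + (band lo hi (m + 1)).length) (band (lo - 1) lo m).length) fun j hj => by
      have := (List.mem_range'_1.1 hj).2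
      rw [hMN, List.length_map, List.length_append, List.length_append, List.length_replicate, dbl,
        List.length_map] at hlen
      exact this.trans_le hlen
  have hmem : ∀ g ∈ ((List.replicate k 1 ++ band lo hi (m + 1)) ++ dbl id (band (lo - 1) lo m) :
      List (Word (len m + len m))), punct (m + 1) g ∈
        stackP (List.replicate k 1 ++ band lo hi (m + 1)) (band (lo - 1) lo m) := fun g hg => by
    rw [hMN]; exact List.mem_map_of_mem hg
  obtain ⟨p, X, hp, hX⟩ := exists_stage (π := punct m)
    (M := stackP (List.replicate k 1 ++ band lo hi (m + 1)) (band (lo - 1) lo m)) (M₁ := M₁)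
    (M₂ := M₂) (G₃ := List.replicate k 1 ++ band (lo - 1) hi m) (G₄ := band (lo - 1) (hi - 1) m)
    (G₅ := band (lo - 1) hi m)
    (fun u hu => by
      rw [← punct_append]
      refine hmem _ ?_
      rcases List.mem_append.1 hu with hu | hu
      · obtain ⟨hk0, rfl⟩ := List.mem_replicate.1 hu
        rw [append_one_one]
        exact List.mem_append_left _ (List.mem_append_left _ (List.mem_replicate.2 ⟨hk0, rfl⟩))
      · have hu' := mem_band.1 hu
        by_cases hlo' : lo < rowDeg m u
        · exact List.mem_append_left _ (List.mem_append_right _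
            (append_self_mem_band.2 (mem_band.2 ⟨hu'.1, hlo', hu'.2.2⟩)))
        · exact List.mem_append_right _ (mem_dbl.2 ⟨u, mem_band.2 ⟨hu'.1, hu'.2.1, by omega⟩, rfl⟩))
    (fun v hv => by
      rw [← map_zero (punct m), ← punct_append]
      exact hmem _ (List.mem_append_left _ (List.mem_append_right _ (append_zero_mem_band.2 hv))))
    hlen (fun u hu => h₁.mem _ ⟨u, hu, rfl⟩) h₁.length_le
    (fun v hv => h₂.mem v (band_subset le_rfl (by omega) hv)) h₂.length_le
    (hG₃.injOn.mono Submodule.subset_span) (fun u hu => hG₃.punct_ne_zero hu)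
    fun u hu => ⟨List.mem_append_right _ hu, h₂.mem u hu⟩
  exact ⟨_, K, p, X, rfl, hK, hp, hX⟩

/-- The last qubit of the second part is left free by the other rows. -/
theorem exists_diag_step {r : ℕ} {c : Fin (len (r + 1))} (hc : (c : ℕ) + 1 = len (r + 1)) :
    ∃ (p : Equiv.Perm (Fin (plen (r + 1) + len (r + 1))))
      (X : List (Fin (plen (r + 1)) × Fin (len (r + 1)))),
      Routes (punct (r + 1)) ((G ((r + 1 : ℕ) : ℤ) (r + 2)).map (punct (r + 2)))
        ((G r (r + 1)).map (punct (r + 1))) (G r (r + 1)) (G r (r + 1)) (G r (r + 1)) p ∧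
      (∀ q : Fin (plen (r + 1) + len (r + 1)),
        (q : ℕ) = ((G ((r + 1 : ℕ) : ℤ) (r + 2)).map (punct (r + 2))).idxOf
          (Fin.append (punct (r + 1) (Pi.single c 1)) (Pi.single c 1)) →
        p q = Fin.natAdd (plen (r + 1)) c) ∧
      FanOut (punct (r + 1)) ((G r (r + 1)).map (punct (r + 1))) (G r (r + 1)) (G r (r + 1)) X := by
  have hs := punctSafe_G (r := (r : ℤ)) (m := r + 1) (by omega)
  have hs' := punctSafe_G (r := ((r + 1 : ℕ) : ℤ)) (m := r + 2) (by omega)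
  have hfull : fullRows (r + 1) = G r (r + 1) ++ [lastRow (r + 1)] := by
    rw [G_self_eq_concat]
    push_cast
    rw [add_sub_cancel_right]
  have hlast : lastRow (r + 1) ∉ G r (r + 1) := fun h => by
    have := (mem_G.1 h).2
    rw [rowDeg_lastRow] at this
    omega
  have hmem : ∀ g ∈ G ((r + 1 : ℕ) : ℤ) (r + 2), punct (r + 2) g ∈
      (G ((r + 1 : ℕ) : ℤ) (r + 2)).map (punct (r + 2)) := fun g hg => List.mem_map_of_mem hg
  have hsub : ∀ u ∈ G r (r + 1), u ∈ G ((r + 1 : ℕ) : ℤ) (r + 1) := fun u hu =>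
    mem_G.2 ⟨(mem_G.1 hu).1, by have := (mem_G.1 hu).2; omega⟩
  have hlen₁ := hs.length_le (nodup_G r (r + 1))
  -- The exceptional row `(e^*, e)` joins the rows `(0, v)`, all of the form `(σ v, v)`. In
  -- `fullRows` the row `e` has the last number, so it is routed to the last qubit of the second
  -- part.
  let σ : Word (len (r + 1)) → Word (plen (r + 1)) := fun v =>
    if v = lastRow (r + 1) then punct (r + 1) v else 0
  have hσ : ∀ v ∈ G r (r + 1), σ v = 0 := fun v hv =>
    if_neg fun e : v = lastRow (r + 1) => hlast (e ▸ hv)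
  obtain ⟨p, hp₁, hp₂⟩ := exists_perm_routing (π := punct (r + 1)) (σ := σ)
    (M := (G ((r + 1 : ℕ) : ℤ) (r + 2)).map (punct (r + 2)))
    (M₁ := (G r (r + 1)).map (punct (r + 1))) (M₂ := fullRows (r + 1)) (G₃ := G r (r + 1))
    (G₄ := fullRows (r + 1))
    (fun u hu => by
      rw [← punct_append]; exact hmem _ (append_self_mem_G (hsub u hu)))
    (fun v hv => by
      rw [hfull, List.mem_append, List.mem_singleton] at hv
      rcases hv with hv | rfl
      · rw [hσ v hv, ← map_zero (punct (r + 1)), ← punct_append]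
        exact hmem _ (append_zero_mem_G (by push_cast; rwa [add_sub_cancel_right]))
      · rw [show σ (lastRow (r + 1)) = punct (r + 1) (lastRow (r + 1)) from if_pos rfl,
          ← punct_append]
        refine hmem _ (append_self_mem_G (mem_G.2 ⟨lastRow_mem _, ?_⟩))
        rw [rowDeg_lastRow])
    (hs'.length_le (nodup_G _ _)) (fun u hu => List.mem_map_of_mem hu) hlen₁ (fun v hv => hv)
    (fullRows_length _).le (hs.injOn.mono Submodule.subset_span)
    (fun u hu _ => by rw [hσ u hu]; exact hs.punct_ne_zero hu)
  obtain ⟨X, hX⟩ := exists_fanOut (π := punct (r + 1)) (M₁ := (G r (r + 1)).map (punct (r + 1)))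
    (M₂ := G r (r + 1)) (G₅ := G r (r + 1)) (fun u hu => List.mem_map_of_mem hu) hlen₁
    (fun u hu => hu) (length_G_le _ _)
  refine ⟨p, X, ⟨hp₁, fun v hv q hq => ?_⟩, fun q hq => Fin.ext ?_, hX⟩
  · rw [hp₂ v (by rw [hfull]; exact List.mem_append_left _ hv) q (by rw [hσ v hv, hq]), hfull,
      List.idxOf_append_of_mem hv]
  · rw [single_last_eq hc] at hq
    rw [hp₂ _ (lastRow_mem _) q
      (by rw [show σ (lastRow (r + 1)) = punct (r + 1) (lastRow (r + 1)) from if_pos rfl, hq])]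
    have := fullRows_idxOf_lastRow (r + 1)
    rw [Fin.val_natAdd]
    omega

theorem RecPQRM.index_eq_of_diag {r : ℕ} {C : Circuit (plen (r + 1))}
    {M : List (Word (plen (r + 1)))} (h : RecPQRM r (r + 1) C M) :
    M = (G r (r + 1)).map (punct (r + 1)) :=
  (RecBasisPQRM.diag h).index_eq

theorem exists_recPQRM {r m : ℕ} (hm : m ≤ 2 * r + 1) (h : r < m) : ∃ C M, RecPQRM r m C M := by
  induction m generalizing r with
  | zero => omega
  | succ m ih =>
    by_cases hr : r < m
    · obtain ⟨C₁, M₁, hC₁⟩ := ih (by omega) hr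
      obtain ⟨C₂, M₂, hC₂⟩ := exists_recQRM (r := r) (m := m) (by omega) (by omega)
      obtain ⟨M, K, p, X, hM, hK, hp, hX⟩ := exists_punct_step (k := 1) (lo := m - r)
        (B₁ := _) (B₂ := _) hC₁.encodes hC₂.encodes (by omega) (by omega) le_rfl (by omega)
      refine ⟨_, _, .step (M := M) (K := K) (p := p) (X := X) hr (by omega) hC₁ hC₂
        (by simp only [rowDiff_G]; exact hM) ?_ (by simp only [rowDiff_G]; exact hp)
        (by simp only [rowDiff_G]; exact hX)⟩
      rw [hK, length_band (a := m + 1 - r) (by omega), length_band_one (d := m - r) (by omega)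
        (by omega)]
    · obtain rfl : r = m := by omega
      rcases r with _ | r
      · exact ⟨_, _, .base⟩
      · obtain ⟨C₁, M₁, hC₁⟩ := ih (r := r) (by omega) (by omega)
        obtain ⟨C₂, M₂, hC₂⟩ := exists_recBasisQRM (r := r) (m := r + 1) (by omega)
        obtain rfl := hC₁.index_eq_of_diag
        obtain rfl := hC₂.index_eq
        have h₁ := len_pos (r + 1)
        have h₂ : 0 < plen (r + 1) := by
          have := plen_succ (r + 1); have := len_pos r; rw [plen]; omega
        obtain ⟨p, X, hp, hpe, hX⟩ := exists_diag_step (r := r) (c := ⟨len (r + 1) - 1, by omega⟩)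
          (by simp only; omega)
        exact ⟨_, _, .diag (t := ⟨plen (r + 1) - 1, by omega⟩) hC₁ hC₂ rfl hp
          (by simp only; omega) (by simp only; omega) rfl hpe hX⟩

theorem exists_recBasisPQRM {r m : ℕ} (h : r < m) : ∃ C M, RecBasisPQRM r m C M := by
  induction m with
  | zero => omega
  | succ m ih =>
    by_cases hr : r < m
    · obtain ⟨C₁, M₁, hC₁⟩ := ih hr
      obtain ⟨C₂, M₂, hC₂⟩ := exists_recBasisQRM (r := r) (m := m) (by omega)
      obtain rfl := hC₁.index_eq
      obtain rfl := hC₂.index_eq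
      have hs := punctSafe_G (r := (r : ℤ)) (m := m) (by omega)
      have hs' := punctSafe_G (r := (r : ℤ)) (m := m + 1) (by omega)
      obtain ⟨p, X, hp, hX⟩ := exists_stage (π := punct m)
        (M := (G r (m + 1)).map (punct (m + 1))) (M₁ := (G r m).map (punct m)) (M₂ := G r m)
        (G₃ := G r m) (G₄ := G (r - 1) m) (G₅ := G r m)
        (fun u hu => by
          rw [← punct_append]; exact List.mem_map_of_mem (append_self_mem_G hu))
        (fun v hv => by
          rw [← map_zero (punct m), ← punct_append]
          exact List.mem_map_of_mem (append_zero_mem_G hv))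
        (hs'.length_le (nodup_G _ _)) (fun u hu => List.mem_map_of_mem hu)
        (hs.length_le (nodup_G _ _))
        (fun v hv => mem_G.2 ⟨(mem_G.1 hv).1, by have := (mem_G.1 hv).2; omega⟩)
        (length_G_le _ _) (hs.injOn.mono Submodule.subset_span)
        (fun u hu => hs.punct_ne_zero hu) fun u hu => ⟨hu, hu⟩
      exact ⟨_, _, .step hr hC₁ hC₂ rfl hp hX⟩
    · obtain rfl : r = m := by omega
      obtain ⟨C, M, hC⟩ := exists_recPQRM (r := r) (m := r + 1) (by omega) (by omega)
      exact ⟨_, _, .diag hC⟩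

theorem punctSafe_band_zero (hi : ℤ) (m : ℕ) : PunctSafe {g | g ∈ band 0 hi m} :=
  ⟨fun _ hg => (mem_band.1 hg).1, Or.inr fun h => by have := (one_mem_band.1 h).1; omega⟩

theorem exists_prep_step {r : ℕ} {hi : ℤ} (h : (r : ℤ) ≤ hi) {C₁ : Circuit (plen r)}
    {C₂ : Circuit (len r)} {M₁ : List (Word (plen r))} {M₂ : List (Word (len r))}
    (hC₁ : RecStatePrepPQRM r r C₁ M₁) (hC₂ : RecQRM r r C₂ M₂) :
    ∃ (p : Equiv.Perm (Fin (plen r + len r))) (X : List (Fin (plen r) × Fin (len r))),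
      Routes (punct r) ((band 0 hi (r + 1)).map (punct (r + 1))) M₁ M₂ (band 0 r r)
        (G (hi - 1) r) p ∧
      FanOut (punct r) M₁ M₂ (band 0 r r) X := by
  have h₁ := hC₁.encodes
  rw [max_eq_right (by omega)] at h₁
  have h₂ := hC₂.encodes
  have hmem : ∀ g ∈ fullRows r, g ∈ M₂ := fun g hg =>
    h₂.mem g (mem_band.2 ⟨hg, by omega, by have := rowDeg_le hg; omega⟩)
  have hs := punctSafe_band_zero r r
  exact exists_stage (π := punct r)
    (fun u hu => by
      rw [← punct_append]
      exact List.mem_map_of_mem (append_self_mem_band.2 (band_subset le_rfl h hu)))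
    (fun v hv => by
      rw [← map_zero (punct r), ← punct_append]
      refine List.mem_map_of_mem (append_zero_mem_band.2 ?_)
      rwa [← G_eq_band (by norm_num)])
    ((punctSafe_band_zero hi (r + 1)).length_le (nodup_band _ _ _))
    (fun u hu => h₁.mem _ ⟨u, hu, rfl⟩)
    h₁.length_le (fun v hv => hmem v (mem_G.1 hv).1) h₂.length_le
    (hs.injOn.mono Submodule.subset_span) (fun u hu => hs.punct_ne_zero hu)
    fun u hu => ⟨hu, hmem u (mem_band.1 hu).1⟩

theorem exists_recStatePrepPQRM {r m : ℕ} (hm : m ≤ 2 * r + 1) (h : r ≤ m) :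
    ∃ C M, RecStatePrepPQRM r m C M := by
  induction m generalizing r with
  | zero =>
    obtain rfl : r = 0 := by omega
    exact ⟨_, _, .base⟩
  | succ m ih =>
    by_cases hr : r < m
    · obtain ⟨C₁, M₁, hC₁⟩ := ih (r := r) (by omega) (by omega)
      obtain ⟨C₂, M₂, hC₂⟩ := exists_recQRM (r := r) (m := m) (by omega) (by omega)
      have h₁ := hC₁.encodes
      rw [max_eq_left (by omega)] at h₁
      obtain ⟨M, K, p, X, hM, hK, hp, hX⟩ := exists_punct_step (k := 0) (lo := m - r)
        h₁ hC₂.encodes (by omega) (by omega) (by omega) (by omega)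
      refine ⟨_, _, .step (M := M) (K := K) (p := p) (X := X) hr (by omega) hC₁ hC₂
        (by simp only [rowDiff_G]; exact hM) ?_ (by simp only [rowDiff_G]; exact hp)
        (by simp only [rowDiff_G]; exact hX)⟩
      rw [hK, length_band (a := m + 1 - r) (by omega), length_band_one (d := m - r) (by omega)
        (by omega), zero_add]
    · obtain ⟨C₁, M₁, hC₁⟩ := ih (r := m) (by omega) le_rfl
      obtain ⟨C₂, M₂, hC₂⟩ := exists_recQRM (r := m) (m := m) (by omega) le_rfl
      by_cases hr' : r = m
      · subst hr'
        obtain ⟨p, X, hp, hX⟩ := exists_prep_step (hi := r) le_rfl hC₁ hC₂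
        rw [← rowDiff_G_one, ← rowDiff_G_one] at hp
        rw [← rowDiff_G_one] at hX
        exact ⟨_, _, .diag hC₁ hC₂ rfl hp hX⟩
      · obtain rfl : r = m + 1 := by omega
        obtain ⟨p, X, hp, hX⟩ := exists_prep_step (hi := ((m + 1 : ℕ) : ℤ)) (by omega) hC₁ hC₂
        rw [← rowDiff_G_one, ← rowDiff_G_one,
          show ((m + 1 : ℕ) : ℤ) - 1 = m by push_cast; ring] at hp
        rw [← rowDiff_G_one] at hX
        exact ⟨_, _, .full hC₁ hC₂ rfl hp hX⟩

theorem exists_recPZQRM_full {r₀ m₀ : ℕ} (h : m₀ < 2 * r₀ + 1) (h' : r₀ + 1 ≤ m₀) :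
    ∃ C M, RecPZQRM r₀ m₀ (2 * r₀ + 1 - m₀) (r₀ + 1) C M := by
  obtain ⟨C, M, hC⟩ := exists_recPQRM (r := r₀) (m := r₀ + 1) (by omega) (by omega)
  have hE := hC.encodes
  rw [show ((r₀ + 1 : ℕ) : ℤ) - r₀ - 1 = 0 by push_cast; ring] at hE
  obtain ⟨K, hK⟩ := exists_list_fin (plen (r₀ + 1))
    ((rowDiff (G ((2 * r₀ + 1 - m₀ : ℕ) : ℤ) (r₀ + 1)) [1]).map
      fun g => M.idxOf (punct (r₀ + 1) g)) (fun k hk => by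
    obtain ⟨g, hg, rfl⟩ := List.mem_map.1 hk
    rw [rowDiff_G_one] at hg
    exact hE.idxOf_lt ⟨g, List.mem_cons_of_mem _ (band_subset le_rfl (by omega) hg), rfl⟩)
  exact ⟨_, _, .full h hC hK⟩

theorem exists_recPZQRM {r₀ m₀ r m : ℕ} (h : PZRange r₀ m₀ r m) :
    ∃ C M, RecPZQRM r₀ m₀ r m C M := by
  induction m generalizing r with
  | zero => obtain ⟨h₁, h₂, h₃⟩ := h; omega
  | succ m ih =>
    obtain ⟨h₁, h₂, h₃⟩ := h
    by_cases hb : r = 0 ∧ 2 * r₀ + 1 ≤ m₀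
    · obtain ⟨rfl, hb⟩ := hb
      obtain ⟨C, M, hC⟩ := exists_recBasisPQRM (r := r₀) (m := m + 1) (by omega)
      exact ⟨C, M, .basis hb hC⟩
    by_cases hf : m = r₀
    · obtain rfl : r = 2 * r₀ + 1 - m₀ := by omega
      subst hf
      exact exists_recPZQRM_full (by omega) (by omega)
    · obtain ⟨r, rfl⟩ : ∃ n, r = n + 1 := ⟨r - 1, by omega⟩
      obtain ⟨C₁, M₁, hC₁⟩ := ih (r := r) ⟨by omega, by omega, by omega⟩
      obtain ⟨C₂, M₂, hC₂⟩ := exists_recZQRM (r₀ := r₀) (m₀ := m₀) (r := r) (m := m)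
        ⟨by omega, by omega, by omega, by omega⟩
      have e : ((r + 1 : ℕ) : ℤ) - 1 = r := by push_cast; ring
      have hE₁ := hC₁.encodes (by omega)
      have hE₂ := hC₂.encodes
      rw [← e] at hE₁ hE₂
      obtain ⟨M, K, p, X, hM, hK, hp, hX⟩ := exists_punct_step (k := 1)
        (lo := ((r + 1 : ℕ) : ℤ)) hE₁ hE₂ (by omega) (by omega) le_rfl (by omega)
      simp only [e] at hM hK hp hX
      refine ⟨_, _, .step (M := M) (K := K) (p := p) (X := X) (by omega) (by omega) hC₁ hC₂
        (by simp only [rowDiff_G]; exact hM) ?_ (by simp only [rowDiff_G]; exact hp)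
        (by simp only [rowDiff_G]; exact hX)⟩
      rw [hK, length_band (a := r + 2) (by push_cast; omega),
        length_band_one (d := r + 1) (by omega) (by omega)]

/-! ## CNOT counts -/

theorem FanOut.length_eq {a b : ℕ} {π : Word b → Word a} {M₁ : List (Word a)}
    {M₂ G₅ : List (Word b)} {X : List (Fin a × Fin b)} (h : FanOut π M₁ M₂ G₅ X) :
    X.length = G₅.length := by
  have := congrArg List.length h
  rwa [List.length_map, List.length_map] at this

theorem cnotCount_append {n : ℕ} (C C' : Circuit n) :
    Circuit.cnotCount (C ++ C') = C.cnotCount + C'.cnotCount := List.countP_append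

theorem cnotCount_left {a : ℕ} (b : ℕ) (C : Circuit a) :
    (Circuit.left b C).cnotCount = C.cnotCount := by
  rw [Circuit.cnotCount, Circuit.left, List.countP_map]
  exact List.countP_congr fun g _ => by cases g <;> rfl

theorem cnotCount_right (a : ℕ) {b : ℕ} (C : Circuit b) :
    (Circuit.right a C).cnotCount = C.cnotCount := by
  rw [Circuit.cnotCount, Circuit.right, List.countP_map]
  exact List.countP_congr fun g _ => by cases g <;> rfl

theorem cnotCount_map_h {n : ℕ} (K : List (Fin n)) :
    Circuit.cnotCount (K.map Gate.h) = 0 := by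
  rw [Circuit.cnotCount, List.countP_map, List.countP_eq_zero]
  intro i _ h
  exact Bool.noConfusion h

theorem cnotCount_stage {a b : ℕ} (K : List (Fin (a + b))) (p : Equiv.Perm (Fin (a + b)))
    (X : List (Fin a × Fin b)) : (stage K p X).cnotCount = X.length := by
  rw [stage, cnotCount_append, cnotCount_map_h, zero_add]
  change List.countP _ _ = _
  rw [List.countP_cons_of_neg (by simp [Gate.isCnot]), List.countP_map, List.countP_eq_length]
  intro e _
  rfl

theorem cnotCount_stage_par {a b : ℕ} (K : List (Fin (a + b))) (p : Equiv.Perm (Fin (a + b)))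
    (X : List (Fin a × Fin b)) (C₁ : Circuit a) (C₂ : Circuit b) :
    Circuit.cnotCount (stage K p X ++ par C₁ C₂) = X.length + C₁.cnotCount + C₂.cnotCount := by
  rw [cnotCount_append, par, cnotCount_append, cnotCount_left, cnotCount_right, cnotCount_stage,
    add_assoc]

theorem length_G (r m : ℕ) : (G r m).length = ∑ i ∈ Finset.Icc 0 r, m.choose i := by
  rw [G_eq_band (show (-1 : ℤ) < 0 by norm_num), length_band (a := 0) (by norm_num)]

theorem length_G_self (m : ℕ) : (G m m).length = 2 ^ m := by
  rw [← fullRows_eq_G le_rfl, fullRows_length, len_eq]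

theorem length_band_self (m : ℕ) : (band 0 m m).length = 2 ^ m - 1 := by
  have := length_G_self m
  rw [G_eq_one_cons (by omega), List.length_cons] at this
  omega

/-- Only `0…01` is missing from the list. On the diagonal the CNOT array thus has one gate less than
a power of two, and the additional CNOT completes the number. -/
theorem length_G_diag (r : ℕ) : (G r (r + 1)).length + 1 = 2 ^ (r + 1) := by
  have h := G_self_eq_concat (r + 1)
  rw [Nat.cast_succ, add_sub_cancel_right] at h
  have h' := congrArg List.length h
  rw [fullRows_length, List.length_append, List.length_singleton] at h'
  rw [← len_eq]
  exact h'.symm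

/-- The CNOT count of `U^c(r, m)`. -/
def basisCount : ℕ → ℕ → ℕ
  | _, 0 => 0
  | r, m + 1 => if r ≤ m then (G r m).length + 2 * basisCount r m
      else 2 ^ m + 2 * basisCount m m

/-- The circuits depend on the choice of permutations, but their counts do not. Therefore the
recurrences hold between circuits that are chosen independently of one another. -/
theorem RecBasisQRM.cnotCount {r m : ℕ} {C : Circuit (len m)} {M : List (Word (len m))}
    (h : RecBasisQRM r m C M) : C.cnotCount = basisCount r m := by
  induction h with
  | base => rfl
  | step hr hC hp hX ih =>
    rw [cnotCount_stage_par, ih, hX.length_eq, basisCount, if_pos hr, two_mul, add_assoc]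
  | full hC hp hX ih =>
    rw [cnotCount_stage_par, ih, hX.length_eq, length_G_self, basisCount, if_neg (by omega),
      two_mul, add_assoc]

theorem basisCount_self (m : ℕ) : basisCount m m = m * 2 ^ (m - 1) := by
  induction m with
  | zero => rfl
  | succ m ih =>
    rw [basisCount, if_neg (by omega), ih]
    rcases m with _ | m
    · rfl
    · simp only [Nat.add_sub_cancel]
      rw [pow_succ]; ring

/-- The CNOT count of `U(r, m)`. -/
def qrmCount : ℕ → ℕ → ℕ
  | _, 0 => 0
  | r, m + 1 => if r ≤ m then (band ((m : ℤ) - r - 1) r m).length + 2 * qrmCount r m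
      else basisCount (m + 1) (m + 1)

theorem qrmCount_self (m : ℕ) : qrmCount m m = basisCount m m := by
  rcases m with _ | m
  · rfl
  · rw [qrmCount, if_neg (by omega)]

theorem RecQRM.cnotCount {r m : ℕ} {C : Circuit (len m)} {M : List (Word (len m))}
    (h : RecQRM r m C M) : C.cnotCount = qrmCount r m := by
  induction h with
  | full hC => rw [hC.cnotCount, qrmCount_self]
  | step hr hmr hC hM hK hp hX ih =>
    rw [cnotCount_stage_par, ih, hX.length_eq, rowDiff_G, qrmCount, if_pos hr, two_mul, add_assoc]

/-- The CNOT count of `U^*(r, m)`. -/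
def puncturedCount : ℕ → ℕ → ℕ
  | _, 0 => 0
  | _, 1 => 0
  | r, m + 2 => if r < m + 1 then
      (band (((m + 1 : ℕ) : ℤ) - r - 1) r (m + 1)).length + puncturedCount r (m + 1) +
        qrmCount r (m + 1)
      else 2 ^ (m + 1) + puncturedCount m (m + 1) + basisCount m (m + 1)

theorem puncturedCount_succ {r m : ℕ} (h : r < m) : puncturedCount r (m + 1) =
    (band ((m : ℤ) - r - 1) r m).length + puncturedCount r m + qrmCount r m := by
  rcases m with _ | m
  · omega
  · rw [puncturedCount, if_pos h]

theorem RecPQRM.cnotCount {r m : ℕ} {C : Circuit (plen m)} {M : List (Word (plen m))}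
    (h : RecPQRM r m C M) : C.cnotCount = puncturedCount r m := by
  induction h with
  | base => rfl
  | @diag r C₁ C₂ M₁ M₂ M p X e c t hC₁ hC₂ hM hp hc ht he hpe hX ih =>
    rw [cnotCount_append, cnotCount_append, cnotCount_stage, cnotCount_left, ih, hX.length_eq,
      puncturedCount, if_neg (by omega), ← length_G_diag]
    change _ + List.countP _ _ = _
    rw [List.countP_cons_of_pos (by rfl)]
    change _ + (Circuit.cnotCount (Circuit.right _ C₂) + 1) = _
    rw [cnotCount_right, hC₂.cnotCount]
    ring
  | step hr hmr hC₁ hC₂ hM hK hp hX ih =>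
    rw [cnotCount_stage_par, ih, hC₂.cnotCount, hX.length_eq, rowDiff_G, puncturedCount_succ hr]

/-- The CNOT count of `U^{(*,c)}(r, m)`. -/
def basisPuncturedCount : ℕ → ℕ → ℕ
  | _, 0 => 0
  | r, m + 1 => if r < m then (G r m).length + basisPuncturedCount r m + basisCount r m
      else puncturedCount r (m + 1)

theorem RecBasisPQRM.cnotCount {r m : ℕ} {C : Circuit (plen m)} {M : List (Word (plen m))}
    (h : RecBasisPQRM r m C M) : C.cnotCount = basisPuncturedCount r m := by
  induction h with
  | diag hC => rw [hC.cnotCount, basisPuncturedCount, if_neg (by omega)]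
  | step hr hC₁ hC₂ hM hp hX ih =>
    rw [cnotCount_stage_par, ih, hC₂.cnotCount, hX.length_eq, basisPuncturedCount, if_pos hr]

/-- The CNOT count of `U^{(*,s)}(r, m)`. -/
def prepCount : ℕ → ℕ → ℕ
  | _, 0 => 0
  | r, m + 1 => if r < m then
      (band ((m : ℤ) - r - 1) r m).length + prepCount r m + qrmCount r m
      else 2 ^ m - 1 + prepCount m m + qrmCount m m

theorem RecStatePrepPQRM.cnotCount {r m : ℕ} {C : Circuit (plen m)} {M : List (Word (plen m))}
    (h : RecStatePrepPQRM r m C M) : C.cnotCount = prepCount r m := by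
  induction h with
  | base => rfl
  | full hC₁ hC₂ hM hp hX ih =>
    rw [cnotCount_stage_par, ih, hC₂.cnotCount, hX.length_eq, rowDiff_G_one, length_band_self,
      prepCount, if_neg (by omega)]
  | diag hC₁ hC₂ hM hp hX ih =>
    rw [cnotCount_stage_par, ih, hC₂.cnotCount, hX.length_eq, rowDiff_G_one, length_band_self,
      prepCount, if_neg (by omega)]
  | step hr hmr hC₁ hC₂ hM hK hp hX ih =>
    rw [cnotCount_stage_par, ih, hC₂.cnotCount, hX.length_eq, rowDiff_G, prepCount, if_pos hr]

/-- The CNOT count of `U^{(0)}(r, m; r₀, m₀)`. -/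
def zeroCount (r₀ : ℕ) : ℤ → ℕ → ℕ
  | _, 0 => 0
  | r, m + 1 => if m + 1 = r₀ then basisCount r₀ r₀ else
      if r = -1 then basisCount r₀ (m + 1) else
        (band (r - 1) r₀ m).length + 2 * zeroCount r₀ (r - 1) m

theorem zeroCount_self (r₀ : ℕ) (r : ℤ) : zeroCount r₀ r r₀ = basisCount r₀ r₀ := by
  rcases r₀ with _ | r₀
  · rfl
  · rw [zeroCount, if_pos rfl]

/-- The clauses for `m = r₀` and `r = -1` may both apply; in that case they agree. -/
theorem zeroCount_neg_one (r₀ m : ℕ) : zeroCount r₀ (-1) m = basisCount r₀ m := by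
  rcases m with _ | m
  · rfl
  · rw [zeroCount, if_pos (rfl : (-1 : ℤ) = -1)]
    split_ifs with h
    · rw [h]
    · rfl

theorem zeroCount_succ {r₀ m : ℕ} (r : ℕ) (h : r₀ ≤ m) : zeroCount r₀ r (m + 1) =
    (band ((r : ℤ) - 1) r₀ m).length + 2 * zeroCount r₀ ((r : ℤ) - 1) m := by
  rw [zeroCount, if_neg (by omega), if_neg (by omega)]

theorem RecZQRM.cnotCount {r₀ m₀ : ℕ} {r : ℤ} {m : ℕ} {C : Circuit (len m)}
    {M : List (Word (len m))} (h : RecZQRM r₀ m₀ r m C M) : C.cnotCount = zeroCount r₀ r m := by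
  induction h with
  | basis h hC => rw [hC.cnotCount, zeroCount_neg_one]
  | full h hC hK =>
    rw [cnotCount_append, cnotCount_map_h, zero_add, hC.cnotCount, zeroCount_self, qrmCount_self]
  | step hr hm hC hM hK hp hX ih =>
    rw [cnotCount_stage_par, ih, hX.length_eq, rowDiff_G, zeroCount_succ _ hm, two_mul, add_assoc]

/-- The CNOT count of `U^{(*,0)}(r, m; r₀, m₀)`. -/
def zeroPuncturedCount (r₀ : ℕ) : ℕ → ℕ → ℕ
  | _, 0 => 0
  | r, m + 1 => if m = r₀ then puncturedCount r₀ (m + 1) else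
      if r = 0 then basisPuncturedCount r₀ (m + 1) else
        (band ((r : ℤ) - 1) r₀ m).length + zeroPuncturedCount r₀ (r - 1) m +
          zeroCount r₀ ((r : ℤ) - 1) m

theorem zeroPuncturedCount_diag (r₀ r : ℕ) :
    zeroPuncturedCount r₀ r (r₀ + 1) = puncturedCount r₀ (r₀ + 1) := by
  rw [zeroPuncturedCount, if_pos rfl]

theorem zeroPuncturedCount_zero (r₀ m : ℕ) :
    zeroPuncturedCount r₀ 0 m = basisPuncturedCount r₀ m := by
  rcases m with _ | m
  · rfl
  · rw [zeroPuncturedCount, if_pos (rfl : 0 = 0)]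
    split_ifs with h
    · rw [h, basisPuncturedCount, if_neg (lt_irrefl _)]
    · rfl

theorem zeroPuncturedCount_succ {r₀ m : ℕ} (r : ℕ) (h : r₀ + 1 ≤ m) :
    zeroPuncturedCount r₀ (r + 1) (m + 1) =
      (band r r₀ m).length + zeroPuncturedCount r₀ r m + zeroCount r₀ r m := by
  rw [zeroPuncturedCount, if_neg (by omega), if_neg (by omega), Nat.cast_succ,
    add_sub_cancel_right, Nat.add_sub_cancel]

theorem RecPZQRM.cnotCount {r₀ m₀ r m : ℕ} {C : Circuit (plen m)} {M : List (Word (plen m))}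
    (h : RecPZQRM r₀ m₀ r m C M) : C.cnotCount = zeroPuncturedCount r₀ r m := by
  induction h with
  | basis h hC => rw [hC.cnotCount, zeroPuncturedCount_zero]
  | full h hC hK =>
    rw [cnotCount_append, cnotCount_map_h, zero_add, hC.cnotCount, zeroPuncturedCount_diag]
  | step hr hm hC₁ hC₂ hM hK hp hX ih =>
    rw [cnotCount_stage_par, ih, hC₂.cnotCount, hX.length_eq, rowDiff_G,
      zeroPuncturedCount_succ _ hm]

/-! ## The structure of the recursive step -/

theorem nodup_of_map_val {n : ℕ} {K : List (Fin n)} (h : (K.map Fin.val).Nodup) : K.Nodup :=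
  h.of_map _

/-- Distinct rows have distinct controls. Together with the same fact for the targets, which lie in
the other part, the gates act on disjoint pairs and form a single layer. -/
theorem FanOut.nodup_fst {a b : ℕ} {π : Word b → Word a} {M₁ : List (Word a)}
    {M₂ G₅ : List (Word b)} {X : List (Fin a × Fin b)} (h : FanOut π M₁ M₂ G₅ X)
    (hG : G₅.Nodup) (hπ : Set.InjOn π {u | u ∈ G₅}) (h₁ : ∀ u ∈ G₅, π u ∈ M₁) :
    (X.map Prod.fst).Nodup := by
  have h' := congrArg (List.map Prod.fst) h
  rw [List.map_map, List.map_map] at h'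
  refine nodup_of_map_val ?_
  rw [List.map_map]
  refine (congrArg List.Nodup h').mpr (List.Nodup.map_on ?_ hG)
  exact fun u hu v hv e => hπ hu hv ((List.idxOf_inj (h₁ u hu)).1 e)

theorem FanOut.nodup_snd {a b : ℕ} {π : Word b → Word a} {M₁ : List (Word a)}
    {M₂ G₅ : List (Word b)} {X : List (Fin a × Fin b)} (h : FanOut π M₁ M₂ G₅ X)
    (hG : G₅.Nodup) (h₂ : ∀ u ∈ G₅, u ∈ M₂) : (X.map Prod.snd).Nodup := by
  have h' := congrArg (List.map Prod.snd) h
  rw [List.map_map, List.map_map] at h'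
  refine nodup_of_map_val ?_
  rw [List.map_map]
  refine (congrArg List.Nodup h').mpr (List.Nodup.map_on ?_ hG)
  exact fun u hu v hv e => (List.idxOf_inj (h₂ u hu)).1 e

theorem RecQRM.exists_step {r m : ℕ} {C : Circuit (len (m + 1))} {M : List (Word (len (m + 1)))}
    (hr : r ≤ m) (h : RecQRM r (m + 1) C M) :
    ∃ (K : List (Fin (len m + len m))) (p : Equiv.Perm (Fin (len m + len m)))
      (X : List (Fin (len m) × Fin (len m))) (C' : Circuit (len m)) (M' : List (Word (len m))),
      RecQRM r m C' M' ∧ C = stage K p X ++ par C' C' ∧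
      K.Nodup ∧ K.length = m.choose (m - r) ∧
      (X.map Prod.fst).Nodup ∧ (X.map Prod.snd).Nodup ∧
      X.length = ∑ i ∈ Finset.Icc (m - r) r, m.choose i := by
  cases h with
  | full hC => omega
  | @step _ C' M₁ _ K p X _ hmr hC' hM hK hp hX =>
    rw [rowDiff_G] at hX
    have hmem := hC'.encodes.mem
    refine ⟨K, p, X, C', M₁, hC', rfl, nodup_of_map_val ?_, ?_,
      hX.nodup_fst (nodup_band _ _ _) (Set.injOn_id _) hmem, hX.nodup_snd (nodup_band _ _ _) hmem,
      ?_⟩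
    · rw [hK]; exact List.nodup_range'
    · have := congrArg List.length hK
      rwa [List.length_map, List.length_range'] at this
    · rw [hX.length_eq, length_band (a := m - r) (by omega)]

/-! ## Depth -/

/-- The times at which the qubits are last used, after a circuit that starts at the times `l`. -/
def Circuit.run {n : ℕ} (C : Circuit n) (l : Fin n → ℕ) : Fin n → ℕ :=
  C.foldl (fun l g => g.tick l) l

theorem Circuit.run_append {n : ℕ} (C C' : Circuit n) (l : Fin n → ℕ) :
    Circuit.run (C ++ C') l = C'.run (C.run l) := List.foldl_append

theorem Circuit.run_le_depth {n : ℕ} (C : Circuit n) (i : Fin n) : C.run 0 i ≤ C.depth :=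
  Finset.le_sup (f := C.run 0) (Finset.mem_univ i)

theorem Circuit.depth_le_iff {n : ℕ} {C : Circuit n} {k : ℕ} :
    C.depth ≤ k ↔ ∀ i, C.run 0 i ≤ k :=
  ⟨fun h i => (C.run_le_depth i).trans h, fun h => Finset.sup_le fun i _ => h i⟩

theorem Gate.tick_mono {n : ℕ} (g : Gate n) {l l' : Fin n → ℕ} (h : l ≤ l') :
    g.tick l ≤ g.tick l' := by
  cases g with
  | h i => exact update_le_update_iff.2 ⟨Nat.succ_le_succ (h i), fun j _ => h j⟩
  | cnot i j hij =>
    have := Nat.succ_le_succ (max_le_max (h i) (h j))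
    exact update_le_update_iff.2 ⟨this, fun k _ => update_le_update_iff.2 ⟨this, fun k _ => h k⟩ k⟩
  | perm p => exact fun i => h _

theorem Gate.tick_add {n : ℕ} (g : Gate n) (l : Fin n → ℕ) (k : ℕ) :
    g.tick (fun i => l i + k) = fun i => g.tick l i + k := by
  cases g with
  | h i =>
    ext j
    simp only [Gate.tick, Function.update_apply]
    split_ifs <;> omega
  | cnot i j hij =>
    ext k
    simp only [Gate.tick, Function.update_apply]
    split_ifs <;> omega
  | perm p => rfl

theorem Circuit.run_mono {n : ℕ} (C : Circuit n) {l l' : Fin n → ℕ} (h : l ≤ l') :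
    C.run l ≤ C.run l' := by
  induction C generalizing l l' with
  | nil => exact h
  | cons g C ih => exact ih (g.tick_mono h)

theorem Circuit.run_add {n : ℕ} (C : Circuit n) (l : Fin n → ℕ) (k : ℕ) :
    C.run (fun i => l i + k) = fun i => C.run l i + k := by
  induction C generalizing l with
  | nil => rfl
  | cons g C ih =>
    change Circuit.run C (g.tick _) = fun i => Circuit.run C (g.tick l) i + k
    rw [g.tick_add, ih]

/-- Delaying every qubit to the common time `C.depth` can only postpone later gates
(`Circuit.run_mono`), and a common delay is simply added to the final times (`Circuit.run_add`). -/
theorem Circuit.depth_append_le {n : ℕ} (C C' : Circuit n) :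
    Circuit.depth (C ++ C') ≤ C.depth + C'.depth := by
  refine Circuit.depth_le_iff.2 fun i => ?_
  rw [Circuit.run_append]
  have h : C.run 0 ≤ fun i => (0 : Fin n → ℕ) i + C.depth := fun i => by
    simpa using C.run_le_depth i
  refine (C'.run_mono h i).trans ?_
  rw [C'.run_add]
  change C'.run 0 i + C.depth ≤ _
  have := C'.run_le_depth i
  omega

theorem Gate.tick_left {a : ℕ} (b : ℕ) (g : Gate a) (l : Fin a → ℕ) (l' : Fin b → ℕ) :
    (g.left b).tick (Fin.append l l') = Fin.append (g.tick l) l' := by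
  cases g with
  | h i => rw [Gate.left, Gate.tick, Gate.tick, Fin.append_left, append_update_left]
  | cnot i j hij =>
    rw [Gate.left, Gate.tick, Gate.tick, Fin.append_left, Fin.append_left, append_update_left,
      append_update_left]
  | perm p => exact append_comp_perm l l' p (Equiv.refl _)

theorem Gate.tick_right (a : ℕ) {b : ℕ} (g : Gate b) (l : Fin a → ℕ) (l' : Fin b → ℕ) :
    (g.right a).tick (Fin.append l l') = Fin.append l (g.tick l') := by
  cases g with
  | h i => rw [Gate.right, Gate.tick, Gate.tick, Fin.append_right, append_update_right]
  | cnot i j hij =>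
    rw [Gate.right, Gate.tick, Gate.tick, Fin.append_right, Fin.append_right, append_update_right,
      append_update_right]
  | perm p => exact append_comp_perm l l' (Equiv.refl _) p

theorem Circuit.run_left {a : ℕ} (b : ℕ) (C : Circuit a) (l : Fin a → ℕ) (l' : Fin b → ℕ) :
    (C.left b).run (Fin.append l l') = Fin.append (C.run l) l' := by
  induction C generalizing l with
  | nil => rfl
  | cons g C ih =>
    change Circuit.run (Circuit.left b C) ((g.left b).tick _) = _
    rw [g.tick_left, ih]; rfl

theorem Circuit.run_right (a : ℕ) {b : ℕ} (C : Circuit b) (l : Fin a → ℕ) (l' : Fin b → ℕ) :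
    (C.right a).run (Fin.append l l') = Fin.append l (C.run l') := by
  induction C generalizing l' with
  | nil => rfl
  | cons g C ih =>
    change Circuit.run (Circuit.right a C) ((g.right a).tick _) = _
    rw [g.tick_right, ih]; rfl

theorem depth_par_le {a b : ℕ} (C₁ : Circuit a) (C₂ : Circuit b) :
    (par C₁ C₂).depth ≤ max C₁.depth C₂.depth := by
  have h0 : (0 : Fin (a + b) → ℕ) = Fin.append 0 0 := by
    ext i
    refine Fin.addCases (fun i => ?_) (fun i => ?_) i <;> simp
  refine Circuit.depth_le_iff.2 fun i => ?_
  rw [par, Circuit.run_append, h0, Circuit.run_left, Circuit.run_right]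
  refine Fin.addCases (fun i => ?_) (fun i => ?_) i
  · rw [Fin.append_left]; exact (C₁.run_le_depth i).trans (le_max_left _ _)
  · rw [Fin.append_right]; exact (C₂.run_le_depth i).trans (le_max_right _ _)

theorem depth_left_le {a : ℕ} (b : ℕ) (C : Circuit a) : (Circuit.left b C).depth ≤ C.depth := by
  have h := depth_par_le C ([] : Circuit b)
  rw [show par C ([] : Circuit b) = Circuit.left b C from List.append_nil _] at h
  exact h.trans (max_le le_rfl (Circuit.depth_le_iff.2 fun _ => Nat.zero_le _))

theorem run_map_h {n : ℕ} (K : List (Fin n)) (l : Fin n → ℕ) (i : Fin n) :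
    Circuit.run (K.map Gate.h) l i = l i + K.count i := by
  induction K generalizing l with
  | nil => rfl
  | cons k K ih =>
    change Circuit.run (K.map Gate.h) (Function.update l k (l k + 1)) i = _
    rw [ih, List.count_cons, Function.update_apply]
    by_cases h : i = k
    · subst h; simp; omega
    · simp [h, Ne.symm h]

theorem depth_map_h_le {n : ℕ} {K : List (Fin n)} (hK : K.Nodup) :
    Circuit.depth (K.map Gate.h) ≤ 1 :=
  Circuit.depth_le_iff.2 fun i => by
    rw [run_map_h, Pi.zero_apply, zero_add]
    exact List.nodup_iff_count_le_one.1 hK i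

theorem depth_singleton_le {n : ℕ} (g : Gate n) : Circuit.depth [g] ≤ 1 :=
  Circuit.depth_le_iff.2 fun i => by
    change g.tick 0 i ≤ 1
    cases g with
    | h j => simp only [Gate.tick, Function.update_apply]; split_ifs <;> simp
    | cnot j k hjk => simp only [Gate.tick, Function.update_apply]; split_ifs <;> simp
    | perm p => exact Nat.zero_le _

/-- The invariant along the array: qubits of gates still to come are at time `0`, and no qubit is
beyond time `1`. -/
theorem run_map_crossCnot_le {a b : ℕ} {X : List (Fin a × Fin b)} (h₁ : (X.map Prod.fst).Nodup)
    (h₂ : (X.map Prod.snd).Nodup) {l : Fin (a + b) → ℕ}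
    (hl : ∀ e ∈ X, l (Fin.castAdd b e.1) = 0 ∧ l (Fin.natAdd a e.2) = 0) (hl' : ∀ i, l i ≤ 1)
    (i : Fin (a + b)) : Circuit.run (X.map crossCnot) l i ≤ 1 := by
  induction X generalizing l with
  | nil => exact hl' i
  | cons e X ih =>
    rw [List.map_cons, List.nodup_cons] at h₁ h₂
    obtain ⟨he₁, he₂⟩ := hl e List.mem_cons_self
    refine ih h₁.2 h₂.2 (l := (crossCnot e).tick l) (fun e' he' => ?_) fun j => ?_
    · have n₁ : e'.1 ≠ e.1 := fun h => h₁.1 (h ▸ List.mem_map_of_mem he')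
      have n₂ : e'.2 ≠ e.2 := fun h => h₂.1 (h ▸ List.mem_map_of_mem he')
      obtain ⟨e₁, e₂⟩ := hl e' (List.mem_cons_of_mem _ he')
      simp only [crossCnot, Gate.tick]
      rw [Function.update_of_ne (castAdd_ne_natAdd _ _),
        Function.update_of_ne (fun h => n₁ (Fin.castAdd_injective _ _ h)),
        Function.update_of_ne (fun h => n₂ (Fin.natAdd_injective _ _ h)),
        Function.update_of_ne (castAdd_ne_natAdd _ _).symm]
      exact ⟨e₁, e₂⟩
    · simp only [crossCnot, Gate.tick, Function.update_apply, he₁, he₂]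
      have := hl' j
      split_ifs <;> simp [this]

theorem depth_perm_crossCnot_le {a b : ℕ} (p : Equiv.Perm (Fin (a + b)))
    {X : List (Fin a × Fin b)} (h₁ : (X.map Prod.fst).Nodup) (h₂ : (X.map Prod.snd).Nodup) :
    Circuit.depth (Gate.perm p :: X.map crossCnot) ≤ 1 :=
  Circuit.depth_le_iff.2 fun i =>
    run_map_crossCnot_le h₁ h₂ (l := 0) (fun _ _ => ⟨rfl, rfl⟩) (fun _ => Nat.zero_le _) i

theorem depth_stage_le {a b : ℕ} {K : List (Fin (a + b))} (hK : K.Nodup)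
    (p : Equiv.Perm (Fin (a + b))) {X : List (Fin a × Fin b)} (h₁ : (X.map Prod.fst).Nodup)
    (h₂ : (X.map Prod.snd).Nodup) : (stage K p X).depth ≤ 2 :=
  (Circuit.depth_append_le _ _).trans
    (Nat.add_le_add (depth_map_h_le hK) (depth_perm_crossCnot_le p h₁ h₂))

theorem depth_stage_par_le {a b : ℕ} {K : List (Fin (a + b))} (hK : K.Nodup)
    (p : Equiv.Perm (Fin (a + b))) {X : List (Fin a × Fin b)} (h₁ : (X.map Prod.fst).Nodup)
    (h₂ : (X.map Prod.snd).Nodup) {C₁ : Circuit a} {C₂ : Circuit b} {k : ℕ} (hC₁ : C₁.depth ≤ k)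
    (hC₂ : C₂.depth ≤ k) : Circuit.depth (stage K p X ++ par C₁ C₂) ≤ k + 2 := by
  have := Circuit.depth_append_le (stage K p X) (par C₁ C₂)
  have := depth_stage_le hK p h₁ h₂
  have := (depth_par_le C₁ C₂).trans (max_le hC₁ hC₂)
  omega

theorem depth_stage_nil_par_le {a b : ℕ} (p : Equiv.Perm (Fin (a + b))) {X : List (Fin a × Fin b)}
    (h₁ : (X.map Prod.fst).Nodup) (h₂ : (X.map Prod.snd).Nodup) {C₁ : Circuit a} {C₂ : Circuit b}
    {k : ℕ} (hC₁ : C₁.depth ≤ k) (hC₂ : C₂.depth ≤ k) :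
    Circuit.depth (stage [] p X ++ par C₁ C₂) ≤ k + 1 := by
  have := Circuit.depth_append_le (stage [] p X) (par C₁ C₂)
  have : (stage [] p X).depth ≤ 1 := depth_perm_crossCnot_le p h₁ h₂
  have := (depth_par_le C₁ C₂).trans (max_le hC₁ hC₂)
  omega

theorem RecBasisQRM.depth_le {r m : ℕ} {C : Circuit (len m)} {M : List (Word (len m))}
    (h : RecBasisQRM r m C M) : C.depth ≤ m := by
  induction h with
  | base => exact Circuit.depth_le_iff.2 fun _ => Nat.zero_le _
  | step hr hC hp hX ih =>
    obtain rfl := hC.index_eq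
    exact depth_stage_nil_par_le _ (hX.nodup_fst (nodup_G _ _) (Set.injOn_id _) fun _ hu => hu)
      (hX.nodup_snd (nodup_G _ _) fun _ hu => hu) ih ih
  | full hC hp hX ih =>
    obtain rfl := hC.index_eq
    exact depth_stage_nil_par_le _ (hX.nodup_fst (nodup_G _ _) (Set.injOn_id _) fun _ hu => hu)
      (hX.nodup_snd (nodup_G _ _) fun _ hu => hu) ih ih

theorem nodup_of_map_val_eq_range' {n s k : ℕ} {K : List (Fin n)}
    (h : K.map Fin.val = List.range' s k) : K.Nodup :=
  nodup_of_map_val (h ▸ List.nodup_range')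

theorem RecQRM.depth_le {r m : ℕ} {C : Circuit (len m)} {M : List (Word (len m))}
    (h : RecQRM r m C M) : C.depth ≤ 2 * m := by
  induction h with
  | full hC => exact hC.depth_le.trans (by omega)
  | step hr hmr hC hM hK hp hX ih =>
    rw [rowDiff_G] at hX
    have hmem := hC.encodes.mem
    exact depth_stage_par_le (nodup_of_map_val_eq_range' hK) _
      (hX.nodup_fst (nodup_band _ _ _) (Set.injOn_id _) hmem)
      (hX.nodup_snd (nodup_band _ _ _) hmem) ih ih

/-- Two layers for each level; the extra `1` is the initial Hadamard layer of the case `m = r₀`,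
which occurs once along the recursion. -/
theorem RecZQRM.depth_le {r₀ m₀ : ℕ} {r : ℤ} {m : ℕ} {C : Circuit (len m)}
    {M : List (Word (len m))} (h : RecZQRM r₀ m₀ r m C M) : C.depth ≤ 2 * m + 1 := by
  induction h with
  | basis h hC => exact hC.depth_le.trans (by omega)
  | @full C M K h hC hK =>
    have hn : K.Nodup := by
      refine nodup_of_map_val (hK ▸ List.Nodup.map_on (fun u hu v hv e => ?_) (nodup_G _ _))
      refine (List.idxOf_inj (hC.encodes.mem u ?_)).1 e
      have := mem_G.1 hu
      exact mem_band.2 ⟨this.1, by omega, by have := rowDeg_le this.1; omega⟩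
    have := Circuit.depth_append_le (K.map Gate.h) C
    have := depth_map_h_le hn
    have := hC.depth_le
    omega
  | step hr hm hC hM hK hp hX ih =>
    rw [rowDiff_G] at hX
    have hmem := hC.encodes.mem
    exact depth_stage_par_le (nodup_of_map_val_eq_range' hK) _
      (hX.nodup_fst (nodup_band _ _ _) (Set.injOn_id _) hmem)
      (hX.nodup_snd (nodup_band _ _ _) hmem) ih ih

theorem PunctSafe.injOn_self {m : ℕ} {S : Set (Word (len m))} (h : PunctSafe S) :
    Set.InjOn (punct m) S := h.injOn.mono Submodule.subset_span

theorem RecStatePrepPQRM.depth_le {r m : ℕ} {C : Circuit (plen m)} {M : List (Word (plen m))}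
    (h : RecStatePrepPQRM r m C M) : C.depth ≤ 2 * m := by
  have aux : ∀ {r : ℕ} {C₁ : Circuit (plen r)} {C₂ : Circuit (len r)} {M₁ : List (Word (plen r))}
      {M₂ : List (Word (len r))} (p : Equiv.Perm (Fin (plen r + len r)))
      {X : List (Fin (plen r) × Fin (len r))}, RecStatePrepPQRM r r C₁ M₁ → RecQRM r r C₂ M₂ →
      FanOut (punct r) M₁ M₂ (rowDiff (G r r) [1]) X → C₁.depth ≤ 2 * r →
      Circuit.depth (stage [] p X ++ par C₁ C₂) ≤ 2 * (r + 1) := by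
    intro r C₁ C₂ M₁ M₂ p X hC₁ hC₂ hX ih
    rw [rowDiff_G_one] at hX
    have h₁ := hC₁.encodes.mem
    rw [max_eq_right (by omega)] at h₁
    have := depth_stage_nil_par_le p
      (hX.nodup_fst (nodup_band _ _ _) (punctSafe_band_zero _ _).injOn_self
        fun u hu => h₁ _ ⟨u, hu, rfl⟩)
      (hX.nodup_snd (nodup_band _ _ _)
        fun u hu => hC₂.encodes.mem _ (band_subset (by omega) le_rfl hu))
      ih hC₂.depth_le
    omega
  induction h with
  | base => exact Circuit.depth_le_iff.2 fun _ => Nat.zero_le _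
  | full hC₁ hC₂ hM hp hX ih => exact aux _ hC₁ hC₂ hX ih
  | diag hC₁ hC₂ hM hp hX ih => exact aux _ hC₁ hC₂ hX ih
  | @step r m C₁ C₂ M₁ M₂ M K p X hr hmr hC₁ hC₂ hM hK hp hX ih =>
    rw [rowDiff_G] at hX
    have h₁ := hC₁.encodes.mem
    rw [max_eq_left (by omega)] at h₁
    have hs := punctSafe_ones_band (lo := m - r) (hi := r) (m := m) (k := 0) (by omega) (by omega)
      (by omega) (by omega)
    exact depth_stage_par_le (nodup_of_map_val_eq_range' hK) _
      (hX.nodup_fst (nodup_band _ _ _) hs.injOn_self fun u hu => h₁ _ ⟨u, hu, rfl⟩)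
      (hX.nodup_snd (nodup_band _ _ _) hC₂.encodes.mem) ih hC₂.depth_le

/-! ## Rearrangement -/

theorem hCount_append {n : ℕ} (C C' : Circuit n) :
    Circuit.hCount (C ++ C') = C.hCount + C'.hCount := List.countP_append

theorem hCount_left {a : ℕ} (b : ℕ) (C : Circuit a) : (Circuit.left b C).hCount = C.hCount := by
  rw [Circuit.hCount, Circuit.left, List.countP_map]
  exact List.countP_congr fun g _ => by cases g <;> rfl

theorem hCount_right (a : ℕ) {b : ℕ} (C : Circuit b) : (Circuit.right a C).hCount = C.hCount := by
  rw [Circuit.hCount, Circuit.right, List.countP_map]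
  exact List.countP_congr fun g _ => by cases g <;> rfl

theorem hCount_par {a b : ℕ} (C₁ : Circuit a) (C₂ : Circuit b) :
    (par C₁ C₂).hCount = C₁.hCount + C₂.hCount := by
  rw [par, hCount_append, hCount_left, hCount_right]

theorem SameGates.refl {n : ℕ} (C : Circuit n) : SameGates C C := ⟨rfl, rfl, rfl⟩

theorem SameGates.trans {n : ℕ} {C C' C'' : Circuit n} (h : SameGates C C')
    (h' : SameGates C' C'') : SameGates C C'' :=
  ⟨h.mat.trans h'.mat, h.cnots.trans h'.cnots, h.hs.trans h'.hs⟩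

theorem SameGates.append {n : ℕ} {C C' D D' : Circuit n} (h : SameGates C C')
    (h' : SameGates D D') : SameGates (C ++ D) (C' ++ D') where
  mat := by rw [Circuit.mat_append, Circuit.mat_append, h.mat, h'.mat]
  cnots := by rw [cnotCount_append, cnotCount_append, h.cnots, h'.cnots]
  hs := by rw [hCount_append, hCount_append, h.hs, h'.hs]

theorem SameGates.left {a : ℕ} (b : ℕ) {C C' : Circuit a} (h : SameGates C C') :
    SameGates (Circuit.left b C) (Circuit.left b C') where
  mat := by rw [Circuit.left_mat, Circuit.left_mat, h.mat]
  cnots := by rw [cnotCount_left, cnotCount_left, h.cnots]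
  hs := by rw [hCount_left, hCount_left, h.hs]

theorem SameGates.par {a b : ℕ} {C₁ C₁' : Circuit a} (h : SameGates C₁ C₁') (C₂ : Circuit b) :
    SameGates (par C₁ C₂) (QRMEnc.par C₁' C₂) := (h.left b).append (.refl _)

theorem RecBasisQRM.hCount {r m : ℕ} {C : Circuit (len m)} {M : List (Word (len m))}
    (h : RecBasisQRM r m C M) : C.hCount = 0 := by
  have hs : ∀ {n : ℕ} (p : Equiv.Perm (Fin (n + n))) (X : List (Fin n × Fin n)),
      Circuit.hCount (stage [] p X) = 0 := fun p X => hCount_perm_crossCnot p X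
  induction h with
  | base => rfl
  | step hr hC hp hX ih => rw [hCount_append, hs, hCount_par, ih]
  | full hC hp hX ih => rw [hCount_append, hs, hCount_par, ih]

theorem ket_injective (n : ℕ) : Function.Injective (ket : Word n → State n) := fun x y h => by
  have := congrFun h x
  rw [ket_apply, ket_apply, if_pos rfl] at this
  by_contra hne
  rw [if_neg hne] at this
  exact one_ne_zero this

/-- The circuit `U^c(r, r + 1)` fixes the unit word of the last qubit. -/
theorem RecBasisQRM.bits_last {r : ℕ} {C : Circuit (len (r + 1))} {M : List (Word (len (r + 1)))}
    (h : RecBasisQRM r (r + 1) C M) {c : Fin (len (r + 1))} (hc : (c : ℕ) + 1 = len (r + 1)) :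
    C.bits (Pi.single c 1) = Pi.single c 1 := by
  have hE := h.encodes_fullRows.enc _ _ (mem_msgRel (lastRow_mem (r + 1)))
  have hi := fullRows_idxOf_lastRow (r + 1)
  -- The row `0…01` is carried by the last qubit and is also the unit word of that qubit; encoding
  -- it means fixing it.
  rw [show (fullRows (r + 1)).idxOf (lastRow (r + 1)) = c by omega, unitWord_val,
    Circuit.mat_mulVec_ket h.hCount, Submodule.span_empty, cosetState_bot] at hE
  rw [ket_injective _ hE, single_last_eq hc]

/-- A CNOT gate from the second part commutes with a circuit on the first part that fixes the unit
word of its target. -/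
theorem sameGates_cnot_left {a b : ℕ} {Q : Circuit a} (hQ : Q.hCount = 0) {t : Fin a}
    (ht : Q.bits (Pi.single t 1) = Pi.single t 1) (c : Fin b) :
    SameGates (Q.left b ++ [Gate.cnot (Fin.natAdd a c) (Fin.castAdd b t)
        (castAdd_ne_natAdd t c).symm])
      (Gate.cnot (Fin.natAdd a c) (Fin.castAdd b t) (castAdd_ne_natAdd t c).symm :: Q.left b) := by
  have hg : (Gate.cnot (Fin.natAdd a c) (Fin.castAdd b t) (castAdd_ne_natAdd t c).symm).isH =
    false := rfl
  have hbits : ∀ (x : Word a) (y : Word b), (Gate.cnot (Fin.natAdd a c) (Fin.castAdd b t)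
      (castAdd_ne_natAdd t c).symm).bits (Fin.append x y) =
        Fin.append (x + y c • (Pi.single t 1 : Word a)) y := fun x y => by
    rw [Gate.bits_cnot, Fin.append_left, Fin.append_right, append_update_left]
    congr 1
    ext k
    by_cases hk : k = t
    · subst hk; simp
    · simp [hk]
  have hh : Circuit.hCount (Q.left b) = 0 := (hCount_left b Q).trans hQ
  generalize Gate.cnot (Fin.natAdd a c) (Fin.castAdd b t) _ = g at hbits hg ⊢
  have hperm := List.perm_append_singleton g (Q.left b)
  have hg' : Circuit.hCount (g :: Q.left b) = 0 :=
    (List.countP_cons_of_neg (by simp [hg])).trans hh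
  refine ⟨Circuit.mat_eq_of_bits ((hperm.countP_eq _).trans hg') hg' fun y => ?_,
    hperm.countP_eq _, hperm.countP_eq _⟩
  obtain ⟨x, y, rfl⟩ : ∃ (x' : Word a) (y' : Word b), y = Fin.append x' y' :=
    ⟨_, _, (append_parts y).symm⟩
  rw [Circuit.bits_append]
  change g.bits ((Circuit.left b Q).bits (Fin.append x y)) =
    (Circuit.left b Q).bits (g.bits (Fin.append x y))
  -- Linearity of `Q` gives `Q (x + y c • e_t) = Q x + y c • e_t`, since `Q` fixes `e_t`.
  rw [Circuit.left_bits, hbits, hbits, Circuit.left_bits, map_add, map_smul, ht]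

/-- The circuit `U^*(r, r + 1)` splits into a first part of depth `2r` and a second part of depth
`r` that fixes the unit word of the last qubit. -/
theorem RecPQRM.exists_split {r : ℕ} {C : Circuit (plen (r + 1))} {M : List (Word (plen (r + 1)))}
    (h : RecPQRM r (r + 1) C M) : ∃ P Q : Circuit (plen (r + 1)), SameGates C (P ++ Q) ∧
      P.depth ≤ 2 * r ∧ Q.depth ≤ r ∧ Q.hCount = 0 ∧
      ∀ t : Fin (plen (r + 1)), (t : ℕ) + 1 = plen (r + 1) →
        Q.bits (Pi.single t 1) = Pi.single t 1 := by
  induction r with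
  | zero =>
    cases h with
    | base => exact ⟨[], [], .refl _, Circuit.depth_le_iff.2 fun _ => Nat.zero_le _,
        Circuit.depth_le_iff.2 fun _ => Nat.zero_le _, rfl, fun _ _ => rfl⟩
    | step hr => omega
  | succ r ih =>
    cases h with
    | step hr => omega
    | @diag _ C₁ C₂ M₁ M₂ _ p X e c t hC₁ hC₂ hM hp hc ht he hpe hX =>
      obtain ⟨P, Q, hPQ, hP, hQ, hQh, hQt⟩ := ih hC₁
      obtain rfl := hC₂.index_eq
      have hs := punctSafe_G (r := (r : ℤ)) (m := r + 1) (by omega)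
      have hst : (stage [] p X).depth ≤ 1 := depth_perm_crossCnot_le p
        (hX.nodup_fst (nodup_G _ _) hs.injOn_self fun u hu => by
          rw [hC₁.index_eq_of_diag]; exact List.mem_map_of_mem hu)
        (hX.nodup_snd (nodup_G _ _) fun u hu => hu)
      let g : Gate (plen (r + 1) + len (r + 1)) := Gate.cnot (Fin.natAdd (plen (r + 1)) c)
        (Fin.castAdd (len (r + 1)) t) (castAdd_ne_natAdd t c).symm
      -- The part `Q` of the first circuit passes behind the additional CNOT and runs next to `C₂`.
      -- The depths are `1 + 2 r + 1` for the new first part and `max r (r + 1)` for the new second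
      -- part, so the total grows linearly; adding the depths of `C₁` and `C₂` at every level would
      -- give a quadratic bound.
      refine ⟨(stage [] p X ++ P.left _) ++ [g], par Q C₂, ?_, ?_, ?_, ?_, ?_⟩
      · have h₁ : SameGates (stage [] p X ++ C₁.left (len (r + 1)) ++ g :: C₂.right (plen (r + 1)))
            (stage [] p X ++ (P ++ Q).left (len (r + 1)) ++ g :: C₂.right (plen (r + 1))) :=
          ((SameGates.refl _).append (hPQ.left _)).append (.refl _)
        refine h₁.trans ?_
        have h₂ := ((SameGates.refl (stage [] p X ++ P.left (len (r + 1)))).append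
          (sameGates_cnot_left hQh (hQt t ht) c)).append (.refl (C₂.right (plen (r + 1))))
        have e₁ : (P ++ Q).left (len (r + 1)) = P.left (len (r + 1)) ++ Q.left (len (r + 1)) :=
          List.map_append
        rw [e₁]
        simp only [par, List.append_assoc, List.cons_append, List.nil_append] at h₂ ⊢
        exact h₂
      · have h₁ := Circuit.depth_append_le (stage [] p X ++ P.left (len (r + 1))) [g]
        have h₂ := Circuit.depth_append_le (stage [] p X) (P.left (len (r + 1)))
        have h₃ := depth_left_le (len (r + 1)) P
        have h₄ := depth_singleton_le g
        exact h₁.trans (by omega)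
      · exact (depth_par_le Q C₂).trans (max_le (hQ.trans (Nat.le_succ r)) hC₂.depth_le)
      · exact (hCount_par Q C₂).trans (by rw [hQh, hC₂.hCount])
      · intro t' ht'
        have hp' : (t' : ℕ) + 1 = plen (r + 1) + len (r + 1) := ht'
        -- The last qubit of the whole register is the last qubit of the second part, where `C₂`
        -- fixes its unit word.
        have e : (Pi.single t' 1 : Word (plen (r + 1) + len (r + 1))) =
            Fin.append 0 (Pi.single c 1) := by
          rw [← unitWord_val, ← unitWord_val, ← unitWord_right]
          congr 1
          omega
        change (par Q C₂).bits (Pi.single t' 1 : Word (plen (r + 1) + len (r + 1))) =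
          (Pi.single t' 1 : Word (plen (r + 1) + len (r + 1)))
        rw [e, par, Circuit.bits_append, LinearMap.comp_apply, Circuit.left_bits,
          Circuit.right_bits, map_zero, hC₂.bits_last hc]

theorem RecPQRM.exists_depth_le_diag {r : ℕ} {C : Circuit (plen (r + 1))}
    {M : List (Word (plen (r + 1)))} (h : RecPQRM r (r + 1) C M) :
    ∃ C', SameGates C C' ∧ C'.depth ≤ 3 * r := by
  obtain ⟨P, Q, hPQ, hP, hQ, -⟩ := h.exists_split
  have := Circuit.depth_append_le P Q
  exact ⟨P ++ Q, hPQ, by omega⟩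

theorem RecPQRM.exists_depth_le {r m : ℕ} {C : Circuit (plen m)} {M : List (Word (plen m))}
    (h : RecPQRM r m C M) : ∃ C', SameGates C C' ∧ C'.depth ≤ 3 * m := by
  induction m with
  | zero => exact absurd h.lt (Nat.not_lt_zero r)
  | succ m ih =>
    by_cases hr : r = m
    · subst hr
      obtain ⟨C', h₁, h₂⟩ := h.exists_depth_le_diag
      exact ⟨C', h₁, by omega⟩
    · cases h with
      | base => exact absurd rfl hr
      | diag => exact absurd rfl hr
      | @step _ _ C₁ C₂ M₁ M₂ _ K p X hr' hmr hC₁ hC₂ hM hK hp hX =>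
        rw [rowDiff_G] at hX
        obtain ⟨C', h₁, h₂⟩ := ih hC₁
        have hs := punctSafe_ones_band (lo := m - r) (hi := r) (m := m) (k := 0) (by omega)
          (by omega) (by omega) (by omega)
        have := depth_stage_par_le (nodup_of_map_val_eq_range' hK) p
          (hX.nodup_fst (nodup_band _ _ _) hs.injOn_self
            fun u hu => hC₁.encodes.mem _ ⟨u, List.mem_cons_of_mem _ hu, rfl⟩)
          (hX.nodup_snd (nodup_band _ _ _) hC₂.encodes.mem) h₂
          (hC₂.depth_le.trans (show 2 * m ≤ 3 * m by omega))
        exact ⟨_, (SameGates.refl _).append (h₁.par C₂), this.trans (by omega)⟩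

theorem RecBasisPQRM.exists_depth_le {r m : ℕ} {C : Circuit (plen m)} {M : List (Word (plen m))}
    (h : RecBasisPQRM r m C M) : ∃ C', SameGates C C' ∧ C'.depth ≤ 3 * m := by
  induction h with
  | diag hC => exact hC.exists_depth_le
  | @step m C₁ C₂ M₁ M₂ M p X hr hC₁ hC₂ hM hp hX ih =>
    obtain ⟨C', h₁, h₂⟩ := ih
    have hs := punctSafe_G (r := (r : ℤ)) (m := m) (by omega)
    have := depth_stage_nil_par_le p
      (hX.nodup_fst (nodup_G _ _) hs.injOn_self fun u hu => by
        rw [hC₁.index_eq]; exact List.mem_map_of_mem hu)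
      (hX.nodup_snd (nodup_G _ _) fun u hu => hC₂.index_eq.symm ▸ hu) h₂
      (hC₂.depth_le.trans (show m ≤ 3 * m by omega))
    exact ⟨_, (SameGates.refl _).append (h₁.par C₂), this.trans (by omega)⟩

theorem RecPZQRM.exists_depth_le {r₀ m₀ r m : ℕ} {C : Circuit (plen m)} {M : List (Word (plen m))}
    (h : RecPZQRM r₀ m₀ r m C M) (hr : r ≤ r₀) :
    ∃ C', SameGates C C' ∧ C'.depth ≤ 3 * m + 1 := by
  induction h with
  | basis h hC =>
    obtain ⟨C', h₁, h₂⟩ := hC.exists_depth_le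
    exact ⟨C', h₁, by omega⟩
  | @full C M K h hC hK =>
    obtain ⟨C', h₁, h₂⟩ := hC.exists_depth_le
    rw [rowDiff_G_one] at hK
    have hs : PunctSafe {g | g ∈ band 0 ((2 * r₀ + 1 - m₀ : ℕ) : ℤ) (r₀ + 1)} :=
      punctSafe_band_zero _ _
    have hn : K.Nodup := by
      refine nodup_of_map_val (hK ▸ List.Nodup.map_on (fun u hu v hv e => ?_) (nodup_band _ _ _))
      refine hs.injOn_self hu hv ((List.idxOf_inj ?_).1 e)
      rw [hC.index_eq_of_diag]
      refine List.mem_map_of_mem (mem_G.2 ?_)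
      have := mem_band.1 hu
      exact ⟨this.1, by omega⟩
    have := Circuit.depth_append_le (K.map Gate.h) C'
    have := depth_map_h_le hn
    exact ⟨_, (SameGates.refl _).append h₁, by omega⟩
  | @step r m C₁ C₂ M₁ M₂ M K p X hr' hm hC₁ hC₂ hM hK hp hX ih =>
    rw [rowDiff_G] at hX
    obtain ⟨C', h₁, h₂⟩ := ih (by omega)
    have hs : PunctSafe {g | g ∈ band r r₀ m} := (punctSafe_G (r := (r₀ : ℤ)) (m := m)
      (by omega)).mono fun g hg => mem_G.2 ⟨(mem_band.1 hg).1, (mem_band.1 hg).2.2⟩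
    have hE := hC₁.encodes (by omega)
    have := depth_stage_par_le (nodup_of_map_val_eq_range' hK) p
      (hX.nodup_fst (nodup_band _ _ _) hs.injOn_self
        fun u hu => hE.mem _ ⟨u, List.mem_cons_of_mem _ hu, rfl⟩)
      (hX.nodup_snd (nodup_band _ _ _) hC₂.encodes.mem) h₂
      (hC₂.depth_le.trans (show 2 * m + 1 ≤ 3 * m + 1 by omega))
    exact ⟨_, (SameGates.refl _).append (h₁.par C₂), this.trans (by omega)⟩

/-! ## Logarithmic bounds -/

theorem le_log_len {d m : ℕ} (h : d ≤ 7 * m) : (d : ℝ) ≤ 7 / Real.log 2 * Real.log (len m) := by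
  have h2 : 0 < Real.log 2 := Real.log_pos one_lt_two
  rw [len_eq, Nat.cast_pow, Nat.cast_ofNat, Real.log_pow, mul_comm (m : ℝ), ← mul_assoc,
    div_mul_cancel₀ _ h2.ne']
  exact_mod_cast h

/-- The punctured length is at least `2 ^ (m - 1)`, so `m - 1` takes the place of `m`. -/
theorem le_log_plen {d m : ℕ} (hm : 1 ≤ m) (h : d ≤ 7 * (m - 1)) :
    (d : ℝ) ≤ 7 / Real.log 2 * Real.log (plen m) := by
  obtain ⟨m, rfl⟩ : ∃ k, m = k + 1 := ⟨m - 1, by omega⟩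
  refine (le_log_len (m := m) h).trans (mul_le_mul_of_nonneg_left ?_ ?_)
  · have hl := len_pos m
    refine Real.log_le_log (by exact_mod_cast hl) ?_
    rw [plen]
    exact_mod_cast Nat.le_add_left _ _
  · exact div_nonneg (by norm_num) (Real.log_pos one_lt_two).le

end QRMEnc

/-! ### The theorem -/

theorem mainTheorem7 :
    -- `U(r, m)`: existence, encoder, structure of the recursive step
    (∀ r m : ℕ, m ≤ 2 * r + 1 → r ≤ m → ∃ C M, RecQRM r m C M) ∧
    (∀ (r m : ℕ) (C : Circuit (len m)) (M : List (Word (len m))),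
      m ≤ 2 * r + 1 → r ≤ m → RecQRM r m C M →
      IsEncoder (dual (RM r m)) (RM r m) (rowDiff (G r m) (G ((m : ℤ) - r - 1) m)) Fin.val
        C.mat) ∧
    (∀ (r m : ℕ) (C : Circuit (len (m + 1))) (M : List (Word (len (m + 1)))),
      m ≤ 2 * r → r ≤ m → RecQRM r (m + 1) C M →
      ∃ (K : List (Fin (len m + len m))) (p : Equiv.Perm (Fin (len m + len m)))
        (X : List (Fin (len m) × Fin (len m))) (C' : Circuit (len m)) (M' : List (Word (len m))),
        RecQRM r m C' M' ∧ C = stage K p X ++ par C' C' ∧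
        K.Nodup ∧ K.length = m.choose (m - r) ∧
        (X.map Prod.fst).Nodup ∧ (X.map Prod.snd).Nodup ∧
        X.length = ∑ i ∈ Finset.Icc (m - r) r, m.choose i) ∧
    -- `U^c(r, m)`
    (∀ r m : ℕ, r ≤ m → ∃ C M, RecBasisQRM r m C M) ∧
    (∀ (r m : ℕ) (C : Circuit (len m)) (M : List (Word (len m))),
      r ≤ m → RecBasisQRM r m C M →
      IsEncoder ⊥ (RM r m) (G r m) Fin.val C.mat) ∧
    -- `U^*(r, m)`
    (∀ r m : ℕ, m ≤ 2 * r + 1 → r < m → ∃ C M, RecPQRM r m C M) ∧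
    (∀ (r m : ℕ) (C : Circuit (plen m)) (M : List (Word (plen m))),
      m ≤ 2 * r + 1 → r < m → RecPQRM r m C M →
      IsEncoder (dual (pRM r m)) (pRM r m)
        ((1 :: rowDiff (G r m) (G ((m : ℤ) - r - 1) m)).map (punct m)) Fin.val
        C.mat) ∧
    -- `U^{(*,c)}(r, m)`
    (∀ r m : ℕ, r < m → ∃ C M, RecBasisPQRM r m C M) ∧
    (∀ (r m : ℕ) (C : Circuit (plen m)) (M : List (Word (plen m))),
      r < m → RecBasisPQRM r m C M →
      IsEncoder ⊥ (pRM r m) ((G r m).map (punct m)) Fin.val C.mat) ∧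
    -- `U^{(*,s)}(r, m)`
    (∀ r m : ℕ, m ≤ 2 * r + 1 → r ≤ m → ∃ C M, RecStatePrepPQRM r m C M) ∧
    (∀ (r m : ℕ) (C : Circuit (plen m)) (M : List (Word (plen m))),
      m ≤ 2 * r + 1 → r ≤ m → RecStatePrepPQRM r m C M →
      IsEncoder (dual (pRM r m)) (pRMmod r m)
        ((rowDiff (rowDiff (G r m) (G ((m : ℤ) - r - 1) m)) [1]).map (punct m)) Fin.val
        C.mat) ∧
    -- `U^{(0)}(r, m; r₀, m₀)`
    (∀ (r₀ m₀ : ℕ) (r : ℤ) (m : ℕ), ZRange r₀ m₀ r m → ∃ C M, RecZQRM r₀ m₀ r m C M) ∧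
    (∀ (r₀ m₀ : ℕ) (r : ℤ) (m : ℕ) (C : Circuit (len m)) (M : List (Word (len m))),
      ZRange r₀ m₀ r m → RecZQRM r₀ m₀ r m C M →
      IsEncoder (RM r m) (RM r₀ m) (rowDiff (G r₀ m) (G r m))
        (fun j => M.idxOf (rowDiff (G r₀ m) (G r m))[j]) C.mat) ∧
    -- `U^{(*,0)}(r, m; r₀, m₀)`
    (∀ r₀ m₀ r m : ℕ, PZRange r₀ m₀ r m → ∃ C M, RecPZQRM r₀ m₀ r m C M) ∧
    (∀ (r₀ m₀ r m : ℕ) (C : Circuit (plen m)) (M : List (Word (plen m))),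
      PZRange r₀ m₀ r m → RecPZQRM r₀ m₀ r m C M →
      IsEncoder (pRMmod r m) (pRM r₀ m)
        ((1 :: rowDiff (G r₀ m) (G r m)).map (punct m))
        (fun j => M.idxOf ((1 :: rowDiff (G r₀ m) (G r m)).map (punct m))[j])
        C.mat) ∧
    -- CNOT counts of `U` and `U^c`
    (∀ r m C M C' M', m ≤ 2 * r → r ≤ m → RecQRM r (m + 1) C M → RecQRM r m C' M' →
      C.cnotCount = (∑ i ∈ Finset.Icc (m - r) r, m.choose i) + 2 * C'.cnotCount) ∧
    (∀ m C M, RecQRM m m C M → C.cnotCount = m * 2 ^ (m - 1)) ∧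
    (∀ r m C M C' M', r ≤ m → RecBasisQRM r (m + 1) C M → RecBasisQRM r m C' M' →
      C.cnotCount = (∑ i ∈ Finset.Icc 0 r, m.choose i) + 2 * C'.cnotCount) ∧
    (∀ m C M, RecBasisQRM m m C M → C.cnotCount = m * 2 ^ (m - 1)) ∧
    -- CNOT counts of `U^*` and `U^{(*,c)}`
    (∀ r m C M C₁ M₁ C₂ M₂, m ≤ 2 * r → r < m →
      RecPQRM r (m + 1) C M → RecPQRM r m C₁ M₁ → RecQRM r m C₂ M₂ →
      C.cnotCount = (∑ i ∈ Finset.Icc (m - r) r, m.choose i) + C₁.cnotCount + C₂.cnotCount) ∧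
    (∀ r C M C₁ M₁ C₂ M₂,
      RecPQRM (r + 1) (r + 2) C M → RecPQRM r (r + 1) C₁ M₁ → RecBasisQRM r (r + 1) C₂ M₂ →
      C.cnotCount = 2 ^ (r + 1) + C₁.cnotCount + C₂.cnotCount) ∧
    (∀ C M, RecPQRM 0 1 C M → C.cnotCount = 0) ∧
    (∀ r m C M C₁ M₁ C₂ M₂, r < m →
      RecBasisPQRM r (m + 1) C M → RecBasisPQRM r m C₁ M₁ → RecBasisQRM r m C₂ M₂ →
      C.cnotCount = (∑ i ∈ Finset.Icc 0 r, m.choose i) + C₁.cnotCount + C₂.cnotCount) ∧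
    (∀ r C M C₁ M₁, RecBasisPQRM r (r + 1) C M → RecPQRM r (r + 1) C₁ M₁ →
      C.cnotCount = C₁.cnotCount) ∧
    -- CNOT counts of `U^{(*,s)}`
    (∀ r m C M C₁ M₁ C₂ M₂, m ≤ 2 * r → r < m →
      RecStatePrepPQRM r (m + 1) C M → RecStatePrepPQRM r m C₁ M₁ → RecQRM r m C₂ M₂ →
      C.cnotCount = (∑ i ∈ Finset.Icc (m - r) r, m.choose i) + C₁.cnotCount + C₂.cnotCount) ∧
    (∀ r C M C₁ M₁ C₂ M₂,
      RecStatePrepPQRM r (r + 1) C M → RecStatePrepPQRM r r C₁ M₁ → RecQRM r r C₂ M₂ →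
      C.cnotCount = (2 ^ r - 1) + C₁.cnotCount + C₂.cnotCount) ∧
    (∀ r C M C₁ M₁ C₂ M₂,
      RecStatePrepPQRM (r + 1) (r + 1) C M → RecStatePrepPQRM r r C₁ M₁ → RecQRM r r C₂ M₂ →
      C.cnotCount = (2 ^ r - 1) + C₁.cnotCount + C₂.cnotCount) ∧
    (∀ C M, RecStatePrepPQRM 1 1 C M → C.cnotCount = 0) ∧
    -- CNOT counts of `U^{(0)}`
    (∀ r₀ m₀ m C M C' M', 2 * r₀ + 1 ≤ m₀ → ZRange r₀ m₀ (-1) m →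
      RecZQRM r₀ m₀ (-1) m C M → RecBasisQRM r₀ m C' M' → C.cnotCount = C'.cnotCount) ∧
    (∀ (r₀ m₀ : ℕ) (r : ℤ) C M C' M', m₀ < 2 * r₀ + 1 → ZRange r₀ m₀ r r₀ →
      RecZQRM r₀ m₀ r r₀ C M → RecQRM r₀ r₀ C' M' → C.cnotCount = C'.cnotCount) ∧
    (∀ (r₀ m₀ r m : ℕ) C M C' M', ZRange r₀ m₀ r (m + 1) → r₀ ≤ m →
      RecZQRM r₀ m₀ r (m + 1) C M → RecZQRM r₀ m₀ ((r : ℤ) - 1) m C' M' →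
      C.cnotCount = (∑ i ∈ Finset.Icc r r₀, m.choose i) + 2 * C'.cnotCount) ∧
    -- CNOT counts of `U^{(*,0)}`
    (∀ r₀ m₀ m C M C' M', 2 * r₀ + 1 ≤ m₀ → PZRange r₀ m₀ 0 m →
      RecPZQRM r₀ m₀ 0 m C M → RecBasisPQRM r₀ m C' M' → C.cnotCount = C'.cnotCount) ∧
    (∀ r₀ m₀ r C M C' M', m₀ < 2 * r₀ + 1 → PZRange r₀ m₀ r (r₀ + 1) →
      RecPZQRM r₀ m₀ r (r₀ + 1) C M → RecPQRM r₀ (r₀ + 1) C' M' →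
      C.cnotCount = C'.cnotCount) ∧
    (∀ r₀ m₀ r m C M C₁ M₁ C₂ M₂, PZRange r₀ m₀ (r + 1) (m + 1) → r₀ + 1 ≤ m →
      RecPZQRM r₀ m₀ (r + 1) (m + 1) C M → RecPZQRM r₀ m₀ r m C₁ M₁ →
      RecZQRM r₀ m₀ r m C₂ M₂ →
      C.cnotCount = (∑ i ∈ Finset.Icc (r + 1) r₀, m.choose i) + C₁.cnotCount + C₂.cnotCount) ∧
    -- logarithmic depth, with one absolute constant
    (∃ A : ℝ,
      (∀ r m C M, m ≤ 2 * r + 1 → r ≤ m → 1 ≤ m → RecQRM r m C M →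
        (C.depth : ℝ) ≤ A * Real.log (len m)) ∧
      (∀ r m C M, r ≤ m → 1 ≤ m → RecBasisQRM r m C M →
        (C.depth : ℝ) ≤ A * Real.log (len m)) ∧
      (∀ r m C M, m ≤ 2 * r + 1 → r ≤ m → 2 ≤ m → RecStatePrepPQRM r m C M →
        (C.depth : ℝ) ≤ A * Real.log (plen m)) ∧
      (∀ (r₀ m₀ : ℕ) (r : ℤ) (m : ℕ) C M, ZRange r₀ m₀ r m → 1 ≤ m → RecZQRM r₀ m₀ r m C M →
        (C.depth : ℝ) ≤ A * Real.log (len m)) ∧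
      (∀ r m C M, m ≤ 2 * r + 1 → r < m → 2 ≤ m → RecPQRM r m C M →
        ∃ C', SameGates C C' ∧ (C'.depth : ℝ) ≤ A * Real.log (plen m)) ∧
      (∀ r m C M, r < m → 2 ≤ m → RecBasisPQRM r m C M →
        ∃ C', SameGates C C' ∧ (C'.depth : ℝ) ≤ A * Real.log (plen m)) ∧
      (∀ r₀ m₀ r m C M, PZRange r₀ m₀ r m → 2 ≤ m → RecPZQRM r₀ m₀ r m C M →
        ∃ C', SameGates C C' ∧ (C'.depth : ℝ) ≤ A * Real.log (plen m))) ∧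
    (∀ r C M, RecPQRM r (r + 1) C M → ∃ C', SameGates C C' ∧ C'.depth ≤ 3 * r) := by
  refine ⟨fun r m hm hr => exists_recQRM hm hr, fun r m C M hm hr h => h.isEncoder hm hr,
    fun r m C M _ hr h => h.exists_step hr, fun r m hr => exists_recBasisQRM hr,
    fun r m C M _ h => h.isEncoder, fun r m hm hr => exists_recPQRM hm hr,
    fun r m C M hm hr h => h.isEncoder hm hr, fun r m hr => exists_recBasisPQRM hr,
    fun r m C M _ h => h.isEncoder, fun r m hm hr => exists_recStatePrepPQRM hm hr,
    fun r m C M hm hr h => h.isEncoder hm hr, fun r₀ m₀ r m h => exists_recZQRM h,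
    fun r₀ m₀ r m C M hz h => h.isEncoder hz, fun r₀ m₀ r m h => exists_recPZQRM h,
    fun r₀ m₀ r m C M hz h => h.isEncoder hz, ?_, ?_, ?_, ?_, ?_, ?_, ?_, ?_, ?_, ?_, ?_, ?_, ?_,
    ?_, ?_, ?_, ?_, ?_, ?_, ?_, ?_⟩
  · intro r m C M C' M' hm hr h h'
    rw [h.cnotCount, h'.cnotCount, qrmCount, if_pos hr, length_band (a := m - r) (by omega)]
  · intro m C M h
    rw [h.cnotCount, qrmCount_self, basisCount_self]
  · intro r m C M C' M' hr h h'
    rw [h.cnotCount, h'.cnotCount, basisCount, if_pos hr, length_G]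
  · intro m C M h
    rw [h.cnotCount, basisCount_self]
  · intro r m C M C₁ M₁ C₂ M₂ hm hr h h₁ h₂
    rw [h.cnotCount, h₁.cnotCount, h₂.cnotCount, puncturedCount_succ hr,
      length_band (a := m - r) (by omega)]
  · intro r C M C₁ M₁ C₂ M₂ h h₁ h₂
    rw [h.cnotCount, h₁.cnotCount, h₂.cnotCount, puncturedCount, if_neg (by omega)]
  · intro C M h
    exact h.cnotCount
  · intro r m C M C₁ M₁ C₂ M₂ hr h h₁ h₂
    rw [h.cnotCount, h₁.cnotCount, h₂.cnotCount, basisPuncturedCount, if_pos hr, length_G]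
  · intro r C M C₁ M₁ h h₁
    rw [h.cnotCount, h₁.cnotCount, basisPuncturedCount, if_neg (by omega)]
  · intro r m C M C₁ M₁ C₂ M₂ hm hr h h₁ h₂
    rw [h.cnotCount, h₁.cnotCount, h₂.cnotCount, prepCount, if_pos hr,
      length_band (a := m - r) (by omega)]
  · intro r C M C₁ M₁ C₂ M₂ h h₁ h₂
    rw [h.cnotCount, h₁.cnotCount, h₂.cnotCount, prepCount, if_neg (by omega)]
  · intro r C M C₁ M₁ C₂ M₂ h h₁ h₂
    rw [h.cnotCount, h₁.cnotCount, h₂.cnotCount, prepCount, if_neg (by omega)]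
  · intro C M h
    exact h.cnotCount
  · intro r₀ m₀ m C M C' M' _ _ h h'
    rw [h.cnotCount, h'.cnotCount, zeroCount_neg_one]
  · intro r₀ m₀ r C M C' M' _ _ h h'
    rw [h.cnotCount, h'.cnotCount, zeroCount_self, qrmCount_self]
  · intro r₀ m₀ r m C M C' M' _ hm h h'
    rw [h.cnotCount, h'.cnotCount, zeroCount_succ _ hm, length_band (a := r) (by omega)]
  · intro r₀ m₀ m C M C' M' _ _ h h'
    rw [h.cnotCount, h'.cnotCount, zeroPuncturedCount_zero]
  · intro r₀ m₀ r C M C' M' _ _ h h'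
    rw [h.cnotCount, h'.cnotCount, zeroPuncturedCount_diag]
  · intro r₀ m₀ r m C M C₁ M₁ C₂ M₂ _ hm h h₁ h₂
    rw [h.cnotCount, h₁.cnotCount, h₂.cnotCount, zeroPuncturedCount_succ _ hm,
      length_band (a := r + 1) (by omega)]
  -- The largest depth bound is `3 m + 1` on `2 ^ m - 1` qubits with `m ≥ 2`, and `3 m + 1 ≤ 7 (m -
  -- 1)` is sharp at `m = 2`; the division by `log 2` converts to the natural logarithm.
  · refine ⟨7 / Real.log 2, ?_, ?_, ?_, ?_, ?_, ?_, ?_⟩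
    · exact fun r m C M _ _ hm h => le_log_len (h.depth_le.trans (by omega))
    · exact fun r m C M _ hm h => le_log_len (h.depth_le.trans (by omega))
    · exact fun r m C M _ _ hm h => le_log_plen (by omega) (h.depth_le.trans (by omega))
    · exact fun r₀ m₀ r m C M _ hm h => le_log_len (h.depth_le.trans (by omega))
    · intro r m C M _ _ hm h
      obtain ⟨C', h₁, h₂⟩ := h.exists_depth_le
      exact ⟨C', h₁, le_log_plen (by omega) (h₂.trans (by omega))⟩
    · intro r m C M _ hm h
      obtain ⟨C', h₁, h₂⟩ := h.exists_depth_le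
      exact ⟨C', h₁, le_log_plen (by omega) (h₂.trans (by omega))⟩
    · intro r₀ m₀ r m C M hz hm h
      obtain ⟨C', h₁, h₂⟩ := h.exists_depth_le hz.1
      exact ⟨C', h₁, le_log_plen (by omega) (h₂.trans (by omega))⟩
  · exact fun r C M h => h.exists_depth_le_diag
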